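/- Let $k$ be a field of characteristic $0$, $\Delta=\mathrm{Spec}\,A$ an integral affine curve over $k$ with a $k$-rational point $0$ at which it is smooth (more generally, $A$ may be any integral domain over $k$ whose localization at the maximal ideal of such a point is a discrete valuation ring), and $t\in A$ a local coordinate at $0$. Let $\mathcal{X}\subset\Delta\times\mathbb{A}^l$ be a closed subscheme, flat over $\Delta$, that contains the zero section; let $x=(0,0)$ and let $X=\mathcal{X}\cap(\{0\}\times\mathbb{A}^l)$ be the central fibre. Let $z_1,\dots,z_l$ be the coordinates of $\mathbb{A}^l$. For weights $w_0>0$ (of $t$) and $w_1,\dots,w_l>0$ (of $z_1,\dots,z_l$) in $\mathbb{R}$, the weight $w(F)$ of $F\in\mathcal{O}_{\Delta\times\mathbb{A}^l,(0,0)}$ with Taylor expansion $F=\sum a_{i_0,\dots,i_l}t^{i_0}z_1^{i_1}\cdots z_l^{i_l}$ is $\min\{\sum_j w_ji_j\mid a_{i_0,\dots,i_l}\neq0\}$ (and $\infty$ if $F=0$), and $$\mathrm{gr}_{w_0,\dots,w_l}\mathcal{O}_{\mathcal{X},x}=\bigoplus_{m\ge0}\{F|_{\mathcal{X}}: w(F)\ge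 m\}/\{F|_{\mathcal{X}}: w(F)>m\},\qquad \mathcal{W}(w_0)=\mathrm{Spec}\,\mathrm{gr}_{w_0,\dots,w_l}\mathcal{O}_{\mathcal{X},x}.$$ The class $\bar t$ of $t$ in degree $w_0$ makes $\mathcal{W}(w_0)$ a scheme over $\mathbb{A}^1_t$. In the same way $w_1,\dots,w_l$ define $\mathrm{gr}_{w_1,\dots,w_l}\mathcal{O}_{X,x}$; put $W=\mathrm{Spec}\,\mathrm{gr}_{w_1,\dots,w_l}\mathcal{O}_{X,x}$. Fix $w_1,\dots,w_l>0$ and assume that $W$ is a normal variety (i.e. this ring is an integrally closed domain), so that the weights define a degeneration $X\rightsquigarrow W$ to a normal variety. Call $\mathcal{W}(w_0)$ canonically trivial if there is an isomorphism $\mathcal{W}(w_0)\cong\mathbb{A}^1_t\times W$ over $\mathbb{A}^1_t$ that identifies the classes of $z_1,\dots,z_l$ on both sides. Then there is a critical weight $w_{\rm cri}\in\mathbb{R}_{>0}$ with the following properties. 1. If $w_0>w_{\rm cri}$, then $\mathcal{W}(w_0)$ is canonically trivial. Moreover, unless $\mathcal{W}(w_0)$ is canonically trivial for all $w_0>0$,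 one has for $w_0>0$: $\mathcal{W}(w_0)$ is canonically trivial if and only if $w_0>w_{\rm cri}$. 2. $\mathcal{W}(w_{\rm cri})$ is an integral normal affine scheme of finite type over $k$, faithfully flat over $\mathbb{A}^1_t$, and its fibre over $0$ is $W$ (by an isomorphism that identifies the classes of $z_1,\dots,z_l$). It is equivariant: the torus whose character group is the subgroup of $\mathbb{R}$ generated by $w_{\rm cri},w_1,\dots,w_l$ acts on $\mathcal{W}(w_{\rm cri})$ and on $\mathbb{A}^1_t$, the projection being equivariant, with weight $w_{\rm cri}$ on $t$ and $w_i$ on $z_i$; and if $(w_{\rm cri},w_1,\dots,w_l)=c\,(n_0,\dots,n_l)$ with $c>0$ real and $n_j\in\mathbb{Z}$, then $\mathbb{G}_m$ acts in this way with weight $n_0$ on $t$ and $n_i$ on $z_i$. 3. For every $w_0\ge w_{\rm cri}$ there is a unique valuation $v:\mathcal{O}_{\mathcal{X},x}\to\mathbb{R}_{\ge0}\cup\{\infty\}$ with $v(f)=\max\{w(F): F|_{\mathcal{X}}=f\}$ for all $f$ (in particular, the maximum exists). -/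

import Mathlib

open scoped NNReal ENNReal Polynomial PowerSeries

namespace Bubbling

noncomputable section

/-! ### The base: a pointed curve with a local coordinate -/

instance ker_isPrime {k P : Type*} [Field k] [CommRing P] {F : Type*} [FunLike F P k]
    [RingHomClass F P k] (f : F) : (RingHom.ker f).IsPrime :=
  RingHom.ker_isPrime f

/-- The base `0 ∈ Δ = Spec A`: an integral affine `k`-scheme with a `k`-rational point `0`
(given by `pt : A → k`) at which it is a smooth curve, i.e. the local ring at `0` is a discrete
valuation ring, together with a function `t` which is a local coordinate at `0`. -/
structure PointedCurve (k A : Type*) [Field k] [CommRing A] [IsDomain A] [Algebra k A] where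
  pt : A →ₐ[k] k
  isDVR : IsDiscreteValuationRing (Localization.AtPrime (RingHom.ker pt))
  t : A
  irreducible_t : Irreducible (algebraMap A (Localization.AtPrime (RingHom.ker pt)) t)

namespace PointedCurve

variable {k A : Type*} [Field k] [CommRing A] [IsDomain A] [Algebra k A] (Δ : PointedCurve k A)

/-- The local ring `𝒪_{Δ,0}`. -/
abbrev LocalRing : Type _ := Localization.AtPrime (RingHom.ker Δ.pt)

/-- The coordinate `t` as an element of `𝒪_{Δ,0}`. -/
def tLoc : Δ.LocalRing := algebraMap A Δ.LocalRing Δ.t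

/-- Evaluation at `0`, as a ring homomorphism `𝒪_{Δ,0} → k`. -/
def evalZero : Δ.LocalRing →ₐ[k] k :=
  IsLocalization.liftAlgHom (M := (RingHom.ker Δ.pt).primeCompl) (f := Δ.pt) (by
    rintro ⟨y, hy⟩
    exact isUnit_iff_ne_zero.mpr fun h => hy h)

theorem evalZero_algebraMap (a : A) : Δ.evalZero (algebraMap A Δ.LocalRing a) = Δ.pt a := by
  unfold evalZero
  simp

theorem ker_evalZero : RingHom.ker Δ.evalZero = Ideal.span {Δ.tLoc} := by
  have := Δ.isDVR
  have h1 : IsLocalRing.maximalIdeal Δ.LocalRing = Ideal.span {Δ.tLoc} :=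
    (IsDiscreteValuationRing.irreducible_iff_uniformizer _).mp Δ.irreducible_t
  have h2 : (RingHom.ker Δ.evalZero).IsMaximal :=
    RingHom.ker_isMaximal_of_surjective _ (fun c => ⟨algebraMap k _ c, by simp⟩)
  rw [← h1]
  exact IsLocalRing.eq_maximalIdeal h2

theorem tLoc_ne_zero : Δ.tLoc ≠ 0 := Δ.irreducible_t.ne_zero

theorem exists_shift (f : Δ.LocalRing) :
    ∃ g, f = algebraMap k Δ.LocalRing (Δ.evalZero f) + Δ.tLoc * g := by
  have h : f - algebraMap k Δ.LocalRing (Δ.evalZero f) ∈ RingHom.ker Δ.evalZero := by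
    simp [RingHom.mem_ker]
  rw [ker_evalZero, Ideal.mem_span_singleton] at h
  obtain ⟨g, hg⟩ := h
  exact ⟨g, by rw [← hg]; ring⟩

/-- The unique `g` with `f = f(0) + t g`. -/
def shift (f : Δ.LocalRing) : Δ.LocalRing := (Δ.exists_shift f).choose

theorem shift_spec (f : Δ.LocalRing) :
    f = algebraMap k Δ.LocalRing (Δ.evalZero f) + Δ.tLoc * Δ.shift f :=
  (Δ.exists_shift f).choose_spec

theorem shift_eq (f g : Δ.LocalRing) (c : k) (h : f = algebraMap k Δ.LocalRing c + Δ.tLoc * g) :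
    Δ.shift f = g := by
  have := Δ.isDVR
  have ht : Δ.evalZero Δ.tLoc = 0 := by
    have : Δ.tLoc ∈ RingHom.ker Δ.evalZero := by
      rw [ker_evalZero]; exact Ideal.mem_span_singleton_self _
    exact this
  have hc : Δ.evalZero f = c := by rw [h]; simp [ht]
  have h' := Δ.shift_spec f
  rw [hc] at h'
  have := h'.symm.trans h
  exact mul_left_cancel₀ Δ.tLoc_ne_zero (add_left_cancel this)

/-- The Taylor coefficients at `0` of `f ∈ 𝒪_{Δ,0}` with respect to the coordinate `t`. -/
def taylorCoeff (f : Δ.LocalRing) (n : ℕ) : k := Δ.evalZero (Δ.shift^[n] f)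

/-- The Taylor series at `0` of `f ∈ 𝒪_{Δ,0}` with respect to the coordinate `t`. -/
def taylorFun (f : Δ.LocalRing) : k⟦X⟧ := PowerSeries.mk (Δ.taylorCoeff f)

theorem coeff_zero_taylorFun (f : Δ.LocalRing) :
    PowerSeries.coeff 0 (Δ.taylorFun f) = Δ.evalZero f := by
  simp [taylorFun, taylorCoeff]

theorem taylorFun_eq (f : Δ.LocalRing) :
    Δ.taylorFun f = PowerSeries.C (Δ.evalZero f) + PowerSeries.X * Δ.taylorFun (Δ.shift f) := by
  ext n
  cases n with
  | zero => simp [taylorFun, taylorCoeff]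
  | succ n =>
    simp [taylorFun, taylorCoeff, PowerSeries.coeff_succ_X_mul]

theorem taylorFun_const_add (c : k) (g : Δ.LocalRing) :
    Δ.taylorFun (algebraMap k Δ.LocalRing c + Δ.tLoc * g) =
      PowerSeries.C c + PowerSeries.X * Δ.taylorFun g := by
  have ht : Δ.evalZero Δ.tLoc = 0 := by
    have : Δ.tLoc ∈ RingHom.ker Δ.evalZero := by
      rw [ker_evalZero]; exact Ideal.mem_span_singleton_self _
    exact this
  rw [taylorFun_eq, Δ.shift_eq _ g c rfl]
  simp [ht]

theorem taylorFun_zero : Δ.taylorFun 0 = 0 := by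
  have hs : Δ.shift 0 = 0 := Δ.shift_eq 0 0 0 (by simp)
  ext n
  induction n with
  | zero => simp [taylorFun, taylorCoeff]
  | succ n ih =>
    rw [taylorFun_eq, hs]
    simpa [PowerSeries.coeff_succ_X_mul] using ih

theorem taylorFun_algebraMap (c : k) :
    Δ.taylorFun (algebraMap k Δ.LocalRing c) = PowerSeries.C c := by
  have := Δ.taylorFun_const_add c 0
  simpa [taylorFun_zero] using this

theorem taylorFun_add (f g : Δ.LocalRing) :
    Δ.taylorFun (f + g) = Δ.taylorFun f + Δ.taylorFun g := by
  ext n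
  induction n generalizing f g with
  | zero => simp [taylorFun, taylorCoeff]
  | succ n ih =>
    have hs : Δ.shift (f + g) = Δ.shift f + Δ.shift g := by
      apply Δ.shift_eq _ _ (Δ.evalZero f + Δ.evalZero g)
      conv_lhs => rw [Δ.shift_spec f, Δ.shift_spec g]
      rw [map_add]; ring
    rw [Δ.taylorFun_eq (f + g), Δ.taylorFun_eq f, Δ.taylorFun_eq g, hs]
    simp only [map_add, PowerSeries.coeff_succ_X_mul, ih]
    ring

theorem taylorFun_mul (f g : Δ.LocalRing) :
    Δ.taylorFun (f * g) = Δ.taylorFun f * Δ.taylorFun g := by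
  ext n
  induction n generalizing f g with
  | zero => simp [taylorFun, taylorCoeff]
  | succ n ih =>
    have hs : Δ.shift (f * g) =
        algebraMap k Δ.LocalRing (Δ.evalZero f) * Δ.shift g + Δ.shift f * g := by
      apply Δ.shift_eq _ _ (Δ.evalZero f * Δ.evalZero g)
      have e1 := Δ.shift_spec f
      have e2 := Δ.shift_spec g
      rw [map_mul]
      linear_combination g * e1 + algebraMap k Δ.LocalRing (Δ.evalZero f) * e2
    rw [Δ.taylorFun_eq (f * g), hs]
    conv_rhs => rw [Δ.taylorFun_eq f, add_mul, Δ.taylorFun_eq g, mul_add, ← Δ.taylorFun_eq g,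
      mul_assoc]
    rw [taylorFun_add]
    simp only [map_add, PowerSeries.coeff_succ_X_mul, ih, taylorFun_algebraMap]
    rw [mul_left_comm, PowerSeries.coeff_succ_X_mul, map_mul Δ.evalZero, map_mul PowerSeries.C]
    ring

/-- Taylor expansion at `0` in the coordinate `t`, as a ring homomorphism `𝒪_{Δ,0} → k⟦t⟧`. -/
def taylor : Δ.LocalRing →+* k⟦X⟧ where
  toFun := Δ.taylorFun
  map_zero' := Δ.taylorFun_zero
  map_one' := by simpa using Δ.taylorFun_algebraMap 1
  map_add' := Δ.taylorFun_add
  map_mul' := Δ.taylorFun_mul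

theorem taylor_tLoc : Δ.taylor Δ.tLoc = PowerSeries.X := by
  have := Δ.taylorFun_const_add 0 1
  have h1 : Δ.taylorFun 1 = 1 := by simpa using Δ.taylorFun_algebraMap 1
  have h2 : Δ.taylorFun Δ.tLoc = PowerSeries.X := by simpa [h1] using this
  exact h2

end PointedCurve

/-! ### Filtered rings and their associated graded rings -/

/-- A decreasing multiplicative filtration of a ring `S`, indexed by the real numbers `m ≥ 0`: ideals
`ge m = {v ≥ m}` and `gt m = {v > m}`. -/
structure Filtration (S : Type*) [CommRing S] where
  ge : ℝ≥0 → Ideal S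
  gt : ℝ≥0 → Ideal S
  one_mem_ge : 1 ∈ ge 0
  mul_mem_ge : ∀ {a b : ℝ≥0} {x y : S}, x ∈ ge a → y ∈ ge b → x * y ∈ ge (a + b)
  mul_mem_gt : ∀ {a b : ℝ≥0} {x y : S}, x ∈ ge a → y ∈ gt b → x * y ∈ gt (a + b)

namespace Filtration

variable (k : Type*) [Field k] {S : Type*} [CommRing S] [Algebra k S] (𝓕 : Filtration S)

/-- The Rees algebra `⨁_{m ≥ 0} {v ≥ m} sᵐ`. -/
def rees : Subalgebra k (AddMonoidAlgebra S ℝ≥0) where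
  carrier := {p | ∀ m, p.coeff m ∈ 𝓕.ge m}
  add_mem' := fun ha hb m => by
    simpa using Ideal.add_mem _ (ha m) (hb m)
  mul_mem' := by
    classical
    intro a b ha hb m
    rw [AddMonoidAlgebra.coeff_mul]
    refine Ideal.sum_mem _ fun i _ => Ideal.sum_mem _ fun j _ => ?_
    dsimp only
    split_ifs with h
    · rw [← h]; exact 𝓕.mul_mem_ge (ha i) (hb j)
    · exact zero_mem _
  algebraMap_mem' := by
    classical
    intro c m
    rw [AddMonoidAlgebra.coe_algebraMap]
    simp only [Function.comp_apply, AddMonoidAlgebra.coeff_single, Finsupp.single_apply]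
    split_ifs with h
    · rw [← h, ← mul_one (algebraMap k S c)]
      exact Ideal.mul_mem_left _ _ 𝓕.one_mem_ge
    · exact zero_mem _

/-- The ideal `⨁_{m ≥ 0} {v > m} sᵐ` of the Rees algebra. -/
def reesGT : Ideal (𝓕.rees k) where
  carrier := {p | ∀ m, p.1.coeff m ∈ 𝓕.gt m}
  add_mem' := fun ha hb m => by
    simpa using Ideal.add_mem _ (ha m) (hb m)
  zero_mem' := fun m => by simp
  smul_mem' := by
    classical
    intro a b hb m
    change (a.1 * b.1).coeff m ∈ _
    rw [AddMonoidAlgebra.coeff_mul]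
    refine Ideal.sum_mem _ fun i _ => Ideal.sum_mem _ fun j _ => ?_
    dsimp only
    split_ifs with h
    · rw [← h]; exact 𝓕.mul_mem_gt (a.2 i) (hb j)
    · exact zero_mem _

/-- The associated graded ring `⨁_{m ≥ 0} {v ≥ m} / {v > m}`, written as the quotient of the two direct
sums above. -/
def Gr : Type _ := 𝓕.rees k ⧸ 𝓕.reesGT k

instance : CommRing (𝓕.Gr k) := Ideal.Quotient.commRing (𝓕.reesGT k)

instance : Algebra k (𝓕.Gr k) := Ideal.Quotient.algebra k (I := 𝓕.reesGT k)

/-- The quotient map from the Rees algebra to the associated graded ring. -/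
def toGr : 𝓕.rees k →ₐ[k] 𝓕.Gr k := Ideal.Quotient.mkₐ k (𝓕.reesGT k)

/-- The class in degree `m` of an element `x` of `{v ≥ m}`. -/
def symb (m : ℝ≥0) (x : S) (hx : x ∈ 𝓕.ge m) : 𝓕.Gr k :=
  𝓕.toGr k ⟨AddMonoidAlgebra.single m x, by
    classical
    intro n
    simp only [AddMonoidAlgebra.coeff_single, Finsupp.single_apply]
    split_ifs with h
    · rw [← h]; exact hx
    · exact zero_mem _⟩

end Filtration

/-! ### Weights on local rings of closed subschemes of affine spaces -/

section Weights

variable {k : Type*} [Field k] {τ : Type*}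

/-- The weight `w(f) = min {∑ⱼ wⱼ iⱼ ∣ a_i ≠ 0}` of a power series `f = ∑ a_i x^i`
(it is `∞` for `f = 0`). -/
def weight (w : τ → ℝ≥0) (f : MvPowerSeries τ k) : ℝ≥0∞ :=
  ⨅ (d : τ →₀ ℕ) (_ : MvPowerSeries.coeff d f ≠ 0), ((Finsupp.weight w d : ℝ≥0) : ℝ≥0∞)

theorem le_weight_iff {w : τ → ℝ≥0} {f : MvPowerSeries τ k} {m : ℝ≥0∞} :
    m ≤ weight w f ↔ ∀ d, MvPowerSeries.coeff d f ≠ 0 → m ≤ (Finsupp.weight w d : ℝ≥0) := by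
  simp [weight]

theorem weight_zero (w : τ → ℝ≥0) : weight w (0 : MvPowerSeries τ k) = ⊤ := by
  simp [weight]

theorem min_weight_le_weight_add (w : τ → ℝ≥0) (f g : MvPowerSeries τ k) :
    min (weight w f) (weight w g) ≤ weight w (f + g) := by
  rw [le_weight_iff]
  intro d hd
  by_cases hf : MvPowerSeries.coeff d f = 0
  · have hg : MvPowerSeries.coeff d g ≠ 0 := by
      intro hg; apply hd; simp [hf, hg]
    exact (min_le_right _ _).trans (le_weight_iff.mp le_rfl d hg)
  · exact (min_le_left _ _).trans (le_weight_iff.mp le_rfl d hf)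

theorem weight_add_weight_le_weight_mul (w : τ → ℝ≥0) (f g : MvPowerSeries τ k) :
    weight w f + weight w g ≤ weight w (f * g) := by
  classical
  rw [le_weight_iff]
  intro d hd
  rw [MvPowerSeries.coeff_mul] at hd
  obtain ⟨p, hp, hne⟩ := Finset.exists_ne_zero_of_sum_ne_zero hd
  replace hp : p.1 + p.2 = d := Finset.HasAntidiagonal.mem_antidiagonal.mp hp
  rw [← hp, map_add, ENNReal.coe_add]
  exact add_le_add (le_weight_iff.mp le_rfl _ (left_ne_zero_of_mul hne))
    (le_weight_iff.mp le_rfl _ (right_ne_zero_of_mul hne))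

theorem weight_X (w : τ → ℝ≥0) (i : τ) :
    (w i : ℝ≥0∞) ≤ weight w (MvPowerSeries.X i : MvPowerSeries τ k) := by
  classical
  rw [le_weight_iff]
  intro d hd
  rw [MvPowerSeries.coeff_X] at hd
  have : d = Finsupp.single i 1 := by
    by_contra h; simp [h] at hd
  subst this
  simp [Finsupp.weight_single]

variable {P : Type*} [CommRing P] (E : P →+* MvPowerSeries τ k) (I : Ideal P)

/-- For a ring `P` with a power series expansion `E` at a `k`-point `0` of `Spec P`: the prime
ideal of all functions that vanish at `0`. -/
abbrev originIdeal : Ideal P := RingHom.ker (MvPowerSeries.constantCoeff.comp E)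

/-- The local ring of `Spec P` at `0`. -/
abbrev AmbientRing : Type _ := Localization.AtPrime (originIdeal E)

/-- The power series expansion on the local ring of `Spec P` at `0`. -/
def expand : AmbientRing E →+* MvPowerSeries τ k :=
  IsLocalization.lift (M := (originIdeal E).primeCompl) (g := E) (by
    rintro ⟨y, hy⟩
    rw [MvPowerSeries.isUnit_iff_constantCoeff]
    exact isUnit_iff_ne_zero.mpr fun h => hy h)

theorem expand_algebraMap (p : P) : expand E (algebraMap P (AmbientRing E) p) = E p := by
  simp [expand]

/-- The local ring at `0` of the closed subscheme `V(I) ⊆ Spec P`. -/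
abbrev Stalk : Type _ := AmbientRing E ⧸ I.map (algebraMap P (AmbientRing E))

/-- The restriction of a function germ to the closed subscheme `V(I)`. -/
abbrev restrict : AmbientRing E →+* Stalk E I := Ideal.Quotient.mk _

variable (w : τ → ℝ≥0)

/-- The ideal `{f̄ ∣ w(f) ≥ m}` of the local ring of `V(I)` at `0`. -/
def fil (m : ℝ≥0) : Ideal (Stalk E I) where
  carrier := {x | ∃ f : AmbientRing E, (m : ℝ≥0∞) ≤ weight w (expand E f) ∧ restrict E I f = x}
  add_mem' := by
    rintro _ _ ⟨f, hf, rfl⟩ ⟨g, hg, rfl⟩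
    refine ⟨f + g, ?_, map_add _ _ _⟩
    rw [map_add]
    exact (le_min hf hg).trans (min_weight_le_weight_add _ _ _)
  zero_mem' := ⟨0, by simp [weight_zero], map_zero _⟩
  smul_mem' := by
    rintro c _ ⟨f, hf, rfl⟩
    obtain ⟨c, rfl⟩ := Ideal.Quotient.mk_surjective c
    refine ⟨c * f, ?_, map_mul _ _ _⟩
    rw [map_mul]
    exact (hf.trans le_add_self).trans (weight_add_weight_le_weight_mul _ _ _)

/-- The ideal `{f̄ ∣ w(f) > m}` of the local ring of `V(I)` at `0`. -/
def filLT (m : ℝ≥0) : Ideal (Stalk E I) where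
  carrier := {x | ∃ f : AmbientRing E, (m : ℝ≥0∞) < weight w (expand E f) ∧ restrict E I f = x}
  add_mem' := by
    rintro _ _ ⟨f, hf, rfl⟩ ⟨g, hg, rfl⟩
    refine ⟨f + g, ?_, map_add _ _ _⟩
    rw [map_add]
    exact (lt_min hf hg).trans_le (min_weight_le_weight_add _ _ _)
  zero_mem' := ⟨0, by simp [weight_zero], map_zero _⟩
  smul_mem' := by
    rintro c _ ⟨f, hf, rfl⟩
    obtain ⟨c, rfl⟩ := Ideal.Quotient.mk_surjective c
    refine ⟨c * f, ?_, map_mul _ _ _⟩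
    rw [map_mul]
    exact (hf.trans_le le_add_self).trans_le (weight_add_weight_le_weight_mul _ _ _)

theorem mul_mem_fil {a b : ℝ≥0} {x y : Stalk E I} (hx : x ∈ fil E I w a) (hy : y ∈ fil E I w b) :
    x * y ∈ fil E I w (a + b) := by
  obtain ⟨f, hf, rfl⟩ := hx
  obtain ⟨g, hg, rfl⟩ := hy
  refine ⟨f * g, ?_, map_mul _ _ _⟩
  rw [map_mul, ENNReal.coe_add]
  exact (add_le_add hf hg).trans (weight_add_weight_le_weight_mul _ _ _)

theorem mul_mem_filLT {a b : ℝ≥0} {x y : Stalk E I} (hx : x ∈ fil E I w a)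
    (hy : y ∈ filLT E I w b) : x * y ∈ filLT E I w (a + b) := by
  obtain ⟨f, hf, rfl⟩ := hx
  obtain ⟨g, hg, rfl⟩ := hy
  refine ⟨f * g, ?_, map_mul _ _ _⟩
  rw [map_mul, ENNReal.coe_add]
  exact (ENNReal.add_lt_add_of_le_of_lt ENNReal.coe_ne_top hf hg).trans_le
    (weight_add_weight_le_weight_mul _ _ _)

/-- The filtration of the local ring of `V(I)` at `0` that is given by the weights `w`. -/
def weightFiltration : Filtration (Stalk E I) where
  ge := fil E I w
  gt := filLT E I w
  one_mem_ge := by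
    obtain ⟨f, hf⟩ := Ideal.Quotient.mk_surjective (1 : Stalk E I)
    exact ⟨f, by simp, hf⟩
  mul_mem_ge := mul_mem_fil E I w
  mul_mem_gt := mul_mem_filLT E I w

/-- The graded ring `gr_w = ⨁_{m ≥ 0} {f̄ ∣ w(f) ≥ m} / {f̄ ∣ w(f) > m}` of the local ring of `V(I)`
at `0`. -/
abbrev Gr [Algebra k P] : Type _ := (weightFiltration E I w).Gr k

theorem coord_mem_fil {p : P} {i : τ} (hp : E p = MvPowerSeries.X i) :
    restrict E I (algebraMap P (AmbientRing E) p) ∈ fil E I w (w i) :=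
  ⟨_, by rw [expand_algebraMap, hp]; exact weight_X w i, rfl⟩

/-- The class in degree `wᵢ` of (the restriction to `V(I)` of) the `i`-th coordinate. -/
def coordSymb [Algebra k P] {p : P} {i : τ} (hp : E p = MvPowerSeries.X i) : Gr (k := k) E I w :=
  (weightFiltration E I w).symb k (w i) _ (coord_mem_fil E I w hp)

end Weights

/-! ### The family `𝒳 ⊆ Δ × 𝔸ˡ`, its central fibre, and their graded rings -/

namespace PointedCurve

variable {k A : Type*} [Field k] [CommRing A] [IsDomain A] [Algebra k A] (Δ : PointedCurve k A)
variable {l : ℕ}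

/-- The expansion at the origin of functions on `Δ × 𝔸ˡ`; the variable with index `0` is `t`,
the one with index `i + 1` is `zᵢ`. -/
def totalExp (l : ℕ) : MvPolynomial (Fin l) A →+* MvPowerSeries (Fin (l + 1)) k :=
  MvPolynomial.eval₂Hom
    ((PowerSeries.toMvPowerSeries (0 : Fin (l + 1))).toRingHom.comp
      (Δ.taylor.comp (algebraMap A Δ.LocalRing)))
    (fun i => MvPowerSeries.X i.succ)

theorem totalExp_t (l : ℕ) : Δ.totalExp l (MvPolynomial.C Δ.t) = MvPowerSeries.X 0 := by
  have h : Δ.taylor (algebraMap A Δ.LocalRing Δ.t) = PowerSeries.X := Δ.taylor_tLoc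
  simp [totalExp, h, PowerSeries.toMvPowerSeries_X]

theorem totalExp_z (i : Fin l) : Δ.totalExp l (MvPolynomial.X i) = MvPowerSeries.X i.succ := by
  simp [totalExp]

/-- The value of `totalExp f` at the origin is `f(0, 0)`. -/
theorem constantCoeff_totalExp (f : MvPolynomial (Fin l) A) :
    MvPowerSeries.constantCoeff (Δ.totalExp l f) = Δ.pt (MvPolynomial.constantCoeff f) := by
  have h : (MvPowerSeries.constantCoeff.comp (Δ.totalExp l)) =
      (Δ.pt : A →+* k).comp MvPolynomial.constantCoeff := by
    refine MvPolynomial.ringHom_ext (fun a => ?_) (fun i => ?_)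
    · have h1 : ∀ p : k⟦X⟧, MvPowerSeries.constantCoeff
          (PowerSeries.toMvPowerSeries (0 : Fin (l + 1)) p) = PowerSeries.constantCoeff p := by
        intro p
        have := congrArg MvPowerSeries.constantCoeff
          (congrArg (PowerSeries.toMvPowerSeries (0 : Fin (l + 1))) p.eq_X_mul_shift_add_const)
        simpa [PowerSeries.toMvPowerSeries_X, PowerSeries.toMvPowerSeries_C] using this
      have h2 : PowerSeries.constantCoeff (Δ.taylor (algebraMap A Δ.LocalRing a)) = Δ.pt a := by
        rw [← evalZero_algebraMap, ← coeff_zero_taylorFun]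
        simp [taylor]
      simp [totalExp, h1, h2]
    · simp [totalExp]
  exact congrArg (fun g : MvPolynomial (Fin l) A →+* k => g f) h

/-- The expansion at the origin of functions on `𝔸ˡ`. -/
abbrev fibreExp (k : Type*) [Field k] (l : ℕ) :
    MvPolynomial (Fin l) k →+* MvPowerSeries (Fin l) k :=
  MvPolynomial.coeToMvPowerSeries.ringHom

theorem fibreExp_z (i : Fin l) : fibreExp k l (MvPolynomial.X i) = MvPowerSeries.X i := by
  simp

variable (I : Ideal (MvPolynomial (Fin l) A)) (w₀ : ℝ≥0) (w : Fin l → ℝ≥0)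

/-- The ideal of the central fibre `X = 𝒳 ∩ {0} × 𝔸ˡ` in `𝔸ˡ`, where `𝒳 = V(I)`. -/
abbrev fibreIdeal : Ideal (MvPolynomial (Fin l) k) :=
  I.map (MvPolynomial.map (Δ.pt : A →+* k))

/-- The weights `(w₀, w₁, …, w_l)`. -/
abbrev allWeights : Fin (l + 1) → ℝ≥0 := Fin.cons w₀ w

/-- The local ring `𝒪_{𝒳,x}`. -/
abbrev TotalStalk : Type _ := Stalk (Δ.totalExp l) I

/-- The ring `gr_{w₀,w₁,…,w_l}(𝒪_{𝒳,x})`, whose spectrum is `𝒲(w₀; w₁, …, w_l)`. -/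
abbrev TotalGr : Type _ := Gr (k := k) (Δ.totalExp l) I (allWeights w₀ w)

/-- The ring `gr_{w₁,…,w_l}(𝒪_{X,x})`, whose spectrum is `W`. -/
abbrev FibreGr : Type _ := Gr (k := k) (fibreExp k l) (Δ.fibreIdeal I) w

/-- The class of `t` in degree `w₀` of `gr_{w₀,…,w_l}(𝒪_{𝒳,x})`. -/
def tBar : Δ.TotalGr I w₀ w := coordSymb _ I (allWeights w₀ w) (Δ.totalExp_t l)

/-- The class of `zᵢ` in degree `wᵢ` of `gr_{w₀,…,w_l}(𝒪_{𝒳,x})`. -/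
def zBar (i : Fin l) : Δ.TotalGr I w₀ w := coordSymb _ I (allWeights w₀ w) (Δ.totalExp_z i)

/-- The class of `zᵢ` in degree `wᵢ` of `gr_{w₁,…,w_l}(𝒪_{X,x})`. -/
def zBarFibre (i : Fin l) : Δ.FibreGr I w := coordSymb _ (Δ.fibreIdeal I) w (fibreExp_z i)

/-- The morphism `𝒲 → 𝔸¹_t` as a homomorphism of rings: `k[t] → gr`, `t ↦ t̄`. -/
def structureHom : k[X] →+* Δ.TotalGr I w₀ w :=
  (Polynomial.aeval (Δ.tBar I w₀ w) : k[X] →ₐ[k] Δ.TotalGr I w₀ w).toRingHom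

/-- `𝒲` is canonically isomorphic to `𝔸¹_t × W` over `𝔸¹_t`: the isomorphism respects `t`, and it is
the canonical one, i.e. it respects the coordinates `zᵢ`. -/
def IsCanonicallyTrivial : Prop :=
  ∃ e : Δ.TotalGr I w₀ w ≃ₐ[k] (Δ.FibreGr I w)[X],
    e (Δ.tBar I w₀ w) = Polynomial.X ∧
      ∀ i, e (Δ.zBar I w₀ w i) = Polynomial.C (Δ.zBarFibre I w i)

/-- The central fibre of `𝒲 → 𝔸¹_t` is `W`, compatibly with the coordinates `zᵢ`. -/
def HasCentralFibre : Prop :=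
  ∃ e : (Δ.TotalGr I w₀ w ⧸ Ideal.span {Δ.tBar I w₀ w}) ≃ₐ[k] Δ.FibreGr I w,
    ∀ i, e (Ideal.Quotient.mk _ (Δ.zBar I w₀ w i)) = Δ.zBarFibre I w i

end PointedCurve

/-! ### Actions of tori -/

/-- An algebra homomorphism `ρ : R → R ⊗ k[M] = R[M]`, `r ↦ ∑ₘ rₘ sᵐ`, is an action on `Spec R` of the
diagonalizable group with character group `M` (so of `𝔾ₘ` for `M = ℤ`, and of an algebraic torus for
`M` free of finite rank): counit and coassociativity law. -/
structure IsCoaction {k R M : Type*} [Field k] [CommRing R] [Algebra k R] [AddCommGroup M]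
    (ρ : R →ₐ[k] AddMonoidAlgebra R M) : Prop where
  counit : ∀ r, ((ρ r).coeff.sum fun _ a => a) = r
  coassoc : ∀ r m, ρ ((ρ r).coeff m) = AddMonoidAlgebra.single m ((ρ r).coeff m)

namespace PointedCurve

variable {k A : Type*} [Field k] [CommRing A] [IsDomain A] [Algebra k A] (Δ : PointedCurve k A)
variable {l : ℕ} (I : Ideal (MvPolynomial (Fin l) A)) (w₀ : ℝ≥0) (w : Fin l → ℝ≥0)

/-- The diagonalizable group with character group `M` acts on `𝒲` with weight `d i` on `zᵢ` and so
that `𝒲 → 𝔸¹_t` is equivariant for the action of weight `d 0` on `𝔸¹_t`. -/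
def ActsWithWeights (M : Type*) [AddCommGroup M] (d : Fin (l + 1) → M) : Prop :=
  ∃ ρ : Δ.TotalGr I w₀ w →ₐ[k] AddMonoidAlgebra (Δ.TotalGr I w₀ w) M, IsCoaction ρ ∧
    ρ (Δ.tBar I w₀ w) = AddMonoidAlgebra.single (d 0) (Δ.tBar I w₀ w) ∧
    ∀ i : Fin l, ρ (Δ.zBar I w₀ w i) = AddMonoidAlgebra.single (d i.succ) (Δ.zBar I w₀ w i)

/-- The group of real numbers generated by the weights `w₀, w₁, …, w_l`; it is the character group of
the torus that acts on `𝒲`. -/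
abbrev weightGroup : AddSubgroup ℝ :=
  AddSubgroup.closure (Set.range fun j => (allWeights w₀ w j : ℝ))

/-- The weight `wⱼ` as an element of the group generated by the weights. -/
def weightChar (j : Fin (l + 1)) : weightGroup w₀ w :=
  ⟨(allWeights w₀ w j : ℝ), AddSubgroup.subset_closure ⟨j, rfl⟩⟩

/-- The action on `𝒲` given by the weights. For arbitrary real weights it is an action of the torus
whose character group is generated by the weights. If the weights are proportional to integers `nⱼ`
(for instance, equal to them), then it is an action of `𝔾ₘ` with the weights `nⱼ`. -/
def IsEquivariant : Prop :=
  Δ.ActsWithWeights I w₀ w (weightGroup w₀ w) (weightChar w₀ w) ∧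
    ∀ (c : ℝ) (n : Fin (l + 1) → ℤ), 0 < c → (∀ j, (allWeights w₀ w j : ℝ) = c * n j) →
      Δ.ActsWithWeights I w₀ w ℤ n

/-- `v` is the valuation of `𝒪_{𝒳,x}` given by the weights `w₀, …, w_l`: its value at `f` is the
largest weight of a function germ on `Δ × 𝔸ˡ` that restricts to `f`. -/
def IsWeightValuation (v : AddValuation (Δ.TotalStalk I) ℝ≥0∞) : Prop :=
  ∀ f : Δ.TotalStalk I,
    IsGreatest {m | ∃ F, restrict (Δ.totalExp l) I F = f ∧
      m = weight (allWeights w₀ w) (expand (Δ.totalExp l) F)} (v f)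

end PointedCurve

end

end Bubbling

/-!
The two graded rings are quotients of polynomial rings: `gr(𝒪_{𝒳,x})` is `k[t, z]` modulo the ideal
`in_{w₀,w}(J)` of initial forms of the local equations `J` of `𝒳`, and `gr(𝒪_{X,x})` is `k[z]`
modulo `in_w(J₀)`, where `J₀ = J|_{t=0}` (`totalGrHom`, `fibreGrHom` and the descriptions of their
kernels). The whole theorem is about the dependence of the first ideal on `w₀`.

Call an equation `q` of `in_w(J₀)`, homogeneous of degree `n`, *liftable* at `w₀` if it is the
initial form of `G|_{t=0}` for some `G ∈ J` of weight at least `n` (`HasInitialLift`); a term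
`tʲ z^d` of `G`, `j > 0`, then has weight at least `n`. If all these terms have weight more than
`n`, then `q` itself lies in `in_{w₀,w}(J)`. For a single `q` only finitely many monomials matter.
So the condition `q ∈ in_{w₀,w}(J)` is open in `w₀`, it holds for `w₀ > n`, it implies that `q` is
liftable at `w₀`, a lift at `w₀` puts `q` into `in_{v,w}(J)` for all `v > w₀`, and liftability
passes to limits from above. As `in_w(J₀)` has finitely many homogeneous generators, the same
follows for all `q` simultaneously. `𝒲(w₀)` is canonically trivial if and only if
`in_w(J₀) ⊆ in_{w₀,w}(J)`, so the critical weight is the infimum of the weights where this is true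
(if it is true for all weights, any positive number will do), and at each `w₀ ≥ wcri` all
generators are liftable (`exists_critical_weight`).

If the generators are liftable, then every element of `J₀` lifts to an element of `J` of at least
the same weight (`HasLifts`): subtracting lifts of initial forms increases the weight, and
equations of large weight can be lifted by the Artin–Rees lemma. Flatness of `𝒳` then makes `t̄` a
nonzerodivisor, and the fibre of `𝒲` over `t = 0` is `W`. In the opposite direction, filter
`k[t, z]` by the degree in which `t` has a weight `v₀ < w₀`: among the terms of a polynomial that
is homogeneous for `(w₀, w)`, the one with the smallest power of `t` has the largest degree, so
that the initial ideal for this filtration from above defines `𝔸¹ × W`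
(`HasLifts.isTopDegeneration`). Hence `gr(𝒪_{𝒳,x})` is a domain, and it is integrally closed
because `gr(𝒪_{X,x})[t]` is; here complete integral closedness is compared on leading forms
(`IsTopDegeneration.isIntegrallyClosed`).

The zero section gives a retraction of `k[t] → gr(𝒪_{𝒳,x})`, and with torsion-freeness this is
faithful flatness. The torus action is the grading. Finally, by Krull's intersection theorem a
nonzero function on `𝒳` has a representative of largest weight, and these weights are additive
since the graded ring is a domain (`IsCoordinateExpansion.exists_weightValuation`).
-/

namespace Bubbling

noncomputable section

/-! ### Weights of monomials and polynomials -/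

section PolynomialWeights

open MvPolynomial

variable {k σ : Type*} [Field k]

theorem finite_weight_le [Finite σ] {u : σ → ℝ≥0} (hu : ∀ i, 0 < u i) (C : ℝ≥0) :
    {d : σ →₀ ℕ | Finsupp.weight u d ≤ C}.Finite := by
  classical
  have := Fintype.ofFinite σ
  refine (Set.finite_Icc (0 : σ →₀ ℕ) (Finsupp.equivFunOnFinite.symm fun i => ⌊C / u i⌋₊)).subset ?_
  intro d hd
  refine ⟨bot_le, fun i => ?_⟩
  have h1 : d i • u i ≤ Finsupp.weight u d := by
    rw [Finsupp.weight_apply, Finsupp.sum_fintype _ _ (by simp)]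
    exact Finset.single_le_sum (f := fun j => d j • u j) (fun j _ => zero_le) (Finset.mem_univ i)
  have h2 : (d i : ℝ≥0) ≤ C / u i := by
    rw [le_div_iff₀ (hu i), ← nsmul_eq_mul]
    exact h1.trans hd
  exact Nat.le_floor h2

/-- Monomials may be compared by their (positive) weights in well-founded recursions. -/
theorem wellFounded_weight_lt [Finite σ] {u : σ → ℝ≥0} (hu : ∀ i, 0 < u i) :
    WellFounded fun d e : σ →₀ ℕ => Finsupp.weight u d < Finsupp.weight u e := by
  refine Subrelation.wf (r := InvImage (· < ·)
    fun d => {e : σ →₀ ℕ | Finsupp.weight u e < Finsupp.weight u d}.ncard) ?_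
    (InvImage.wf _ wellFounded_lt)
  intro d e hde
  refine Set.ncard_lt_ncard
    ⟨fun x hx => lt_trans hx hde, fun h => lt_irrefl (Finsupp.weight u d) (h hde)⟩
    ((finite_weight_le hu (Finsupp.weight u e)).subset
      fun x hx => le_of_lt (Set.mem_ofPred_eq ▸ hx))

/-- The polynomials all of whose monomials have weight in a set `s`. -/
def weightSupported (k : Type*) [Field k] {σ : Type*} (u : σ → ℝ≥0) (s : Set ℝ≥0) :
    Submodule k (MvPolynomial σ k) where
  carrier := {p | ∀ d, coeff d p ≠ 0 → Finsupp.weight u d ∈ s}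
  add_mem' := by
    intro p q hp hq d hd
    by_cases h : coeff d p = 0
    · exact hq d fun h' => hd (by simp [h, h'])
    · exact hp d h
  zero_mem' := by simp
  smul_mem' := by
    intro c p hp d hd
    exact hp d fun h => hd (by simp [h])

theorem weightSupported_mono {u : σ → ℝ≥0} {s t : Set ℝ≥0} (h : s ⊆ t) :
    weightSupported k u s ≤ weightSupported k u t := fun _ hp d hd => h (hp d hd)

theorem mul_mem_weightSupported {u : σ → ℝ≥0} {r s t : Set ℝ≥0} {p q : MvPolynomial σ k}
    (h : ∀ a ∈ r, ∀ b ∈ s, a + b ∈ t) (hp : p ∈ weightSupported k u r)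
    (hq : q ∈ weightSupported k u s) : p * q ∈ weightSupported k u t := by
  classical
  intro d hd
  rw [coeff_mul] at hd
  obtain ⟨x, hx, hne⟩ := Finset.exists_ne_zero_of_sum_ne_zero hd
  rw [← Finset.HasAntidiagonal.mem_antidiagonal.mp hx, map_add]
  exact h _ (hp _ (left_ne_zero_of_mul hne)) _ (hq _ (right_ne_zero_of_mul hne))

theorem mul_mem_weightSupported_Iic {u : σ → ℝ≥0} {a b : ℝ≥0} {p q : MvPolynomial σ k}
    (hp : p ∈ weightSupported k u (Set.Iic a)) (hq : q ∈ weightSupported k u (Set.Iic b)) :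
    p * q ∈ weightSupported k u (Set.Iic (a + b)) :=
  mul_mem_weightSupported (r := Set.Iic a) (s := Set.Iic b)
    (fun _ h _ h' => add_le_add (Set.mem_Iic.mp h) (Set.mem_Iic.mp h')) hp hq

theorem pow_mem_weightSupported_Iic {u : σ → ℝ≥0} {a : ℝ≥0} {p : MvPolynomial σ k}
    (hp : p ∈ weightSupported k u (Set.Iic a)) (n : ℕ) :
    p ^ n ∈ weightSupported k u (Set.Iic (n * a)) := by
  induction n with
  | zero =>
    classical
    intro d hd
    rw [pow_zero, coeff_one] at hd
    have : d = 0 := by by_contra h; exact hd (if_neg fun h' => h h'.symm)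
    simp [this]
  | succ n ih =>
    rw [pow_succ, Nat.cast_succ, add_mul, one_mul]
    exact mul_mem_weightSupported_Iic ih hp

theorem mem_Iic_of_isWeightedHomogeneous {u : σ → ℝ≥0} {c : ℝ≥0} {p : MvPolynomial σ k}
    (hp : IsWeightedHomogeneous u p c) : p ∈ weightSupported k u (Set.Iic c) :=
  fun _ hd => (hp hd).le

theorem weightedHomogeneousComponent_eq_zero_of_mem {u : σ → ℝ≥0} {s : Set ℝ≥0} {c : ℝ≥0}
    {p : MvPolynomial σ k} (hp : p ∈ weightSupported k u s) (hc : c ∉ s) :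
    weightedHomogeneousComponent u c p = 0 := by
  classical
  ext d
  rw [coeff_weightedHomogeneousComponent, coeff_zero]
  split_ifs with h
  · by_contra h'
    exact hc (h ▸ hp d h')
  · rfl

theorem sub_weightedHomogeneousComponent_mem {u : σ → ℝ≥0} {s : Set ℝ≥0} {c : ℝ≥0}
    {p : MvPolynomial σ k} (hp : p ∈ weightSupported k u s) :
    p - weightedHomogeneousComponent u c p ∈ weightSupported k u (s \ {c}) := by
  classical
  intro d hd
  rw [coeff_sub, coeff_weightedHomogeneousComponent] at hd
  split_ifs at hd with h
  · simp at hd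
  · rw [sub_zero] at hd
    exact ⟨hp d hd, h⟩

theorem weightSupported_univ (u : σ → ℝ≥0) (p : MvPolynomial σ k) :
    p ∈ weightSupported k u Set.univ := fun _ _ => trivial

theorem weightedHomogeneousComponent_add_mul {u : σ → ℝ≥0} {n m : ℝ≥0} {h : MvPolynomial σ k}
    (hh : IsWeightedHomogeneous u h n) (q : MvPolynomial σ k) :
    weightedHomogeneousComponent u (n + m) (h * q) = h * weightedHomogeneousComponent u m q := by
  have e : h * q = h * weightedHomogeneousComponent u m q +
      h * (q - weightedHomogeneousComponent u m q) := by ring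
  rw [e, map_add, (hh.mul (weightedHomogeneousComponent_isWeightedHomogeneous m
    q)).weightedHomogeneousComponent_same, weightedHomogeneousComponent_eq_zero_of_mem
    (s := {n + m}ᶜ) (mul_mem_weightSupported (r := {n}) (s := {m}ᶜ) ?_ hh ?_) (by simp), add_zero]
  · rintro a rfl b hb
    simpa using hb
  · simpa [Set.compl_eq_univ_sdiff] using
      sub_weightedHomogeneousComponent_mem (c := m) (weightSupported_univ u q)

theorem weightedHomogeneousComponent_mul_eq_zero {u : σ → ℝ≥0} {n c : ℝ≥0} {h : MvPolynomial σ k}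
    (hh : IsWeightedHomogeneous u h n) (q : MvPolynomial σ k) (hc : c < n) :
    weightedHomogeneousComponent u c (h * q) = 0 :=
  weightedHomogeneousComponent_eq_zero_of_mem (s := Set.Ici n)
    (mul_mem_weightSupported (r := {n}) (s := Set.univ)
      (by rintro a rfl b -; simp) hh (weightSupported_univ u q)) (by simpa using hc)

/-- The top weighted component is multiplicative. -/
theorem weightedHomogeneousComponent_mul_of_Iic {u : σ → ℝ≥0} {a b : ℝ≥0} {p q : MvPolynomial σ k}
    (hp : p ∈ weightSupported k u (Set.Iic a)) (hq : q ∈ weightSupported k u (Set.Iic b)) :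
    weightedHomogeneousComponent u (a + b) (p * q) =
      weightedHomogeneousComponent u a p * weightedHomogeneousComponent u b q := by
  have e : p * q = weightedHomogeneousComponent u a p * q +
      (p - weightedHomogeneousComponent u a p) * q := by ring
  rw [e, map_add, weightedHomogeneousComponent_add_mul
    (weightedHomogeneousComponent_isWeightedHomogeneous a p),
    weightedHomogeneousComponent_eq_zero_of_mem (s := Set.Iio (a + b))
    (mul_mem_weightSupported (r := Set.Iio a) (s := Set.Iic b) ?_ ?_ hq) (by simp), add_zero]
  · intro x hx y hy
    exact add_lt_add_of_lt_of_le (Set.mem_Iio.mp hx) (Set.mem_Iic.mp hy)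
  · exact weightSupported_mono (by simp) (sub_weightedHomogeneousComponent_mem hp)

theorem weightedHomogeneousComponent_pow_of_Iic {u : σ → ℝ≥0} {a : ℝ≥0} {p : MvPolynomial σ k}
    (hp : p ∈ weightSupported k u (Set.Iic a)) (n : ℕ) :
    weightedHomogeneousComponent u (n * a) (p ^ n) = weightedHomogeneousComponent u a p ^ n := by
  induction n with
  | zero => simpa using (isWeightedHomogeneous_one k u).weightedHomogeneousComponent_same
  | succ n ih =>
    rw [pow_succ, pow_succ, Nat.cast_succ, add_mul, one_mul,
      weightedHomogeneousComponent_mul_of_Iic (pow_mem_weightSupported_Iic hp n) hp, ih]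

/-- A nonzero polynomial has a monomial of largest weight. -/
theorem exists_mem_weightSupported_Iic (u : σ → ℝ≥0) {p : MvPolynomial σ k} (hp : p ≠ 0) :
    ∃ d, coeff d p ≠ 0 ∧ p ∈ weightSupported k u (Set.Iic (Finsupp.weight u d)) := by
  obtain ⟨d, hd, hmax⟩ := p.support.exists_max_image (Finsupp.weight u)
    (support_nonempty.mpr hp)
  exact ⟨d, mem_support_iff.mp hd, fun e he => hmax e (mem_support_iff.mpr he)⟩

/-- Induction on the degree with respect to positive weights. -/
theorem weightedDegree_induction [Finite σ] {u : σ → ℝ≥0} (hu : ∀ i, 0 < u i)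
    {P : MvPolynomial σ k → Prop} (h0 : P 0)
    (h : ∀ p c, p ∈ weightSupported k u (Set.Iic c) →
      (∀ q ∈ weightSupported k u (Set.Iio c), P q) → P p) (p : MvPolynomial σ k) : P p := by
  have key : ∀ d : σ →₀ ℕ, ∀ p ∈ weightSupported k u (Set.Iic (Finsupp.weight u d)), P p := by
    intro d
    induction d using (wellFounded_weight_lt hu).induction with
    | _ d ih =>
      intro p hp
      refine h p _ hp fun q hq => ?_
      by_cases hq0 : q = 0
      · rwa [hq0]
      obtain ⟨e, he, hqe⟩ := exists_mem_weightSupported_Iic u hq0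
      exact ih e (hq e he) q hqe
  by_cases hp0 : p = 0
  · rwa [hp0]
  obtain ⟨e, he, hpe⟩ := exists_mem_weightSupported_Iic u hp0
  exact key e p hpe

end PolynomialWeights

/-! ### Degenerations of normal domains -/

section Degeneration

open MvPolynomial

/-- In a noetherian integrally closed domain, `a` is divisible by `b` once the powers of `a / b`
have a common denominator. -/
theorem dvd_of_forall_mul_pow {B : Type*} [CommRing B] [IsDomain B] [IsNoetherianRing B]
    [IsIntegrallyClosed B] {a b e : B} (hb : b ≠ 0) (he : e ≠ 0)
    (h : ∀ n : ℕ, ∃ g, e * a ^ n = b ^ n * g) : b ∣ a := by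
  have hb' : algebraMap B (FractionRing B) b ≠ 0 := by simpa using hb
  have hx : IsAlmostIntegral B
      (algebraMap B (FractionRing B) a / algebraMap B (FractionRing B) b) := by
    refine ⟨e, by simpa using he, fun n => ?_⟩
    obtain ⟨g, hg⟩ := h n
    refine ⟨g, ?_⟩
    rw [Algebra.smul_def, div_pow, mul_div_assoc', ← map_pow, ← map_mul, hg, map_mul, map_pow,
      mul_div_cancel_left₀ _ (pow_ne_zero n hb')]
  obtain ⟨c, hc⟩ := IsIntegrallyClosed.isIntegral_iff.mp hx.isIntegral
  refine ⟨c, IsFractionRing.injective B (FractionRing B) ?_⟩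
  rw [map_mul, hc, mul_div_cancel₀ _ hb']

/-- The converse of `dvd_of_forall_mul_pow`; it does not need the ring to be noetherian. -/
theorem isIntegrallyClosed_of_dvd {R : Type*} [CommRing R] [IsDomain R]
    (h : ∀ a b e : R, b ≠ 0 → e ≠ 0 → (∀ n : ℕ, ∃ g, e * a ^ n = b ^ n * g) → b ∣ a) :
    IsIntegrallyClosed R := by
  rw [isIntegrallyClosed_iff (FractionRing R)]
  intro x hx
  obtain ⟨a, b, hb, rfl⟩ := IsFractionRing.div_surjective (A := R) x
  have hb' : algebraMap R (FractionRing R) b ≠ 0 := by simpa using hb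
  obtain ⟨e, he, hen⟩ := hx.isAlmostIntegral
  obtain ⟨c, hc⟩ := h a b e (nonZeroDivisors.ne_zero hb) (nonZeroDivisors.ne_zero he) fun n => by
    obtain ⟨g, hg⟩ := hen n
    refine ⟨g, IsFractionRing.injective R (FractionRing R) ?_⟩
    rw [map_mul, map_mul, hg, Algebra.smul_def, map_pow, map_pow, div_pow, mul_left_comm,
      mul_div_cancel₀ _ (pow_ne_zero n hb')]
  exact ⟨c, by rw [hc, map_mul, mul_div_cancel_left₀ _ hb']⟩

variable {k σ R B : Type*} [Field k] [CommRing R] [CommRing B]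

/-- `B` is the associated graded ring of `R` for the increasing filtration by the `u`-degree of
representing polynomials: the kernel of `Φ` is a homogeneous ideal (`homogeneous`), it contains the
leading forms of the elements of the kernel of `φ` (`symb_ker`), and its homogeneous elements are
such leading forms (`ker_symb`). -/
structure IsTopDegeneration (u : σ → ℝ≥0) (φ : MvPolynomial σ k →+* R)
    (Φ : MvPolynomial σ k →+* B) : Prop where
  surjective_left : Function.Surjective φ
  surjective_right : Function.Surjective Φ
  homogeneous : ∀ q c, Φ q = 0 → Φ (weightedHomogeneousComponent u c q) = 0
  symb_ker : ∀ p c, p ∈ weightSupported k u (Set.Iic c) → φ p = 0 →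
    Φ (weightedHomogeneousComponent u c p) = 0
  ker_symb : ∀ q c, IsWeightedHomogeneous u q c → Φ q = 0 →
    ∃ p, φ p = 0 ∧ q - p ∈ weightSupported k u (Set.Iio c)

namespace IsTopDegeneration

variable {u : σ → ℝ≥0} {φ : MvPolynomial σ k →+* R} {Φ : MvPolynomial σ k →+* B}

/-- If the leading form of `p` vanishes in `B`, the class of `p` in `R` has smaller degree. -/
theorem exists_lt (H : IsTopDegeneration u φ Φ) {p : MvPolynomial σ k} {c : ℝ≥0}
    (hp : p ∈ weightSupported k u (Set.Iic c))
    (h : Φ (weightedHomogeneousComponent u c p) = 0) :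
    ∃ q ∈ weightSupported k u (Set.Iio c), φ q = φ p := by
  obtain ⟨r, hr, hr'⟩ := H.ker_symb _ c (weightedHomogeneousComponent_isWeightedHomogeneous c p) h
  refine ⟨p - r, ?_, by rw [map_sub, hr, sub_zero]⟩
  have e : p - r = (p - weightedHomogeneousComponent u c p) +
    (weightedHomogeneousComponent u c p - r) := by ring
  rw [e]
  exact add_mem (weightSupported_mono (by simp) (sub_weightedHomogeneousComponent_mem hp)) hr'

/-- Every nonzero element of `R` has a representative whose leading form is nonzero in `B`. -/
theorem exists_symb_ne_zero [Finite σ] (H : IsTopDegeneration u φ Φ) (hu : ∀ i, 0 < u i) {r : R}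
    (hr : r ≠ 0) : ∃ p c, φ p = r ∧ p ∈ weightSupported k u (Set.Iic c) ∧
      Φ (weightedHomogeneousComponent u c p) ≠ 0 := by
  obtain ⟨p, rfl⟩ := H.surjective_left r
  revert hr
  induction p using weightedDegree_induction hu with
  | h0 => simp
  | h p c hp ih =>
    intro hr
    by_cases h : Φ (weightedHomogeneousComponent u c p) = 0
    · obtain ⟨q, hq, hqp⟩ := H.exists_lt hp h
      rw [← hqp] at hr ⊢
      exact ih q hq hr
    · exact ⟨p, c, rfl, hp, h⟩

theorem isDomain [Finite σ] (H : IsTopDegeneration u φ Φ) (hu : ∀ i, 0 < u i) [IsDomain B] :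
    IsDomain R := by
  have : Nontrivial R := by
    by_contra h
    rw [not_nontrivial_iff_subsingleton] at h
    have := H.symb_ker 1 0 (mem_Iic_of_isWeightedHomogeneous (isWeightedHomogeneous_one k u))
      (Subsingleton.elim _ _)
    rw [(isWeightedHomogeneous_one k u).weightedHomogeneousComponent_same, map_one] at this
    exact one_ne_zero this
  have : NoZeroDivisors R := by
    refine ⟨fun {r s} hrs => ?_⟩
    by_contra! hne
    obtain ⟨p, c, rfl, hp, hpc⟩ := H.exists_symb_ne_zero hu hne.1
    obtain ⟨q, d, rfl, hq, hqd⟩ := H.exists_symb_ne_zero hu hne.2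
    have := H.symb_ker (p * q) (c + d) (mul_mem_weightSupported_Iic hp hq) (by rw [map_mul, hrs])
    rw [weightedHomogeneousComponent_mul_of_Iic hp hq, map_mul] at this
    exact mul_ne_zero hpc hqd this
  exact NoZeroDivisors.to_isDomain R

/-- Equal elements of `R` with nonzero leading forms have the same degree and leading form. -/
theorem symb_eq (H : IsTopDegeneration u φ Φ) {p q : MvPolynomial σ k} {c d : ℝ≥0}
    (hp : p ∈ weightSupported k u (Set.Iic c)) (hq : q ∈ weightSupported k u (Set.Iic d))
    (hpc : Φ (weightedHomogeneousComponent u c p) ≠ 0)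
    (hqd : Φ (weightedHomogeneousComponent u d q) ≠ 0) (h : φ p = φ q) :
    Φ (weightedHomogeneousComponent u c p) = Φ (weightedHomogeneousComponent u d q) := by
  have h0 : φ (p - q) = 0 := by rw [map_sub, h, sub_self]
  rcases lt_trichotomy c d with hcd | rfl | hcd
  · have := H.symb_ker (p - q) d
      (sub_mem (weightSupported_mono (Set.Iic_subset_Iic.mpr hcd.le) hp) hq) h0
    rw [map_sub, weightedHomogeneousComponent_eq_zero_of_mem hp (by simpa using hcd), zero_sub,
      map_neg, neg_eq_zero] at this
    exact absurd this hqd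
  · have := H.symb_ker (p - q) c (sub_mem hp hq) h0
    rwa [map_sub, map_sub, sub_eq_zero] at this
  · have := H.symb_ker (p - q) c
      (sub_mem hp (weightSupported_mono (Set.Iic_subset_Iic.mpr hcd.le) hq)) h0
    rw [map_sub, weightedHomogeneousComponent_eq_zero_of_mem hq (by simpa using hcd),
      sub_zero] at this
    exact absurd this hpc

/-- Normality lifts from the associated graded ring: if the powers of `a / b` have a common
denominator, so do those of the quotient of the leading forms, which therefore lies in `B`;
subtracting a lift of it lowers the degree of `a`. -/
theorem isIntegrallyClosed [Finite σ] (H : IsTopDegeneration u φ Φ) (hu : ∀ i, 0 < u i) [IsDomain B]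
    [IsNoetherianRing B] [IsIntegrallyClosed B] : IsIntegrallyClosed R := by
  have := H.isDomain hu
  refine isIntegrallyClosed_of_dvd fun a b e hb he hab => ?_
  obtain ⟨q, d, rfl, hq, hqd⟩ := H.exists_symb_ne_zero hu hb
  obtain ⟨s, m, rfl, hs, hsm⟩ := H.exists_symb_ne_zero hu he
  obtain ⟨p, rfl⟩ := H.surjective_left a
  revert hab
  induction p using weightedDegree_induction hu with
  | h0 => simp
  | h p c hp ih =>
    intro hab
    by_cases hpc : Φ (weightedHomogeneousComponent u c p) = 0
    · obtain ⟨r, hr, hrp⟩ := H.exists_lt hp hpc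
      rw [← hrp] at hab ⊢
      exact ih r hr hab
    have hp0 : φ p ≠ 0 := fun h0 => hpc (H.symb_ker p c hp h0)
    have hdvd : Φ (weightedHomogeneousComponent u d q) ∣
        Φ (weightedHomogeneousComponent u c p) := by
      refine dvd_of_forall_mul_pow hqd hsm fun n => ?_
      obtain ⟨g, hg⟩ := hab n
      have hg0 : g ≠ 0 := by
        rintro rfl
        rw [mul_zero] at hg
        exact mul_ne_zero he (pow_ne_zero n hp0) hg
      obtain ⟨g, j, rfl, hgj, hgj'⟩ := H.exists_symb_ne_zero hu hg0
      have h1 := weightedHomogeneousComponent_mul_of_Iic hs (pow_mem_weightSupported_Iic hp n)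
      have h2 := weightedHomogeneousComponent_mul_of_Iic (pow_mem_weightSupported_Iic hq n) hgj
      rw [weightedHomogeneousComponent_pow_of_Iic hp] at h1
      rw [weightedHomogeneousComponent_pow_of_Iic hq] at h2
      refine ⟨Φ (weightedHomogeneousComponent u j g), ?_⟩
      have := H.symb_eq
        (mul_mem_weightSupported_Iic hs (pow_mem_weightSupported_Iic hp n))
        (mul_mem_weightSupported_Iic (pow_mem_weightSupported_Iic hq n) hgj)
        (by rw [h1, map_mul, map_pow]; exact mul_ne_zero hsm (pow_ne_zero n hpc))
        (by rw [h2, map_mul, map_pow]; exact mul_ne_zero (pow_ne_zero n hqd) hgj')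
        (by simpa using hg)
      simpa [h1, h2] using this
    obtain ⟨y, hy⟩ := hdvd
    obtain ⟨y, rfl⟩ := H.surjective_right y
    -- the quotient of the leading forms may be taken to be homogeneous
    have hy' := H.homogeneous (weightedHomogeneousComponent u c p -
      weightedHomogeneousComponent u d q * y) c (by rw [map_sub, map_mul, hy, sub_self])
    have hq' := weightedHomogeneousComponent_isWeightedHomogeneous (w := u) d q
    rw [map_sub, (weightedHomogeneousComponent_isWeightedHomogeneous c
      p).weightedHomogeneousComponent_same] at hy'
    have hdc : d ≤ c := by
      by_contra hlt
      rw [weightedHomogeneousComponent_mul_eq_zero hq' y (not_le.mp hlt), sub_zero] at hy'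
      exact hpc hy'
    obtain ⟨f, rfl⟩ := exists_add_of_le hdc
    rw [weightedHomogeneousComponent_add_mul hq'] at hy'
    have hyf := weightedHomogeneousComponent_isWeightedHomogeneous (w := u) f y
    set z := weightedHomogeneousComponent u f y
    have hp1 : p - q * z ∈ weightSupported k u (Set.Iic (d + f)) :=
      sub_mem hp (mul_mem_weightSupported_Iic hq (mem_Iic_of_isWeightedHomogeneous hyf))
    obtain ⟨r, hr, hrp⟩ := H.exists_lt hp1 (by
      rw [map_sub,
        weightedHomogeneousComponent_mul_of_Iic hq (mem_Iic_of_isWeightedHomogeneous hyf),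
        hyf.weightedHomogeneousComponent_same, hy'])
    -- by the binomial theorem `(a - b z) / b` inherits the common denominator of the powers of `a
    -- / b`
    have hdiv : φ q ∣ φ r := by
      refine ih r hr fun n => ?_
      choose g hg using hab
      refine ⟨∑ i ∈ Finset.range (n + 1), g i * (-φ z) ^ (n - i) * (n.choose i : R), ?_⟩
      rw [hrp, map_sub, map_mul, sub_eq_add_neg, add_pow, Finset.mul_sum, Finset.mul_sum]
      refine Finset.sum_congr rfl fun i hi => ?_
      have hin : i + (n - i) = n := by have := Finset.mem_range.mp hi; omega
      calc φ s * (φ p ^ i * (-(φ q * φ z)) ^ (n - i) * (n.choose i : R))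
          = (φ s * φ p ^ i) * (φ q ^ (n - i) * (-φ z) ^ (n - i)) * (n.choose i : R) := by
            rw [← mul_pow, mul_neg]; ring
        _ = φ q ^ (i + (n - i)) * (g i * (-φ z) ^ (n - i) * (n.choose i : R)) := by
            rw [hg i, pow_add]; ring
        _ = _ := by rw [hin]
    rw [hrp, map_sub, map_mul] at hdiv
    exact (dvd_sub_left (dvd_mul_right _ _)).mp hdiv

end IsTopDegeneration

end Degeneration

/-! ### Weights of power series -/

section SeriesWeights

variable {k τ : Type*} [Field k] {w : τ → ℝ≥0}

theorem coe_le_weight_iff {f : MvPowerSeries τ k} {m : ℝ≥0} :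
    (m : ℝ≥0∞) ≤ weight w f ↔ ∀ d, MvPowerSeries.coeff d f ≠ 0 → m ≤ Finsupp.weight w d := by
  simp [le_weight_iff]

/-- For positive weights the minimum in the definition of the weight is attained. -/
theorem exists_weight_eq [Finite τ] (hw : ∀ i, 0 < w i) {f : MvPowerSeries τ k} (hf : f ≠ 0) :
    ∃ d, MvPowerSeries.coeff d f ≠ 0 ∧ weight w f = (Finsupp.weight w d : ℝ≥0) := by
  obtain ⟨d₀, hd₀⟩ : ∃ d, MvPowerSeries.coeff d f ≠ 0 := by
    by_contra! h
    exact hf (MvPowerSeries.ext h)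
  obtain ⟨d, hd, hmin⟩ := (wellFounded_weight_lt hw).has_min {d | MvPowerSeries.coeff d f ≠ 0}
    ⟨d₀, hd₀⟩
  refine ⟨d, hd, le_antisymm (le_weight_iff.mp le_rfl d hd) (coe_le_weight_iff.mpr fun e he => ?_)⟩
  exact not_lt.mp (hmin e he)

theorem coe_lt_weight_iff [Finite τ] (hw : ∀ i, 0 < w i) {f : MvPowerSeries τ k} {m : ℝ≥0} :
    (m : ℝ≥0∞) < weight w f ↔ ∀ d, MvPowerSeries.coeff d f ≠ 0 → m < Finsupp.weight w d := by
  refine ⟨fun h d hd => by exact_mod_cast h.trans_le (le_weight_iff.mp le_rfl d hd), fun h => ?_⟩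
  by_cases hf : f = 0
  · simp [hf, weight_zero]
  · obtain ⟨d, hd, e⟩ := exists_weight_eq hw hf
    rw [e]
    exact_mod_cast h d hd

theorem weight_neg (f : MvPowerSeries τ k) : weight w (-f) = weight w f := by
  simp [weight]

theorem min_weight_le_weight_sub (f g : MvPowerSeries τ k) :
    min (weight w f) (weight w g) ≤ weight w (f - g) := by
  rw [sub_eq_add_neg, ← weight_neg g]
  exact min_weight_le_weight_add _ _ _

theorem le_weight_coe {p : MvPolynomial τ k} {m : ℝ≥0} (hp : p ∈ weightSupported k w (Set.Ici m)) :
    (m : ℝ≥0∞) ≤ weight w (p : MvPowerSeries τ k) := by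
  rw [coe_le_weight_iff]
  intro d hd
  rw [MvPolynomial.coeff_coe] at hd
  exact hp d hd

theorem le_weight_coe_of_isWeightedHomogeneous {p : MvPolynomial τ k} {m : ℝ≥0}
    (hp : MvPolynomial.IsWeightedHomogeneous w p m) :
    (m : ℝ≥0∞) ≤ weight w (p : MvPowerSeries τ k) :=
  le_weight_coe fun _ hd => (hp hd).ge

/-- Induction on the weight of a power series, from above: it suffices to treat all power series of
weight at least `C` and to reduce to power series of larger weight. -/
theorem weight_induction [Finite τ] (hw : ∀ i, 0 < w i) {α : Type*} (E : α → MvPowerSeries τ k)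
    {P : α → Prop} (C : ℝ≥0) (hC : ∀ a, (C : ℝ≥0∞) ≤ weight w (E a) → P a)
    (h : ∀ a, ∀ m : ℝ≥0, weight w (E a) = m →
      (∀ b, (m : ℝ≥0∞) < weight w (E b) → P b) → P a) (a : α) : P a := by
  -- the number of monomials of weight between that of `E a` and `C` decreases
  obtain ⟨n, hn⟩ : ∃ n, {d : τ →₀ ℕ | weight w (E a) ≤ (Finsupp.weight w d : ℝ≥0) ∧
      Finsupp.weight w d ≤ C}.ncard = n := ⟨_, rfl⟩
  induction n using Nat.strong_induction_on generalizing a with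
  | _ n ih =>
    subst hn
    by_cases hCa : (C : ℝ≥0∞) ≤ weight w (E a)
    · exact hC a hCa
    have hE : E a ≠ 0 := by
      intro h0
      rw [h0, weight_zero] at hCa
      exact hCa le_top
    obtain ⟨d, hd, hwd⟩ := exists_weight_eq hw hE
    refine h a _ hwd fun b hb => ih _ (Set.ncard_lt_ncard ⟨?_, ?_⟩ ?_) b rfl
    · rintro e ⟨he, he'⟩
      exact ⟨hwd.le.trans (hb.le.trans he), he'⟩
    · intro hsub
      have hd' : Finsupp.weight w d ≤ C := by
        rw [hwd] at hCa
        exact_mod_cast (not_le.mp hCa).le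
      exact absurd (hsub (a := d) ⟨hwd.le, hd'⟩).1 (not_le.mpr hb)
    · exact (finite_weight_le hw C).subset fun e he => he.2

theorem finite_weight_eq [Finite τ] (hw : ∀ i, 0 < w i) (m : ℝ≥0) :
    {d : τ →₀ ℕ | Finsupp.weight w d = m}.Finite :=
  (finite_weight_le hw m).subset fun d (hd : Finsupp.weight w d = m) => hd.le

/-- The sum of the terms of weight `m` of a power series, for positive weights. -/
def homogPart [Finite τ] (hw : ∀ i, 0 < w i) (m : ℝ≥0) (f : MvPowerSeries τ k) : MvPolynomial τ k :=
  ∑ d ∈ (finite_weight_eq hw m).toFinset, MvPolynomial.monomial d (MvPowerSeries.coeff d f)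

theorem coeff_homogPart [Finite τ] (hw : ∀ i, 0 < w i) (m : ℝ≥0) (f : MvPowerSeries τ k)
    (d : τ →₀ ℕ) : MvPolynomial.coeff d (homogPart hw m f) =
      if Finsupp.weight w d = m then MvPowerSeries.coeff d f else 0 := by
  classical
  simp [homogPart, MvPolynomial.coeff_sum, MvPolynomial.coeff_monomial]

theorem isWeightedHomogeneous_homogPart [Finite τ] (hw : ∀ i, 0 < w i) (m : ℝ≥0)
    (f : MvPowerSeries τ k) : (homogPart hw m f).IsWeightedHomogeneous w m := by
  intro d hd
  rw [coeff_homogPart] at hd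
  by_contra h
  simp [h] at hd

theorem lt_weight_sub_homogPart [Finite τ] (hw : ∀ i, 0 < w i) {m : ℝ≥0} {f : MvPowerSeries τ k}
    (hf : m ≤ weight w f) : m < weight w (f - (homogPart hw m f : MvPowerSeries τ k)) := by
  rw [coe_lt_weight_iff hw]
  intro d hd
  rw [map_sub, MvPolynomial.coeff_coe, coeff_homogPart] at hd
  split_ifs at hd with h
  · simp at hd
  · rw [sub_zero] at hd
    exact lt_of_le_of_ne (coe_le_weight_iff.mp hf d hd) (Ne.symm h)

end SeriesWeights

/-! ### Homogeneous components as a homomorphism to a monoid algebra -/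

section GradingHom

open MvPolynomial

variable {k σ B M : Type*} [Field k] [CommRing B] [Algebra k B] [AddCommMonoid M]

/-- The homomorphism `p ↦ ∑ₘ f(pₘ) sᵐ` to `B[M]`, where `pₘ` is the component of degree `m` of `p`.
-/
def gradingHom (f : MvPolynomial σ k →ₐ[k] B) (d : σ → M) :
    MvPolynomial σ k →ₐ[k] AddMonoidAlgebra B M :=
  aeval fun i => AddMonoidAlgebra.single (d i) (f (X i))

theorem gradingHom_monomial (f : MvPolynomial σ k →ₐ[k] B) (d : σ → M) (e : σ →₀ ℕ) (c : k) :
    gradingHom f d (monomial e c) =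
      AddMonoidAlgebra.single (Finsupp.weight d e) (f (monomial e c)) := by
  have hC : ∀ c : k, gradingHom f d (C c) = AddMonoidAlgebra.single 0 (f (C c)) := by
    intro c
    rw [← MvPolynomial.algebraMap_eq, AlgHom.commutes, AlgHom.commutes]
    rfl
  induction e using Finsupp.induction_linear generalizing c with
  | zero =>
    rw [map_zero]
    exact hC c
  | add e e' he he' =>
    have : (monomial (e + e') c : MvPolynomial σ k) = monomial e c * monomial e' 1 := by
      simp [monomial_mul]
    rw [this, map_mul, he, he', AddMonoidAlgebra.single_mul_single, map_add, map_mul]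
  | single i n =>
    have : (monomial (Finsupp.single i n) c : MvPolynomial σ k) = C c * X i ^ n := by
      rw [C_mul_X_pow_eq_monomial]
    rw [this, map_mul, map_pow, map_mul, map_pow, hC, gradingHom, aeval_X,
      AddMonoidAlgebra.single_pow, Finsupp.weight_single, AddMonoidAlgebra.single_mul_single,
      zero_add]

theorem coeff_gradingHom (f : MvPolynomial σ k →ₐ[k] B) (d : σ → M) (p : MvPolynomial σ k) (m : M) :
    (gradingHom f d p).coeff m = f (weightedHomogeneousComponent d m p) := by
  classical
  induction p using MvPolynomial.induction_on' with
  | monomial e c =>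
    rw [gradingHom_monomial, weightedHomogeneousComponent_of_mem
      (n := Finsupp.weight d e) (isWeightedHomogeneous_monomial d e c rfl),
      AddMonoidAlgebra.coeff_single, Finsupp.single_apply]
    by_cases h : m = Finsupp.weight d e
    · simp [h]
    · simp [h, Ne.symm h]
  | add p q hp hq =>
    rw [map_add, map_add, map_add, AddMonoidAlgebra.coeff_add, Finsupp.add_apply, hp, hq]

end GradingHom

/-! ### Presentation of the graded ring by the initial ideal -/

section Presentation

open MvPolynomial

variable {k τ P : Type*} [Field k] [CommRing P] [Algebra k P]

/-- `E` is the expansion of functions on `Spec P` at a `k`-rational point at which the functions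
`x i` are coordinates: they expand to the variables and generate the maximal ideal of the local
ring. -/
structure IsCoordinateExpansion (E : P →+* MvPowerSeries τ k) (x : τ → P) : Prop where
  map_algebraMap : ∀ c, E (algebraMap k P c) = MvPowerSeries.C c
  map_coord : ∀ i, E (x i) = MvPowerSeries.X i
  mem_span : ∀ q : AmbientRing E, MvPowerSeries.constantCoeff (expand E q) = 0 →
    q ∈ Ideal.span (Set.range fun i => algebraMap P (AmbientRing E) (x i))

namespace IsCoordinateExpansion

variable {E : P →+* MvPowerSeries τ k} {x : τ → P} (H : IsCoordinateExpansion E x)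
  (I : Ideal P) (w : τ → ℝ≥0)

/-- A polynomial in the coordinates as an element of the local ring. -/
def coordEval (_ : IsCoordinateExpansion E x) : MvPolynomial τ k →ₐ[k] AmbientRing E :=
  aeval fun i => algebraMap P (AmbientRing E) (x i)

theorem coordEval_X (i : τ) : H.coordEval (X i) = algebraMap P (AmbientRing E) (x i) := by
  simp [coordEval]

theorem expand_coordEval (p : MvPolynomial τ k) :
    expand E (H.coordEval p) = (p : MvPowerSeries τ k) := by
  have : (expand E).comp H.coordEval.toRingHom = coeToMvPowerSeries.ringHom := by
    refine MvPolynomial.ringHom_ext (fun c => ?_) fun i => ?_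
    · have : H.coordEval (C c) = algebraMap P (AmbientRing E) (algebraMap k P c) := by
        rw [← MvPolynomial.algebraMap_eq, AlgHom.commutes, ← IsScalarTower.algebraMap_apply]
      simp [this, expand_algebraMap, H.map_algebraMap]
    · simp [coordEval_X, expand_algebraMap, H.map_coord]
  exact RingHom.congr_fun this p

/-- The homomorphism from the polynomial ring to the graded ring that sends the variables to the
classes of the coordinates. -/
def grHom : MvPolynomial τ k →ₐ[k] Gr (k := k) E I w :=
  aeval fun i => coordSymb E I w (H.map_coord i)

theorem grHom_X (i : τ) : H.grHom I w (X i) = coordSymb E I w (H.map_coord i) := by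
  simp [grHom]

/-- The homomorphism from the polynomial ring to `𝒪[ℝ≥0]` that sends `xᵢ` to `xᵢ s ^ wᵢ`. -/
def reesHom (_ : IsCoordinateExpansion E x) :
    MvPolynomial τ k →ₐ[k] AddMonoidAlgebra (Stalk E I) ℝ≥0 :=
  aeval fun i => AddMonoidAlgebra.single (w i) (restrict E I (algebraMap P (AmbientRing E) (x i)))

theorem coeff_reesHom (p : MvPolynomial τ k) (m : ℝ≥0) : (H.reesHom I w p).coeff m =
    restrict E I (H.coordEval (weightedHomogeneousComponent w m p)) := by
  have := coeff_gradingHom ((Ideal.Quotient.mkₐ k (I.map (algebraMap P (AmbientRing E)))).comp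
    H.coordEval) w p m
  simp only [gradingHom, AlgHom.comp_apply, coordEval_X] at this
  exact this

theorem reesHom_mem (p : MvPolynomial τ k) :
    H.reesHom I w p ∈ (weightFiltration E I w).rees k := by
  intro m
  rw [coeff_reesHom]
  refine ⟨_, ?_, rfl⟩
  rw [expand_coordEval]
  exact le_weight_coe_of_isWeightedHomogeneous
    (weightedHomogeneousComponent_isWeightedHomogeneous m p)

theorem grHom_apply (p : MvPolynomial τ k) :
    H.grHom I w p = (weightFiltration E I w).toGr k ⟨H.reesHom I w p, H.reesHom_mem I w p⟩ := by
  have : H.grHom I w = ((weightFiltration E I w).toGr k).comp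
      ((H.reesHom I w).codRestrict _ (H.reesHom_mem I w)) := by
    refine MvPolynomial.algHom_ext fun i => ?_
    rw [grHom_X]
    refine congrArg ((weightFiltration E I w).toGr k) (Subtype.ext ?_)
    simp [reesHom]
  exact DFunLike.congr_fun this p

theorem toGr_eq_zero_iff (r : (weightFiltration E I w).rees k) :
    (weightFiltration E I w).toGr k r = 0 ↔ ∀ m, r.1.coeff m ∈ filLT E I w m :=
  Ideal.Quotient.eq_zero_iff_mem

/-- The kernel of `grHom` is the initial ideal of `I`: the homogeneous components of its elements
are the initial forms of elements of the ideal that `I` generates in the local ring. -/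
theorem grHom_eq_zero_iff {p : MvPolynomial τ k} : H.grHom I w p = 0 ↔
    ∀ m : ℝ≥0, ∃ F ∈ I.map (algebraMap P (AmbientRing E)), (m : ℝ≥0∞) <
      weight w (expand E F - (weightedHomogeneousComponent w m p : MvPowerSeries τ k)) := by
  rw [grHom_apply, toGr_eq_zero_iff]
  refine forall_congr' fun m => ?_
  rw [coeff_reesHom]
  constructor
  · rintro ⟨f, hf, hfe⟩
    refine ⟨H.coordEval (weightedHomogeneousComponent w m p) - f, ?_, ?_⟩
    · exact (Ideal.Quotient.eq (I := I.map (algebraMap P (AmbientRing E)))).mp hfe.symm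
    · rw [map_sub, expand_coordEval, sub_sub_cancel_left, weight_neg]
      exact hf
  · rintro ⟨F, hF, hlt⟩
    refine ⟨H.coordEval (weightedHomogeneousComponent w m p) - F, ?_, ?_⟩
    · rw [map_sub, expand_coordEval, ← weight_neg, neg_sub]
      exact hlt
    · rw [map_sub, Ideal.Quotient.eq_zero_iff_mem.mpr hF, sub_zero]

theorem grHom_eq_zero_iff_of_isWeightedHomogeneous {p : MvPolynomial τ k} {m : ℝ≥0}
    (hp : p.IsWeightedHomogeneous w m) : H.grHom I w p = 0 ↔
    ∃ F ∈ I.map (algebraMap P (AmbientRing E)),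
      (m : ℝ≥0∞) < weight w (expand E F - (p : MvPowerSeries τ k)) := by
  rw [grHom_eq_zero_iff]
  constructor
  · intro h
    simpa [hp.weightedHomogeneousComponent_same] using h m
  · intro h n
    by_cases hn : n = m
    · rw [hn, hp.weightedHomogeneousComponent_same]
      exact h
    · refine ⟨0, zero_mem _, ?_⟩
      rw [hp.weightedHomogeneousComponent_ne n hn]
      simp [weight_zero]

theorem grHom_weightedHomogeneousComponent {p : MvPolynomial τ k} (hp : H.grHom I w p = 0)
    (m : ℝ≥0) : H.grHom I w (weightedHomogeneousComponent w m p) = 0 := by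
  rw [grHom_eq_zero_iff_of_isWeightedHomogeneous _ _ _
    (weightedHomogeneousComponent_isWeightedHomogeneous m p)]
  exact (H.grHom_eq_zero_iff I w).mp hp m

theorem grHom_eq_zero_of_components {p : MvPolynomial τ k}
    (hp : ∀ m, H.grHom I w (weightedHomogeneousComponent w m p) = 0) : H.grHom I w p = 0 := by
  rw [← sum_weightedHomogeneousComponent w p, finsum_eq_sum _
    (weightedHomogeneousComponent_finsupp p), map_sum]
  exact Finset.sum_eq_zero fun m _ => hp m

theorem grHom_surjective [Finite τ] (hw : ∀ i, 0 < w i) : Function.Surjective (H.grHom I w) := by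
  classical
  intro y
  obtain ⟨r, rfl⟩ := Ideal.Quotient.mk_surjective y
  change ∃ p, H.grHom I w p = (weightFiltration E I w).toGr k r
  choose F hF hFr using r.2
  refine ⟨∑ n ∈ r.1.coeff.support, homogPart hw n (expand E (F n)), ?_⟩
  rw [← sub_eq_zero, grHom_apply, ← map_sub, toGr_eq_zero_iff]
  intro m
  change (H.reesHom I w _ - r.1).coeff m ∈ _
  rw [AddMonoidAlgebra.coeff_sub, Finsupp.sub_apply, coeff_reesHom, map_sum]
  have : ∑ n ∈ r.1.coeff.support,
      weightedHomogeneousComponent w m (homogPart hw n (expand E (F n))) =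
      if m ∈ r.1.coeff.support then homogPart hw m (expand E (F m)) else 0 := by
    rw [← Finset.sum_ite_eq r.1.coeff.support m fun n => homogPart hw n (expand E (F n))]
    exact Finset.sum_congr rfl fun n _ => weightedHomogeneousComponent_of_mem
      (isWeightedHomogeneous_homogPart hw n _)
  rw [this]
  split_ifs with hm
  · refine ⟨H.coordEval (homogPart hw m (expand E (F m))) - F m, ?_, ?_⟩
    · rw [map_sub, expand_coordEval, ← weight_neg, neg_sub]
      exact lt_weight_sub_homogPart hw (hF m)
    · rw [map_sub, hFr]
  · rw [Finsupp.notMem_support_iff.mp hm, map_zero, map_zero, sub_zero]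
    exact zero_mem _

/-! ### Weights and powers of the maximal ideal -/

/-- The ideal of all function germs of weight at least `m`. -/
def weightIdeal (E : P →+* MvPowerSeries τ k) (w : τ → ℝ≥0) (m : ℝ≥0) : Ideal (AmbientRing E) where
  carrier := {f | (m : ℝ≥0∞) ≤ weight w (expand E f)}
  add_mem' := by
    intro f g hf hg
    change _ ≤ weight w (expand E (f + g))
    rw [map_add]
    exact (le_min hf hg).trans (min_weight_le_weight_add _ _ _)
  zero_mem' := by simp [weight_zero]
  smul_mem' := by
    intro c f hf
    change _ ≤ weight w (expand E (c * f))
    rw [map_mul]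
    exact (le_trans hf le_add_self).trans (weight_add_weight_le_weight_mul _ _ _)

omit [Algebra k P] in
theorem mem_weightIdeal {w : τ → ℝ≥0} {m : ℝ≥0} {f : AmbientRing E} :
    f ∈ weightIdeal E w m ↔ (m : ℝ≥0∞) ≤ weight w (expand E f) := Iff.rfl

omit [Algebra k P] in
theorem weightIdeal_mul_le (a b : ℝ≥0) :
    weightIdeal E w a * weightIdeal E w b ≤ weightIdeal E w (a + b) := by
  refine Ideal.mul_le.mpr fun f hf g hg => ?_
  rw [mem_weightIdeal, map_mul, ENNReal.coe_add]
  exact (add_le_add hf hg).trans (weight_add_weight_le_weight_mul _ _ _)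

omit [Algebra k P] in
theorem weightIdeal_pow_le (a : ℝ≥0) (n : ℕ) : weightIdeal E w a ^ n ≤ weightIdeal E w (n * a) := by
  induction n with
  | zero => intro f _; simp [mem_weightIdeal]
  | succ n ih =>
    rw [pow_succ, Nat.cast_succ, add_mul, one_mul]
    exact (Ideal.mul_mono_left ih).trans (weightIdeal_mul_le w _ _)

/-- The maximal ideal of the local ring, as generated by the coordinates. -/
def coordIdeal (_ : IsCoordinateExpansion E x) : Ideal (AmbientRing E) :=
  Ideal.span (Set.range fun i => algebraMap P (AmbientRing E) (x i))

theorem coord_mem_coordIdeal (i : τ) : algebraMap P (AmbientRing E) (x i) ∈ H.coordIdeal :=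
  Ideal.subset_span ⟨i, rfl⟩

theorem coordIdeal_pow_le {a : ℝ≥0} (ha : ∀ i, a ≤ w i) (n : ℕ) :
    H.coordIdeal ^ n ≤ weightIdeal E w (n * a) := by
  refine (Ideal.pow_right_mono (Ideal.span_le.mpr ?_) n).trans (weightIdeal_pow_le w a n)
  rintro _ ⟨i, rfl⟩
  change (a : ℝ≥0∞) ≤ weight w (expand E _)
  rw [expand_algebraMap, H.map_coord]
  exact (ENNReal.coe_le_coe.mpr (ha i)).trans (weight_X w i)

theorem mem_and_le_weight_of_mem {a : ℝ≥0} (ha : ∀ i, a ≤ w i) {n : ℕ} {J : Ideal (AmbientRing E)}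
    {f : AmbientRing E} (hf : f ∈ H.coordIdeal ^ n * J) :
    f ∈ J ∧ ((n * a : ℝ≥0) : ℝ≥0∞) ≤ weight w (expand E f) := by
  have h1 : H.coordIdeal ^ n * J ≤ J := Ideal.mul_le_right
  have h2 : H.coordIdeal ^ n * J ≤ H.coordIdeal ^ n := Ideal.mul_le_left
  exact ⟨h1 hf, H.coordIdeal_pow_le w ha n (h2 hf)⟩

/-- Every function germ is a polynomial in the coordinates up to a high power of the maximal
ideal. -/
theorem exists_sub_mem_coordIdeal_pow (n : ℕ) (f : AmbientRing E) [Finite τ] :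
    ∃ p, f - H.coordEval p ∈ H.coordIdeal ^ n := by
  have := Fintype.ofFinite τ
  induction n generalizing f with
  | zero => exact ⟨0, by simp⟩
  | succ n ih =>
    have h := H.mem_span (f - H.coordEval (C (MvPowerSeries.constantCoeff (expand E f))))
      (by rw [map_sub, expand_coordEval]; simp)
    obtain ⟨c, hc⟩ := Ideal.mem_span_range_iff_exists_fun.mp h
    choose p hp using fun i => ih (c i)
    refine ⟨C (MvPowerSeries.constantCoeff (expand E f)) + ∑ i, p i * X i, ?_⟩
    rw [map_add, ← sub_sub, ← hc, map_sum, ← Finset.sum_sub_distrib]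
    refine Ideal.sum_mem _ fun i _ => ?_
    rw [map_mul, coordEval_X, ← sub_mul, pow_succ]
    exact Ideal.mul_mem_mul (hp i) (H.coord_mem_coordIdeal i)

theorem coordEval_mem_coordIdeal_pow {p : MvPolynomial τ k} {n : ℕ}
    (hp : ∀ d, coeff d p ≠ 0 → n ≤ d.degree) : H.coordEval p ∈ H.coordIdeal ^ n := by
  rw [p.as_sum, map_sum]
  refine Ideal.sum_mem _ fun d hd => ?_
  refine Ideal.pow_le_pow_right (hp d (mem_support_iff.mp hd)) ?_
  clear hd
  generalize coeff d p = c
  induction d using Finsupp.induction_linear generalizing c with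
  | zero => simp
  | add d e hd he =>
    have : (monomial (d + e) c : MvPolynomial τ k) = monomial d c * monomial e 1 := by
      simp [monomial_mul]
    rw [this, map_mul, map_add, pow_add]
    exact Ideal.mul_mem_mul (hd c) (he 1)
  | single i n =>
    rw [← C_mul_X_pow_eq_monomial, map_mul, map_pow, coordEval_X, Finsupp.degree_single]
    exact Ideal.mul_mem_left _ _ (Ideal.pow_mem_pow (H.coord_mem_coordIdeal i) n)

/-- Function germs of large weight lie in a high power of the maximal ideal. -/
theorem mem_coordIdeal_pow_of_le_weight [Finite τ] {b : ℝ≥0} (hb : 0 < b) (hwb : ∀ i, w i ≤ b)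
    {n : ℕ} {f : AmbientRing E} (hf : ((n * b : ℝ≥0) : ℝ≥0∞) ≤ weight w (expand E f)) :
    f ∈ H.coordIdeal ^ n := by
  have hdeg : ∀ d : τ →₀ ℕ, Finsupp.weight w d ≤ d.degree * b := by
    intro d
    rw [Finsupp.weight_apply, Finsupp.degree_apply, Finsupp.sum, Nat.cast_sum, Finset.sum_mul]
    refine Finset.sum_le_sum fun i _ => ?_
    rw [nsmul_eq_mul]
    exact mul_le_mul_right (hwb i) _
  have hone : ∀ d : τ →₀ ℕ, Finsupp.weight (fun _ => (1 : ℝ≥0)) d = d.degree := by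
    intro d
    rw [Finsupp.weight_apply, Finsupp.degree_apply, Finsupp.sum, Nat.cast_sum]
    simp
  obtain ⟨p, hp⟩ := H.exists_sub_mem_coordIdeal_pow n f
  have h1 := H.coordIdeal_pow_le (fun _ => 1) (fun _ => le_rfl) n hp
  rw [mem_weightIdeal, mul_one, map_sub, expand_coordEval, coe_le_weight_iff] at h1
  rw [coe_le_weight_iff] at hf
  have h2 : H.coordEval p ∈ H.coordIdeal ^ n := by
    refine H.coordEval_mem_coordIdeal_pow fun d hd => ?_
    by_cases hdf : MvPowerSeries.coeff d (expand E f) = 0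
    · have := h1 d (by rw [map_sub, hdf, coeff_coe, zero_sub]; exact neg_ne_zero.mpr hd)
      rw [hone] at this
      exact_mod_cast this
    · have := (hf d hdf).trans (hdeg d)
      exact_mod_cast le_of_mul_le_mul_right this hb
  simpa using add_mem hp h2

/-- Equations of large weight are combinations of equations with coefficients in a high power of the
maximal ideal, by the Artin–Rees lemma. -/
theorem exists_forall_mem_coordIdeal_pow_mul [Finite τ] [IsNoetherianRing (AmbientRing E)]
    (J : Ideal (AmbientRing E)) (N : ℕ) :
    ∃ C : ℝ≥0, ∀ f ∈ J, (C : ℝ≥0∞) ≤ weight w (expand E f) → f ∈ H.coordIdeal ^ N * J := by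
  obtain ⟨b, hb⟩ := (Set.finite_range w).bddAbove
  have hwb : ∀ i, w i ≤ b + 1 := fun i => (hb ⟨i, rfl⟩).trans le_self_add
  obtain ⟨c, hc⟩ := Ideal.exists_pow_inf_eq_pow_smul H.coordIdeal J
  refine ⟨((N + c : ℕ) : ℝ≥0) * (b + 1), fun f hf hfw => ?_⟩
  have h1 : f ∈ H.coordIdeal ^ (N + c) • (⊤ : Ideal (AmbientRing E)) ⊓ J :=
    ⟨by simpa using H.mem_coordIdeal_pow_of_le_weight w (by positivity) hwb hfw, hf⟩
  rw [hc (N + c) (Nat.le_add_left _ _), Nat.add_sub_cancel] at h1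
  exact Submodule.smul_mono le_rfl inf_le_right h1

end IsCoordinateExpansion

end Presentation

/-! ### The local ring of the family and its restriction to the central fibre -/

theorem sub_C_constantCoeff_mem_span_X {R σ : Type*} [CommRing R] (p : MvPolynomial σ R) :
    p - MvPolynomial.C (MvPolynomial.constantCoeff p) ∈
      Ideal.span (Set.range (MvPolynomial.X : σ → MvPolynomial σ R)) := by
  classical
  rw [← Set.image_univ, MvPolynomial.mem_ideal_span_X_image]
  intro d hd
  by_contra! h
  have hd0 : d = 0 := Finsupp.ext fun i => h i trivial
  rw [MvPolynomial.mem_support_iff, hd0, MvPolynomial.coeff_sub, MvPolynomial.coeff_C, if_pos rfl,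
    MvPolynomial.constantCoeff_eq, sub_self] at hd
  exact hd rfl

/-- In the local ring at the origin, membership in an ideal may be tested on numerators. -/
theorem exists_algebraMap_eq_unit_mul {k τ P : Type*} [Field k] [CommRing P]
    {E : P →+* MvPowerSeries τ k} (q : AmbientRing E) :
    ∃ (a : P) (s : AmbientRing E), IsUnit s ∧ algebraMap P (AmbientRing E) a = s * q := by
  obtain ⟨⟨a, s⟩, h⟩ := IsLocalization.surj (originIdeal E).primeCompl q
  exact ⟨a, _, IsLocalization.map_units _ s, by rw [← h, mul_comm]⟩

theorem constantCoeff_fibreExp {k : Type*} [Field k] {l : ℕ} (f : MvPolynomial (Fin l) k) :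
    MvPowerSeries.constantCoeff (PointedCurve.fibreExp k l f) = MvPolynomial.constantCoeff f := by
  rw [← MvPowerSeries.coeff_zero_eq_constantCoeff_apply]
  exact MvPolynomial.coeff_coe f 0

theorem isCoordinateExpansion_fibreExp (k : Type*) [Field k] (l : ℕ) :
    IsCoordinateExpansion (PointedCurve.fibreExp k l) MvPolynomial.X where
  map_algebraMap c := by simp [MvPolynomial.algebraMap_eq]
  map_coord i := PointedCurve.fibreExp_z i
  mem_span q hq := by
    obtain ⟨a, s, hs, h⟩ := exists_algebraMap_eq_unit_mul q
    rw [← Ideal.unit_mul_mem_iff_mem _ hs, ← h, Set.range_comp' (algebraMap _ _), ← Ideal.map_span]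
    refine Ideal.mem_map_of_mem _ ?_
    have h0 : MvPolynomial.constantCoeff a = 0 := by
      have := congrArg (fun x => MvPowerSeries.constantCoeff (expand _ x)) h
      simp only [expand_algebraMap, map_mul, hq, mul_zero] at this
      rwa [← constantCoeff_fibreExp]
    simpa [h0] using sub_C_constantCoeff_mem_span_X a

/-- Restriction of power series to the hyperplane where the variable with index `0` vanishes. -/
def restrictSeries (k : Type*) [Field k] (l : ℕ) :
    MvPowerSeries (Fin (l + 1)) k →+* MvPowerSeries (Fin l) k where
  toFun f := fun d => MvPowerSeries.coeff (Finsupp.cons 0 d) f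
  map_zero' := by
    ext d
    change MvPowerSeries.coeff (Finsupp.cons 0 d) 0 = MvPowerSeries.coeff d 0
    simp
  map_one' := by
    classical
    ext d
    change MvPowerSeries.coeff (Finsupp.cons 0 d) 1 = MvPowerSeries.coeff d 1
    by_cases hd : d = 0
    · simp [hd]
    · rw [MvPowerSeries.coeff_one, MvPowerSeries.coeff_one, if_neg hd,
        if_neg (Finsupp.cons_ne_zero_of_right hd)]
  map_add' f g := by
    ext d
    exact map_add (MvPowerSeries.coeff (Finsupp.cons 0 d)) f g
  map_mul' f g := by
    classical
    ext d
    change MvPowerSeries.coeff (Finsupp.cons 0 d) (f * g) = _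
    rw [MvPowerSeries.coeff_mul]
    refine Eq.trans ?_ (MvPowerSeries.coeff_mul d _ _).symm
    refine Finset.sum_nbij' (fun p => (p.1.tail, p.2.tail))
      (fun p => (Finsupp.cons 0 p.1, Finsupp.cons 0 p.2)) ?_ ?_ ?_ ?_ ?_
    · intro p hp
      rw [Finset.HasAntidiagonal.mem_antidiagonal] at hp ⊢
      ext i
      have := DFunLike.congr_fun hp i.succ
      simpa [Finsupp.tail_apply] using this
    · intro p hp
      rw [Finset.HasAntidiagonal.mem_antidiagonal] at hp ⊢
      ext i
      refine Fin.cases (by simp) (fun i => ?_) i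
      simpa using DFunLike.congr_fun hp i
    · intro p hp
      rw [Finset.HasAntidiagonal.mem_antidiagonal] at hp
      have h0 := DFunLike.congr_fun hp 0
      simp only [Finsupp.add_apply, Finsupp.cons_zero, Nat.add_eq_zero_iff] at h0
      ext i
      · refine Fin.cases ?_ (fun i => ?_) i <;> simp [h0.1, Finsupp.tail_apply]
      · refine Fin.cases ?_ (fun i => ?_) i <;> simp [h0.2, Finsupp.tail_apply]
    · intro p _
      simp
    · intro p hp
      rw [Finset.HasAntidiagonal.mem_antidiagonal] at hp
      have h0 := DFunLike.congr_fun hp 0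
      simp only [Finsupp.add_apply, Finsupp.cons_zero, Nat.add_eq_zero_iff] at h0
      have h1 : Finsupp.cons 0 p.1.tail = p.1 := by
        conv_rhs => rw [← Finsupp.cons_tail p.1, h0.1]
      have h2 : Finsupp.cons 0 p.2.tail = p.2 := by
        conv_rhs => rw [← Finsupp.cons_tail p.2, h0.2]
      change _ = MvPowerSeries.coeff (Finsupp.cons 0 p.1.tail) f *
        MvPowerSeries.coeff (Finsupp.cons 0 p.2.tail) g
      rw [h1, h2]

theorem coeff_restrictSeries {k : Type*} [Field k] {l : ℕ} (f : MvPowerSeries (Fin (l + 1)) k)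
    (d : Fin l →₀ ℕ) : MvPowerSeries.coeff d (restrictSeries k l f) =
      MvPowerSeries.coeff (Finsupp.cons 0 d) f := rfl

theorem restrictSeries_X_zero (k : Type*) [Field k] (l : ℕ) :
    restrictSeries k l (MvPowerSeries.X 0) = 0 := by
  classical
  ext d
  rw [coeff_restrictSeries, MvPowerSeries.coeff_X, if_neg, map_zero]
  intro h
  simpa using DFunLike.congr_fun h 0

theorem restrictSeries_X_succ {k : Type*} [Field k] {l : ℕ} (i : Fin l) :
    restrictSeries k l (MvPowerSeries.X i.succ) = MvPowerSeries.X i := by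
  classical
  ext d
  rw [coeff_restrictSeries, MvPowerSeries.coeff_X, MvPowerSeries.coeff_X,
    ← Finsupp.cons_zero_single_eq_single_succ]
  simp only [(Finsupp.cons_right_injective (y := (0 : ℕ))).eq_iff]

theorem restrictSeries_C {k : Type*} [Field k] {l : ℕ} (c : k) :
    restrictSeries k l (MvPowerSeries.C c) = MvPowerSeries.C c := by
  classical
  ext d
  rw [coeff_restrictSeries, MvPowerSeries.coeff_C, MvPowerSeries.coeff_C,
    ← Finsupp.cons_zero_zero (M := ℕ)]
  simp only [(Finsupp.cons_right_injective (y := (0 : ℕ))).eq_iff]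

namespace PointedCurve

open MvPolynomial

variable {k A : Type*} [Field k] [CommRing A] [IsDomain A] [Algebra k A] (Δ : PointedCurve k A)
variable {l : ℕ}

/-- The coordinates `t, z₁, …, z_l` on `Δ × 𝔸ˡ`. -/
def totalCoord (l : ℕ) : Fin (l + 1) → MvPolynomial (Fin l) A := Fin.cons (C Δ.t) X

/-- The local ring of `Δ × 𝔸ˡ` at the origin. -/
abbrev TotalRing (l : ℕ) : Type _ := AmbientRing (Δ.totalExp l)

/-- The local ring of `𝔸ˡ` at the origin. -/
abbrev FibreRing (k : Type*) [Field k] (l : ℕ) : Type _ := AmbientRing (fibreExp k l)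

/-- The coordinate `t` as an element of the local ring of `Δ × 𝔸ˡ` at the origin. -/
def tTotal (l : ℕ) : Δ.TotalRing l := algebraMap (MvPolynomial (Fin l) A) (Δ.TotalRing l) (C Δ.t)

theorem exists_mul_eq_mul_t {a : A} (ha : Δ.pt a = 0) :
    ∃ s c, Δ.pt s ≠ 0 ∧ s * a = c * Δ.t := by
  have h : algebraMap A Δ.LocalRing a ∈ RingHom.ker Δ.evalZero := by
    rw [RingHom.mem_ker, evalZero_algebraMap, ha]
  rw [ker_evalZero, Ideal.mem_span_singleton] at h
  obtain ⟨q, hq⟩ := h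
  obtain ⟨⟨c, s⟩, hs⟩ := IsLocalization.surj (RingHom.ker Δ.pt).primeCompl q
  refine ⟨s, c, s.2, ?_⟩
  refine IsLocalization.injective Δ.LocalRing (RingHom.ker Δ.pt).primeCompl_le_nonZeroDivisors ?_
  rw [map_mul, map_mul, hq, ← hs, tLoc]
  ring

/-- A function that vanishes at `0` is a multiple of `t` near the origin of `Δ × 𝔸ˡ`. -/
theorem algebraMap_C_mem_span_t {a : A} (ha : Δ.pt a = 0) :
    algebraMap (MvPolynomial (Fin l) A) (Δ.TotalRing l) (C a) ∈ Ideal.span {Δ.tTotal l} := by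
  obtain ⟨s, c, hs, h⟩ := Δ.exists_mul_eq_mul_t ha
  have hs' : IsUnit (algebraMap (MvPolynomial (Fin l) A) (Δ.TotalRing l) (C s)) := by
    refine IsLocalization.map_units _ (⟨C s, ?_⟩ : (originIdeal (Δ.totalExp l)).primeCompl)
    intro h0
    have : Δ.pt s = 0 := by
      simpa [RingHom.mem_ker, constantCoeff_totalExp] using h0
    exact hs this
  rw [← Ideal.unit_mul_mem_iff_mem _ hs', ← map_mul, ← C_mul, h, C_mul, map_mul]
  exact Ideal.mul_mem_left _ _ (Ideal.mem_span_singleton_self _)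

theorem totalExp_C (a : A) : Δ.totalExp l (C a) =
    PowerSeries.toMvPowerSeries (0 : Fin (l + 1)) (Δ.taylor (algebraMap A Δ.LocalRing a)) := by
  simp [totalExp]

theorem isCoordinateExpansion_totalExp (l : ℕ) :
    IsCoordinateExpansion (Δ.totalExp l) (Δ.totalCoord l) where
  map_algebraMap c := by
    rw [IsScalarTower.algebraMap_apply k A, MvPolynomial.algebraMap_eq, totalExp_C,
      ← IsScalarTower.algebraMap_apply]
    have : Δ.taylor (algebraMap k Δ.LocalRing c) = PowerSeries.C c := Δ.taylorFun_algebraMap c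
    rw [this, PowerSeries.toMvPowerSeries_C]
  map_coord i := by
    refine Fin.cases ?_ (fun i => ?_) i
    · exact Δ.totalExp_t l
    · exact Δ.totalExp_z i
  mem_span q hq := by
    obtain ⟨a, s, hs, h⟩ := exists_algebraMap_eq_unit_mul q
    rw [← Ideal.unit_mul_mem_iff_mem _ hs, ← h]
    have h0 : Δ.pt (constantCoeff a) = 0 := by
      have := congrArg (fun x => MvPowerSeries.constantCoeff (expand _ x)) h
      simpa [expand_algebraMap, hq, constantCoeff_totalExp] using this
    have e : algebraMap (MvPolynomial (Fin l) A) (Δ.TotalRing l) a =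
        algebraMap (MvPolynomial (Fin l) A) (Δ.TotalRing l) (a - C (constantCoeff a)) +
          algebraMap (MvPolynomial (Fin l) A) (Δ.TotalRing l) (C (constantCoeff a)) := by
      rw [← map_add, sub_add_cancel]
    rw [e]
    refine add_mem ?_ ?_
    · have := Ideal.mem_map_of_mem (algebraMap _ (Δ.TotalRing l)) (sub_C_constantCoeff_mem_span_X a)
      rw [Ideal.map_span] at this
      refine Ideal.span_mono ?_ this
      rintro _ ⟨_, ⟨i, rfl⟩, rfl⟩
      exact ⟨i.succ, rfl⟩
    · refine Ideal.span_mono ?_ (Δ.algebraMap_C_mem_span_t h0)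
      rintro _ rfl
      exact ⟨0, rfl⟩

theorem constantCoeff_map_pt (f : MvPolynomial (Fin l) A) :
    constantCoeff (map (Δ.pt : A →+* k) f) = Δ.pt (constantCoeff f) := by
  simp [constantCoeff_map]

theorem primeCompl_le_comap : (originIdeal (Δ.totalExp l)).primeCompl ≤
    (originIdeal (fibreExp k l)).primeCompl.comap (map (Δ.pt : A →+* k)) := by
  intro s hs h0
  refine hs ?_
  rw [SetLike.mem_coe, RingHom.mem_ker, RingHom.comp_apply, constantCoeff_fibreExp,
    constantCoeff_map_pt] at h0
  rw [SetLike.mem_coe, RingHom.mem_ker, RingHom.comp_apply, constantCoeff_totalExp]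
  exact h0

/-- Restriction of function germs on `Δ × 𝔸ˡ` to the fibre over `0`. -/
def toFibre (l : ℕ) : Δ.TotalRing l →+* FibreRing k l :=
  IsLocalization.map (M := (originIdeal (Δ.totalExp l)).primeCompl)
    (T := (originIdeal (fibreExp k l)).primeCompl) (FibreRing k l) (map (Δ.pt : A →+* k))
    Δ.primeCompl_le_comap

theorem toFibre_algebraMap (a : MvPolynomial (Fin l) A) :
    Δ.toFibre l (algebraMap _ (Δ.TotalRing l) a) =
      algebraMap _ (FibreRing k l) (map (Δ.pt : A →+* k) a) :=
  IsLocalization.map_eq _ a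

theorem toFibre_surjective : Function.Surjective (Δ.toFibre l) := by
  intro q
  have hsurj : Function.Surjective (map (Δ.pt : A →+* k) : MvPolynomial (Fin l) A → _) :=
    map_surjective _ fun c => ⟨algebraMap k A c, by simp⟩
  obtain ⟨⟨a, s⟩, h⟩ := IsLocalization.surj (originIdeal (fibreExp k l)).primeCompl q
  obtain ⟨a', ha'⟩ := hsurj a
  obtain ⟨s', hs'⟩ := hsurj s
  have hs0 : s' ∈ (originIdeal (Δ.totalExp l)).primeCompl := by
    intro h0
    refine s.2 ?_
    rw [SetLike.mem_coe, RingHom.mem_ker, RingHom.comp_apply, constantCoeff_totalExp] at h0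
    rw [SetLike.mem_coe, RingHom.mem_ker, RingHom.comp_apply, constantCoeff_fibreExp, ← hs',
      constantCoeff_map_pt, h0]
  refine ⟨IsLocalization.mk' _ a' (⟨s', hs0⟩ : (originIdeal (Δ.totalExp l)).primeCompl), ?_⟩
  rw [toFibre, IsLocalization.map_mk', IsLocalization.mk'_eq_iff_eq_mul, ha']
  simpa [hs'] using h.symm

/-- Expansion at the origin is compatible with restriction to the fibre over `0`. -/
theorem expand_toFibre (q : Δ.TotalRing l) :
    expand (fibreExp k l) (Δ.toFibre l q) = restrictSeries k l (expand (Δ.totalExp l) q) := by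
  have h : (expand (fibreExp k l)).comp (Δ.toFibre l) =
      (restrictSeries k l).comp (expand (Δ.totalExp l)) := by
    refine IsLocalization.ringHom_ext (originIdeal (Δ.totalExp l)).primeCompl ?_
    refine MvPolynomial.ringHom_ext (fun a => ?_) fun i => ?_
    · have hC : ∀ p : k⟦X⟧, restrictSeries k l (PowerSeries.toMvPowerSeries 0 p) =
          MvPowerSeries.C (PowerSeries.constantCoeff p) := by
        intro p
        have := congrArg (restrictSeries k l)
          (congrArg (PowerSeries.toMvPowerSeries (0 : Fin (l + 1))) p.eq_X_mul_shift_add_const)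
        rw [this, map_add, map_mul, map_add, map_mul, PowerSeries.toMvPowerSeries_X,
          restrictSeries_X_zero, zero_mul, zero_add, PowerSeries.toMvPowerSeries_C,
          restrictSeries_C]
      have h2 : PowerSeries.constantCoeff (Δ.taylor (algebraMap A Δ.LocalRing a)) = Δ.pt a := by
        rw [← evalZero_algebraMap, ← coeff_zero_taylorFun]
        simp [taylor]
      simp only [RingHom.comp_apply, toFibre_algebraMap, expand_algebraMap, totalExp_C, hC, h2]
      simp
    · simp only [RingHom.comp_apply, toFibre_algebraMap, expand_algebraMap, totalExp_z,
        restrictSeries_X_succ]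
      simp
  exact RingHom.congr_fun h q

theorem ker_toFibre {q : Δ.TotalRing l} (hq : Δ.toFibre l q = 0) :
    ∃ q', q = Δ.tTotal l * q' := by
  rw [← dvd_def, ← Ideal.mem_span_singleton]
  obtain ⟨a, s, hs, h⟩ := exists_algebraMap_eq_unit_mul q
  rw [← Ideal.unit_mul_mem_iff_mem _ hs, ← h]
  have h0 : map (Δ.pt : A →+* k) a = 0 := by
    refine IsLocalization.injective (FibreRing k l)
      (originIdeal (fibreExp k l)).primeCompl_le_nonZeroDivisors ?_
    rw [← toFibre_algebraMap, h, map_mul, hq, mul_zero, map_zero]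
  rw [a.as_sum, map_sum]
  refine Ideal.sum_mem _ fun d _ => ?_
  have hd : Δ.pt (coeff d a) = 0 := by
    have := congrArg (coeff d) h0
    rwa [coeff_map, coeff_zero] at this
  have e : (monomial d (coeff d a) : MvPolynomial (Fin l) A) = C (coeff d a) * monomial d 1 := by
    rw [C_mul_monomial, mul_one]
  rw [e, map_mul]
  exact Ideal.mul_mem_right _ _ (Δ.algebraMap_C_mem_span_t hd)

instance isNoetherianRing_fibreRing : IsNoetherianRing (FibreRing k l) :=
  IsLocalization.isNoetherianRing (originIdeal (fibreExp k l)).primeCompl _ inferInstance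

/-- The ring `A` itself need not be noetherian; but the local ring of `Δ × 𝔸ˡ` is also a
localization of the polynomial ring over `𝒪_{Δ,0}`. -/
instance isNoetherianRing_totalRing : IsNoetherianRing (Δ.TotalRing l) := by
  have := Δ.isDVR
  let M : Submonoid (MvPolynomial (Fin l) A) := (RingHom.ker Δ.pt).primeCompl.map C
  have hM : M ≤ (originIdeal (Δ.totalExp l)).primeCompl := by
    rintro _ ⟨s, hs, rfl⟩ h0
    refine hs ?_
    simpa [RingHom.mem_ker, constantCoeff_totalExp] using h0
  let : Algebra (MvPolynomial (Fin l) A) (MvPolynomial (Fin l) Δ.LocalRing) := algebraMvPolynomial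
  have : IsLocalization M (MvPolynomial (Fin l) Δ.LocalRing) :=
    MvPolynomial.isLocalization (RingHom.ker Δ.pt).primeCompl Δ.LocalRing
  let := IsLocalization.localizationAlgebraOfSubmonoidLe (MvPolynomial (Fin l) Δ.LocalRing)
    (Δ.TotalRing l) M _ hM
  have := IsLocalization.localization_isScalarTower_of_submonoid_le
    (MvPolynomial (Fin l) Δ.LocalRing) (Δ.TotalRing l) M _ hM
  have := IsLocalization.isLocalization_of_submonoid_le (MvPolynomial (Fin l) Δ.LocalRing)
    (Δ.TotalRing l) M _ hM
  exact IsLocalization.isNoetherianRing ((originIdeal (Δ.totalExp l)).primeCompl.map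
    (algebraMap _ (MvPolynomial (Fin l) Δ.LocalRing))) (Δ.TotalRing l) inferInstance

variable (I : Ideal (MvPolynomial (Fin l) A))

/-- The ideal of the germ of `𝒳` at the origin of `Δ × 𝔸ˡ`. -/
abbrev totalGermIdeal : Ideal (Δ.TotalRing l) := I.map (algebraMap _ (Δ.TotalRing l))

/-- The ideal of the germ of the central fibre at the origin of `𝔸ˡ`. -/
abbrev fibreGermIdeal : Ideal (FibreRing k l) := (Δ.fibreIdeal I).map (algebraMap _ (FibreRing k l))

theorem map_toFibre_totalGermIdeal :
    (Δ.totalGermIdeal I).map (Δ.toFibre l) = Δ.fibreGermIdeal I := by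
  rw [totalGermIdeal, fibreGermIdeal, fibreIdeal, Ideal.map_map, Ideal.map_map]
  congr 1
  exact RingHom.ext Δ.toFibre_algebraMap

theorem toFibre_mem {q : Δ.TotalRing l} (hq : q ∈ Δ.totalGermIdeal I) :
    Δ.toFibre l q ∈ Δ.fibreGermIdeal I :=
  Δ.map_toFibre_totalGermIdeal I ▸ Ideal.mem_map_of_mem _ hq

/-- Flatness over `Δ`: the local equations of `𝒳` may be divided by `t`. -/
theorem mem_of_tTotal_mul_mem (hflat : Module.Flat A (MvPolynomial (Fin l) A ⧸ I))
    {q : Δ.TotalRing l} (hq : Δ.tTotal l * q ∈ Δ.totalGermIdeal I) : q ∈ Δ.totalGermIdeal I := by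
  obtain ⟨a, s, hs, h⟩ := exists_algebraMap_eq_unit_mul q
  rw [← Ideal.unit_mul_mem_iff_mem _ hs, ← h]
  have h1 : algebraMap _ (Δ.TotalRing l) (C Δ.t * a) ∈ Δ.totalGermIdeal I := by
    rw [map_mul, h, mul_left_comm]
    exact Ideal.mul_mem_left _ _ hq
  rw [IsLocalization.algebraMap_mem_map_algebraMap_iff (originIdeal (Δ.totalExp l)).primeCompl]
    at h1 ⊢
  obtain ⟨u, hu, hua⟩ := h1
  refine ⟨u, hu, ?_⟩
  have ht : Δ.t ≠ 0 := fun h0 => Δ.tLoc_ne_zero (by rw [tLoc, h0, map_zero])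
  have hreg := Module.Flat.isSMulRegular_of_nonZeroDivisors (M := MvPolynomial (Fin l) A ⧸ I)
    (mem_nonZeroDivisors_of_ne_zero ht)
  rw [← Ideal.Quotient.eq_zero_iff_mem] at hua ⊢
  refine hreg ?_
  change Δ.t • _ = Δ.t • (0 : MvPolynomial (Fin l) A ⧸ I)
  rw [smul_zero, ← hua]
  change Ideal.Quotient.mk I (Δ.t • (u * a)) = _
  rw [smul_eq_C_mul]
  congr 1
  ring

/-- The equations of `𝒳` vanish along the zero section. -/
theorem coeff_expand_eq_zero_of_section
    (hsection : I ≤ Ideal.span (Set.range (X : Fin l → MvPolynomial (Fin l) A)))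
    {F : Δ.TotalRing l} (hF : F ∈ Δ.totalGermIdeal I) {d : Fin (l + 1) →₀ ℕ}
    (hd : ∀ i : Fin l, d i.succ = 0) : MvPowerSeries.coeff d (expand (Δ.totalExp l) F) = 0 := by
  have h : F ∈ Ideal.span (Set.range fun i : Fin l =>
      algebraMap (MvPolynomial (Fin l) A) (Δ.TotalRing l) (X i)) := by
    have := Ideal.map_mono hsection hF
    rwa [Ideal.map_span, ← Set.range_comp'] at this
  obtain ⟨c, rfl⟩ := Ideal.mem_span_range_iff_exists_fun.mp h
  rw [map_sum, map_sum]
  refine Finset.sum_eq_zero fun i _ => ?_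
  refine MvPowerSeries.X_dvd_iff.mp (Dvd.intro_left (expand _ (c i)) ?_) d (hd i)
  rw [map_mul, expand_algebraMap, totalExp_z]

end PointedCurve

/-! ### Polynomials in `t` and `z₁, …, z_l` -/

section SuccPolynomials

open MvPolynomial

variable {k : Type*} [Field k] {l : ℕ}

/-- The coefficient of `tʲ` (the variable with index `0`) of a polynomial in `t, z₁, …, z_l`. -/
def tCoeff (j : ℕ) : MvPolynomial (Fin (l + 1)) k →ₗ[k] MvPolynomial (Fin l) k where
  toFun p := (finSuccEquiv k l p).coeff j
  map_add' p q := by simp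
  map_smul' c p := by simp

theorem tCoeff_apply (j : ℕ) (p : MvPolynomial (Fin (l + 1)) k) :
    tCoeff j p = (finSuccEquiv k l p).coeff j := rfl

theorem coeff_tCoeff (j : ℕ) (p : MvPolynomial (Fin (l + 1)) k) (d : Fin l →₀ ℕ) :
    coeff d (tCoeff j p) = coeff (d.cons j) p :=
  finSuccEquiv_coeff_coeff d p j

theorem tCoeff_zero_X_mul (p : MvPolynomial (Fin (l + 1)) k) : tCoeff 0 (X 0 * p) = 0 := by
  rw [tCoeff_apply, map_mul, finSuccEquiv_X_zero, Polynomial.coeff_X_mul_zero]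

theorem tCoeff_succ_X_mul (j : ℕ) (p : MvPolynomial (Fin (l + 1)) k) :
    tCoeff (j + 1) (X 0 * p) = tCoeff j p := by
  rw [tCoeff_apply, map_mul, finSuccEquiv_X_zero, Polynomial.coeff_X_mul, tCoeff_apply]

theorem exists_eq_X_mul {p : MvPolynomial (Fin (l + 1)) k} (hp : tCoeff 0 p = 0) :
    ∃ g, p = X 0 * g := by
  obtain ⟨g, hg⟩ := Polynomial.X_dvd_iff.mpr hp
  change finSuccEquiv k l p = _ at hg
  refine ⟨(finSuccEquiv k l).symm g, (finSuccEquiv k l).injective ?_⟩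
  rw [hg, map_mul, finSuccEquiv_X_zero, AlgEquiv.apply_symm_apply]

theorem finSuccEquiv_rename_succ (q : MvPolynomial (Fin l) k) :
    finSuccEquiv k l (rename Fin.succ q) = Polynomial.C q := by
  have : (finSuccEquiv k l).toAlgHom.comp (rename Fin.succ) =
      (Polynomial.CAlgHom (R := MvPolynomial (Fin l) k)).restrictScalars k := by
    refine MvPolynomial.algHom_ext fun i => ?_
    simp [finSuccEquiv_X_succ]
  exact DFunLike.congr_fun this q

theorem tCoeff_zero_rename (q : MvPolynomial (Fin l) k) : tCoeff 0 (rename Fin.succ q) = q := by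
  rw [tCoeff_apply, finSuccEquiv_rename_succ, Polynomial.coeff_C_zero]

theorem tCoeff_succ_rename (j : ℕ) (q : MvPolynomial (Fin l) k) :
    tCoeff (j + 1) (rename Fin.succ q) = 0 := by
  rw [tCoeff_apply, finSuccEquiv_rename_succ, Polynomial.coeff_C_succ]

theorem sum_X_pow_mul_rename_tCoeff (p : MvPolynomial (Fin (l + 1)) k) :
    ∑ j ∈ (finSuccEquiv k l p).support, X 0 ^ j * rename Fin.succ (tCoeff j p) = p := by
  refine (finSuccEquiv k l).injective ?_
  rw [map_sum]
  conv_rhs => rw [(finSuccEquiv k l p).as_sum_support_C_mul_X_pow]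
  refine Finset.sum_congr rfl fun j _ => ?_
  rw [map_mul, map_pow, finSuccEquiv_X_zero, finSuccEquiv_rename_succ, mul_comm, tCoeff_apply]

theorem coe_tCoeff_zero (p : MvPolynomial (Fin (l + 1)) k) :
    ((tCoeff 0 p : MvPolynomial (Fin l) k) : MvPowerSeries (Fin l) k) =
      restrictSeries k l (p : MvPowerSeries (Fin (l + 1)) k) := by
  ext d
  rw [coeff_coe, coeff_tCoeff, coeff_restrictSeries, coeff_coe]

variable (w₀ : ℝ≥0) (w : Fin l → ℝ≥0)

theorem weight_cons (j : ℕ) (d : Fin l →₀ ℕ) :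
    Finsupp.weight (PointedCurve.allWeights w₀ w) (d.cons j) = j * w₀ + Finsupp.weight w d := by
  rw [Finsupp.weight_apply, Finsupp.weight_apply, Finsupp.sum_fintype _ _ (by simp),
    Finsupp.sum_fintype _ _ (by simp), Fin.sum_univ_succ]
  simp

variable {w₀ w}

theorem allWeights_pos (hw₀ : 0 < w₀) (hw : ∀ i, 0 < w i) (i : Fin (l + 1)) :
    0 < PointedCurve.allWeights w₀ w i := by
  refine Fin.cases ?_ (fun i => ?_) i
  · exact hw₀
  · exact hw i

theorem tCoeff_weightedHomogeneousComponent (j : ℕ) (n : ℝ≥0) (p : MvPolynomial (Fin (l + 1)) k) :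
    tCoeff j (weightedHomogeneousComponent (PointedCurve.allWeights w₀ w) (j * w₀ + n) p) =
      weightedHomogeneousComponent w n (tCoeff j p) := by
  classical
  ext d
  rw [coeff_tCoeff, coeff_weightedHomogeneousComponent, coeff_weightedHomogeneousComponent,
    weight_cons, coeff_tCoeff]
  simp only [add_right_inj]

theorem tCoeff_weightedHomogeneousComponent_of_lt {j : ℕ} {m : ℝ≥0} (h : m < j * w₀)
    (p : MvPolynomial (Fin (l + 1)) k) :
    tCoeff j (weightedHomogeneousComponent (PointedCurve.allWeights w₀ w) m p) = 0 := by
  classical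
  ext d
  rw [coeff_tCoeff, coeff_weightedHomogeneousComponent, weight_cons, coeff_zero, if_neg]
  intro h'
  exact absurd (le_self_add.trans h'.le) (not_le.mpr h)

theorem tCoeff_zero_weightedHomogeneousComponent (m : ℝ≥0) (p : MvPolynomial (Fin (l + 1)) k) :
    tCoeff 0 (weightedHomogeneousComponent (PointedCurve.allWeights w₀ w) m p) =
      weightedHomogeneousComponent w m (tCoeff 0 p) := by
  simpa using tCoeff_weightedHomogeneousComponent (w₀ := w₀) (w := w) 0 m p

theorem isWeightedHomogeneous_rename_succ {q : MvPolynomial (Fin l) k} {m : ℝ≥0}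
    (hq : IsWeightedHomogeneous w q m) :
    IsWeightedHomogeneous (PointedCurve.allWeights w₀ w) (rename Fin.succ q) m := by
  intro d hd
  rw [← d.cons_tail] at hd ⊢
  rw [← coeff_tCoeff] at hd
  rcases Nat.eq_zero_or_pos (d 0) with h | h
  · rw [h, tCoeff_zero_rename] at hd
    rw [weight_cons, h, hq hd]
    simp
  · rw [← Nat.succ_pred_eq_of_pos h, Nat.succ_eq_add_one, tCoeff_succ_rename] at hd
    simp at hd

theorem weight_le_weight_restrictSeries (f : MvPowerSeries (Fin (l + 1)) k) :
    weight (PointedCurve.allWeights w₀ w) f ≤ weight w (restrictSeries k l f) := by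
  rw [le_weight_iff]
  intro d hd
  have := le_weight_iff.mp (le_refl (weight (PointedCurve.allWeights w₀ w) f)) (d.cons 0) hd
  simpa [weight_cons] using this

theorem lt_weight_of_X_mul (hw₀ : 0 < w₀) (hw : ∀ i, 0 < w i) {f : MvPowerSeries (Fin (l + 1)) k}
    {m : ℝ≥0} (h : ((w₀ + m : ℝ≥0) : ℝ≥0∞) <
      weight (PointedCurve.allWeights w₀ w) (MvPowerSeries.X 0 * f)) :
    (m : ℝ≥0∞) < weight (PointedCurve.allWeights w₀ w) f := by
  rw [coe_lt_weight_iff (allWeights_pos hw₀ hw)] at h ⊢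
  intro d hd
  have := h (Finsupp.single 0 1 + d) (by
    rw [MvPowerSeries.X_def, MvPowerSeries.coeff_add_monomial_mul, one_mul]
    exact hd)
  rw [map_add, Finsupp.weight_single] at this
  simpa using this

end SuccPolynomials

/-! ### The presentations of the graded rings -/

namespace PointedCurve

open MvPolynomial

variable {k A : Type*} [Field k] [CommRing A] [IsDomain A] [Algebra k A] (Δ : PointedCurve k A)
variable {l : ℕ} (I : Ideal (MvPolynomial (Fin l) A)) (w₀ : ℝ≥0) (w : Fin l → ℝ≥0)

/-- The presentation of `gr_{w₀,…,w_l}(𝒪_{𝒳,x})` by the classes of `t, z₁, …, z_l`. -/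
def totalGrHom : MvPolynomial (Fin (l + 1)) k →ₐ[k] Δ.TotalGr I w₀ w :=
  (Δ.isCoordinateExpansion_totalExp l).grHom I (allWeights w₀ w)

/-- The presentation of `gr_{w₁,…,w_l}(𝒪_{X,x})` by the classes of `z₁, …, z_l`. -/
def fibreGrHom : MvPolynomial (Fin l) k →ₐ[k] Δ.FibreGr I w :=
  (isCoordinateExpansion_fibreExp k l).grHom (Δ.fibreIdeal I) w

theorem totalGrHom_X_zero : Δ.totalGrHom I w₀ w (X 0) = Δ.tBar I w₀ w :=
  (Δ.isCoordinateExpansion_totalExp l).grHom_X I (allWeights w₀ w) 0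

theorem totalGrHom_X_succ (i : Fin l) : Δ.totalGrHom I w₀ w (X i.succ) = Δ.zBar I w₀ w i :=
  (Δ.isCoordinateExpansion_totalExp l).grHom_X I (allWeights w₀ w) i.succ

theorem fibreGrHom_X (i : Fin l) : Δ.fibreGrHom I w (X i) = Δ.zBarFibre I w i :=
  (isCoordinateExpansion_fibreExp k l).grHom_X (Δ.fibreIdeal I) w i

variable {w₀ w}

theorem totalGrHom_surjective (hw₀ : 0 < w₀) (hw : ∀ i, 0 < w i) :
    Function.Surjective (Δ.totalGrHom I w₀ w) :=
  (Δ.isCoordinateExpansion_totalExp l).grHom_surjective I _ (allWeights_pos hw₀ hw)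

theorem fibreGrHom_surjective (hw : ∀ i, 0 < w i) : Function.Surjective (Δ.fibreGrHom I w) :=
  (isCoordinateExpansion_fibreExp k l).grHom_surjective _ _ hw

theorem totalGrHom_eq_zero_iff {p : MvPolynomial (Fin (l + 1)) k} {m : ℝ≥0}
    (hp : IsWeightedHomogeneous (allWeights w₀ w) p m) : Δ.totalGrHom I w₀ w p = 0 ↔
      ∃ F ∈ Δ.totalGermIdeal I, (m : ℝ≥0∞) < weight (allWeights w₀ w)
        (expand (Δ.totalExp l) F - (p : MvPowerSeries (Fin (l + 1)) k)) :=
  (Δ.isCoordinateExpansion_totalExp l).grHom_eq_zero_iff_of_isWeightedHomogeneous I _ hp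

theorem fibreGrHom_eq_zero_iff {p : MvPolynomial (Fin l) k} {m : ℝ≥0}
    (hp : IsWeightedHomogeneous w p m) : Δ.fibreGrHom I w p = 0 ↔
      ∃ F ∈ Δ.fibreGermIdeal I, (m : ℝ≥0∞) < weight w
        (expand (fibreExp k l) F - (p : MvPowerSeries (Fin l) k)) :=
  (isCoordinateExpansion_fibreExp k l).grHom_eq_zero_iff_of_isWeightedHomogeneous _ _ hp

theorem totalGrHom_component {p : MvPolynomial (Fin (l + 1)) k} (hp : Δ.totalGrHom I w₀ w p = 0)
    (m : ℝ≥0) : Δ.totalGrHom I w₀ w (weightedHomogeneousComponent (allWeights w₀ w) m p) = 0 :=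
  (Δ.isCoordinateExpansion_totalExp l).grHom_weightedHomogeneousComponent I _ hp m

theorem fibreGrHom_component {p : MvPolynomial (Fin l) k} (hp : Δ.fibreGrHom I w p = 0)
    (m : ℝ≥0) : Δ.fibreGrHom I w (weightedHomogeneousComponent w m p) = 0 :=
  (isCoordinateExpansion_fibreExp k l).grHom_weightedHomogeneousComponent _ _ hp m

theorem totalGrHom_eq_zero_of_components {p : MvPolynomial (Fin (l + 1)) k}
    (hp : ∀ m, Δ.totalGrHom I w₀ w (weightedHomogeneousComponent (allWeights w₀ w) m p) = 0) :
    Δ.totalGrHom I w₀ w p = 0 :=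
  (Δ.isCoordinateExpansion_totalExp l).grHom_eq_zero_of_components I _ hp

theorem fibreGrHom_eq_zero_of_components {p : MvPolynomial (Fin l) k}
    (hp : ∀ m, Δ.fibreGrHom I w (weightedHomogeneousComponent w m p) = 0) :
    Δ.fibreGrHom I w p = 0 :=
  (isCoordinateExpansion_fibreExp k l).grHom_eq_zero_of_components _ _ hp

/-- Initial forms of equations of `𝒳` restrict to initial forms of equations of `X`. -/
theorem fibreGrHom_tCoeff_zero {p : MvPolynomial (Fin (l + 1)) k} (hp : Δ.totalGrHom I w₀ w p = 0) :
    Δ.fibreGrHom I w (tCoeff 0 p) = 0 := by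
  refine Δ.fibreGrHom_eq_zero_of_components I fun m => ?_
  rw [← tCoeff_zero_weightedHomogeneousComponent (w₀ := w₀)]
  have hm := weightedHomogeneousComponent_isWeightedHomogeneous (w := allWeights w₀ w) m p
  obtain ⟨F, hF, hlt⟩ := (Δ.totalGrHom_eq_zero_iff I hm).mp (Δ.totalGrHom_component I hp m)
  have hm' := weightedHomogeneousComponent_isWeightedHomogeneous (w := w) m (tCoeff 0 p)
  rw [← tCoeff_zero_weightedHomogeneousComponent (w₀ := w₀)] at hm'
  refine (Δ.fibreGrHom_eq_zero_iff I hm').mpr ⟨_, Δ.toFibre_mem I hF, ?_⟩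
  rw [expand_toFibre, coe_tCoeff_zero, ← map_sub]
  exact hlt.trans_le (weight_le_weight_restrictSeries _)

/-! ### Lifting equations of the central fibre -/

/-- Every equation of the central fibre lifts to an equation of `𝒳` whose weight is as large. -/
def HasLifts (w₀ : ℝ≥0) (w : Fin l → ℝ≥0) : Prop :=
  ∀ m : ℝ≥0, ∀ f ∈ Δ.fibreGermIdeal I, (m : ℝ≥0∞) ≤ weight w (expand (fibreExp k l) f) →
    ∃ F ∈ Δ.totalGermIdeal I, Δ.toFibre l F = f ∧
      (m : ℝ≥0∞) ≤ weight (allWeights w₀ w) (expand (Δ.totalExp l) F)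

theorem coordIdeal_le_map : (isCoordinateExpansion_fibreExp k l).coordIdeal ≤
    (Δ.isCoordinateExpansion_totalExp l).coordIdeal.map (Δ.toFibre l) := by
  refine Ideal.span_le.mpr ?_
  rintro _ ⟨i, rfl⟩
  have : Δ.toFibre l (algebraMap _ (Δ.TotalRing l) (Δ.totalCoord l i.succ)) ∈
      (Δ.isCoordinateExpansion_totalExp l).coordIdeal.map (Δ.toFibre l) :=
    Ideal.mem_map_of_mem _ ((Δ.isCoordinateExpansion_totalExp l).coord_mem_coordIdeal i.succ)
  rw [toFibre_algebraMap] at this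
  simpa [totalCoord] using this

/-- Equations of the central fibre of large weight lift to equations of `𝒳` of large weight, by the
Artin–Rees lemma. -/
theorem exists_lift_of_large_weight (hw₀ : 0 < w₀) (hw : ∀ i, 0 < w i) (m : ℝ≥0) :
    ∃ C : ℝ≥0, ∀ f ∈ Δ.fibreGermIdeal I, (C : ℝ≥0∞) ≤ weight w (expand (fibreExp k l) f) →
      ∃ F ∈ Δ.totalGermIdeal I, Δ.toFibre l F = f ∧
        (m : ℝ≥0∞) ≤ weight (allWeights w₀ w) (expand (Δ.totalExp l) F) := by
  have H := Δ.isCoordinateExpansion_totalExp l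
  have H₀ := isCoordinateExpansion_fibreExp k l
  obtain ⟨a, ha, haw⟩ : ∃ a : ℝ≥0, 0 < a ∧ ∀ i, a ≤ allWeights w₀ w i := by
    obtain ⟨i, hi⟩ := Finite.exists_min (allWeights w₀ w)
    exact ⟨_, allWeights_pos hw₀ hw i, hi⟩
  obtain ⟨N, hN⟩ := exists_nat_ge (m / a)
  rw [div_le_iff₀ ha] at hN
  obtain ⟨C, hC⟩ := H₀.exists_forall_mem_coordIdeal_pow_mul w (Δ.fibreGermIdeal I) N
  refine ⟨C, fun f hf hfw => ?_⟩
  have h5 : f ∈ (H.coordIdeal ^ N * Δ.totalGermIdeal I).map (Δ.toFibre l) := by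
    rw [Ideal.map_mul, Ideal.map_pow, map_toFibre_totalGermIdeal]
    exact Ideal.mul_mono_left (Ideal.pow_right_mono Δ.coordIdeal_le_map N) (hC f hf hfw)
  obtain ⟨F, hF, rfl⟩ := (Ideal.mem_map_iff_of_surjective _ Δ.toFibre_surjective).mp h5
  obtain ⟨hFJ, hFw⟩ := H.mem_and_le_weight_of_mem (allWeights w₀ w) haw hF
  exact ⟨F, hFJ, rfl, (ENNReal.coe_le_coe.mpr hN).trans hFw⟩

/-- It suffices to lift the initial forms of the equations of the central fibre. -/
theorem hasLifts_of_initial (hw₀ : 0 < w₀) (hw : ∀ i, 0 < w i)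
    (h : ∀ q m, IsWeightedHomogeneous w q m → Δ.fibreGrHom I w q = 0 →
      ∃ G ∈ Δ.totalGermIdeal I, (m : ℝ≥0∞) ≤ weight (allWeights w₀ w) (expand (Δ.totalExp l) G) ∧
        (m : ℝ≥0∞) < weight w (expand (fibreExp k l) (Δ.toFibre l G) -
          (q : MvPowerSeries (Fin l) k))) : Δ.HasLifts I w₀ w := by
  intro m f hf
  obtain ⟨C, hC⟩ := Δ.exists_lift_of_large_weight I hw₀ hw m
  refine weight_induction hw (fun f : Δ.fibreGermIdeal I => expand (fibreExp k l) f.1)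
    (P := fun f => (m : ℝ≥0∞) ≤ weight w (expand (fibreExp k l) f.1) →
      ∃ F ∈ Δ.totalGermIdeal I, Δ.toFibre l F = f.1 ∧
        (m : ℝ≥0∞) ≤ weight (allWeights w₀ w) (expand (Δ.totalExp l) F)) C
    (fun f hf _ => hC f.1 f.2 hf) ?_ ⟨f, hf⟩
  rintro ⟨f, hf⟩ n hn ih hm
  dsimp only at hn ih hm ⊢
  have hq := isWeightedHomogeneous_homogPart hw n (expand (fibreExp k l) f)
  have hlt := lt_weight_sub_homogPart hw hn.ge
  obtain ⟨G, hG, hGw, hGq⟩ := h _ n hq ((Δ.fibreGrHom_eq_zero_iff I hq).mpr ⟨f, hf, hlt⟩)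
  have hmem : f - Δ.toFibre l G ∈ Δ.fibreGermIdeal I := sub_mem hf (Δ.toFibre_mem I hG)
  have hlt' : (n : ℝ≥0∞) < weight w (expand (fibreExp k l) (f - Δ.toFibre l G)) := by
    rw [map_sub, ← sub_sub_sub_cancel_right _ _
      (homogPart hw n (expand (fibreExp k l) f) : MvPowerSeries (Fin l) k)]
    exact (lt_min hlt hGq).trans_le (min_weight_le_weight_sub _ _)
  rw [hn] at hm
  obtain ⟨F, hF, hFf, hFw⟩ := ih ⟨_, hmem⟩ hlt' (hm.trans hlt'.le)
  refine ⟨F + G, add_mem hF hG, by rw [map_add, hFf, sub_add_cancel], ?_⟩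
  rw [map_add]
  exact (le_min hFw (hm.trans hGw)).trans (min_weight_le_weight_add _ _ _)

variable {I}

/-- Liftability makes `t̄` a nonzerodivisor: if `t p` is the initial form of `F`, then `F|_{t=0}`
has larger weight than `t p`, and subtracting a lift of it from `F` leaves a germ that may be
divided by `t`. -/
theorem HasLifts.totalGrHom_of_X_mul (hL : Δ.HasLifts I w₀ w)
    (hflat : Module.Flat A (MvPolynomial (Fin l) A ⧸ I)) (hw₀ : 0 < w₀) (hw : ∀ i, 0 < w i)
    {p : MvPolynomial (Fin (l + 1)) k} (hp : Δ.totalGrHom I w₀ w (X 0 * p) = 0) :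
    Δ.totalGrHom I w₀ w p = 0 := by
  refine Δ.totalGrHom_eq_zero_of_components I fun m => ?_
  have hm := weightedHomogeneousComponent_isWeightedHomogeneous (w := allWeights w₀ w) m p
  have hX : IsWeightedHomogeneous (allWeights w₀ w) (X 0 : MvPolynomial (Fin (l + 1)) k) w₀ :=
    isWeightedHomogeneous_X k (allWeights w₀ w) 0
  have h0 := Δ.totalGrHom_component I hp (w₀ + m)
  rw [weightedHomogeneousComponent_add_mul hX] at h0
  set q := weightedHomogeneousComponent (allWeights w₀ w) m p
  obtain ⟨F, hF, hlt⟩ := (Δ.totalGrHom_eq_zero_iff I (hX.mul hm)).mp h0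
  have hfib : ((w₀ + m : ℝ≥0) : ℝ≥0∞) < weight w (expand (fibreExp k l) (Δ.toFibre l F)) := by
    refine hlt.trans_le ((weight_le_weight_restrictSeries _).trans_eq ?_)
    rw [map_sub, ← coe_tCoeff_zero, tCoeff_zero_X_mul, expand_toFibre]
    simp
  obtain ⟨m', hm1, hm2⟩ := ENNReal.lt_iff_exists_nnreal_btwn.mp hfib
  obtain ⟨F', hF', hFF', hF'w⟩ := hL m' _ (Δ.toFibre_mem I hF) hm2.le
  obtain ⟨G, hG⟩ := Δ.ker_toFibre (q := F - F') (by rw [map_sub, hFF', sub_self])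
  refine (Δ.totalGrHom_eq_zero_iff I hm).mpr
    ⟨G, Δ.mem_of_tTotal_mul_mem I hflat (hG ▸ sub_mem hF hF'), lt_weight_of_X_mul hw₀ hw ?_⟩
  have e : MvPowerSeries.X 0 * (expand (Δ.totalExp l) G - (q : MvPowerSeries (Fin (l + 1)) k)) =
      (expand (Δ.totalExp l) F - ((X 0 * q : MvPolynomial (Fin (l + 1)) k) :
        MvPowerSeries (Fin (l + 1)) k)) - expand (Δ.totalExp l) F' := by
    have ht : expand (Δ.totalExp l) (Δ.tTotal l) = MvPowerSeries.X 0 := by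
      rw [tTotal, expand_algebraMap, totalExp_t]
    have := congrArg (expand (Δ.totalExp l)) hG
    rw [map_sub, map_mul, ht] at this
    rw [mul_sub, ← this, MvPolynomial.coe_mul, MvPolynomial.coe_X]
    ring
  rw [e]
  exact (lt_min hlt (hm1.trans_le hF'w)).trans_le (min_weight_le_weight_sub _ _)

/-- Liftability makes the restriction of initial ideals to `t = 0` surjective. -/
theorem HasLifts.exists_tCoeff_zero_eq (hL : Δ.HasLifts I w₀ w) (hw₀ : 0 < w₀) (hw : ∀ i, 0 < w i)
    {q : MvPolynomial (Fin l) k} {m : ℝ≥0} (hqm : IsWeightedHomogeneous w q m)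
    (hq : Δ.fibreGrHom I w q = 0) : ∃ p, IsWeightedHomogeneous (allWeights w₀ w) p m ∧
      Δ.totalGrHom I w₀ w p = 0 ∧ tCoeff 0 p = q := by
  obtain ⟨f, hf, hlt⟩ := (Δ.fibreGrHom_eq_zero_iff I hqm).mp hq
  have hfw : (m : ℝ≥0∞) ≤ weight w (expand (fibreExp k l) f) := by
    have := (le_min hlt.le (le_weight_coe_of_isWeightedHomogeneous hqm)).trans
      (min_weight_le_weight_add _ _ _)
    rwa [sub_add_cancel] at this
  obtain ⟨F, hF, rfl, hFw⟩ := hL m f hf hfw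
  have hpos := allWeights_pos hw₀ hw
  have hp := isWeightedHomogeneous_homogPart hpos m (expand (Δ.totalExp l) F)
  refine ⟨_, hp, (Δ.totalGrHom_eq_zero_iff I hp).mpr ⟨F, hF, lt_weight_sub_homogPart hpos hFw⟩, ?_⟩
  ext d
  rw [coeff_tCoeff, coeff_homogPart, weight_cons, Nat.cast_zero, zero_mul, zero_add,
    ← coeff_restrictSeries, ← expand_toFibre]
  split_ifs with hd
  · by_contra hne
    have := (coe_lt_weight_iff hw).mp hlt d (by
      rw [map_sub, coeff_coe]
      exact sub_ne_zero.mpr hne)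
    exact absurd hd this.ne'
  · by_contra hne
    exact hd (hqm (Ne.symm hne))

end PointedCurve

namespace PointedCurve

open MvPolynomial

variable {k A : Type*} [Field k] [CommRing A] [IsDomain A] [Algebra k A] (Δ : PointedCurve k A)
variable {l : ℕ} (I : Ideal (MvPolynomial (Fin l) A)) (w₀ : ℝ≥0) (w : Fin l → ℝ≥0)

/-! ### Canonical triviality and the central fibre -/

/-- The presentation of the coordinate ring of `𝔸¹_t × W` by `t` and the classes of `z₁, …, z_l`. -/
def productHom : MvPolynomial (Fin (l + 1)) k →ₐ[k] (Δ.FibreGr I w)[X] :=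
  (Polynomial.mapAlgHom (Δ.fibreGrHom I w)).comp (finSuccEquiv k l).toAlgHom

theorem coeff_productHom (p : MvPolynomial (Fin (l + 1)) k) (j : ℕ) :
    (Δ.productHom I w p).coeff j = Δ.fibreGrHom I w (tCoeff j p) := by
  simp [productHom, tCoeff_apply]

theorem productHom_eq_zero_iff {p : MvPolynomial (Fin (l + 1)) k} :
    Δ.productHom I w p = 0 ↔ ∀ j, Δ.fibreGrHom I w (tCoeff j p) = 0 := by
  simp only [Polynomial.ext_iff, coeff_productHom, Polynomial.coeff_zero]

theorem productHom_X_zero : Δ.productHom I w (X 0) = Polynomial.X := by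
  simp [productHom, finSuccEquiv_X_zero]

theorem productHom_X_succ (i : Fin l) :
    Δ.productHom I w (X i.succ) = Polynomial.C (Δ.zBarFibre I w i) := by
  simp [productHom, finSuccEquiv_X_succ, fibreGrHom_X]

variable {w₀ w}

theorem productHom_surjective (hw : ∀ i, 0 < w i) : Function.Surjective (Δ.productHom I w) := by
  intro y
  obtain ⟨q, hq⟩ := Polynomial.map_surjective (Δ.fibreGrHom I w : MvPolynomial (Fin l) k →+* _)
    (Δ.fibreGrHom_surjective I hw) y
  refine ⟨(finSuccEquiv k l).symm q, ?_⟩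
  simpa [productHom] using hq

/-- Two quotients of a `k`-algebra with the same kernel are isomorphic. -/
theorem exists_algEquiv_of_ker_eq {S B C : Type*} [CommRing S] [CommRing B] [CommRing C]
    [Algebra k S] [Algebra k B] [Algebra k C] {f : S →ₐ[k] B} {g : S →ₐ[k] C}
    (hf : Function.Surjective f) (hg : Function.Surjective g) (h : ∀ s, f s = 0 ↔ g s = 0) :
    ∃ e : B ≃ₐ[k] C, ∀ s, e (f s) = g s := by
  have hker : RingHom.ker f = RingHom.ker g := Ideal.ext h
  refine ⟨(Ideal.quotientKerAlgEquivOfSurjective hf).symm.trans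
    ((Ideal.quotientEquivAlgOfEq k hker).trans (Ideal.quotientKerAlgEquivOfSurjective hg)),
    fun s => ?_⟩
  have : (Ideal.quotientKerAlgEquivOfSurjective hf).symm (f s) = Ideal.Quotient.mk _ s := by
    rw [AlgEquiv.symm_apply_eq]
    rfl
  rw [AlgEquiv.trans_apply, this]
  rfl

theorem isCanonicallyTrivial_iff (hw₀ : 0 < w₀) (hw : ∀ i, 0 < w i) :
    Δ.IsCanonicallyTrivial I w₀ w ↔
      ∀ p, Δ.totalGrHom I w₀ w p = 0 ↔ Δ.productHom I w p = 0 := by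
  constructor
  · rintro ⟨e, he0, hei⟩ p
    have : e.toAlgHom.comp (Δ.totalGrHom I w₀ w) = Δ.productHom I w := by
      refine MvPolynomial.algHom_ext fun i => ?_
      refine Fin.cases ?_ (fun i => ?_) i
      · simpa [totalGrHom_X_zero, productHom_X_zero] using he0
      · simpa [totalGrHom_X_succ, productHom_X_succ] using hei i
    rw [← this]
    simp
  · intro h
    obtain ⟨e, he⟩ := exists_algEquiv_of_ker_eq (Δ.totalGrHom_surjective I hw₀ hw)
      (Δ.productHom_surjective I hw) h
    refine ⟨e, ?_, fun i => ?_⟩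
    · rw [← totalGrHom_X_zero, he, productHom_X_zero]
    · rw [← totalGrHom_X_succ, he, productHom_X_succ]

theorem productHom_rename {q : MvPolynomial (Fin l) k} (hq : Δ.fibreGrHom I w q = 0) :
    Δ.productHom I w (rename Fin.succ q) = 0 := by
  rw [productHom_eq_zero_iff]
  rintro (_ | j)
  · rw [tCoeff_zero_rename, hq]
  · rw [tCoeff_succ_rename, map_zero]

theorem totalGrHom_of_productHom
    (h : ∀ q, Δ.fibreGrHom I w q = 0 → Δ.totalGrHom I w₀ w (rename Fin.succ q) = 0)
    {p : MvPolynomial (Fin (l + 1)) k} (hp : Δ.productHom I w p = 0) :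
    Δ.totalGrHom I w₀ w p = 0 := by
  rw [productHom_eq_zero_iff] at hp
  rw [← sum_X_pow_mul_rename_tCoeff p, map_sum]
  refine Finset.sum_eq_zero fun j _ => ?_
  rw [map_mul, h _ (hp j), mul_zero]

variable {I}

/-- An initial form of an equation of `𝒳` that is divisible by `tʲ` has a coefficient of `tʲ` that
is an initial form of an equation of the central fibre. -/
theorem HasLifts.fibreGrHom_tCoeff (hL : Δ.HasLifts I w₀ w)
    (hflat : Module.Flat A (MvPolynomial (Fin l) A ⧸ I)) (hw₀ : 0 < w₀) (hw : ∀ i, 0 < w i) (j : ℕ)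
    {p : MvPolynomial (Fin (l + 1)) k} (hp : Δ.totalGrHom I w₀ w p = 0)
    (hj : ∀ i < j, tCoeff i p = 0) : Δ.fibreGrHom I w (tCoeff j p) = 0 := by
  induction j generalizing p with
  | zero => exact Δ.fibreGrHom_tCoeff_zero I hp
  | succ j ih =>
    obtain ⟨g, rfl⟩ := exists_eq_X_mul (hj 0 j.succ_pos)
    rw [tCoeff_succ_X_mul]
    refine ih (hL.totalGrHom_of_X_mul Δ hflat hw₀ hw hp) fun i hi => ?_
    rw [← tCoeff_succ_X_mul]
    exact hj (i + 1) (Nat.succ_lt_succ hi)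

/-- If moreover the initial ideal of the central fibre consists of initial forms of equations of
`𝒳`, the degeneration is a product. -/
theorem HasLifts.isCanonicallyTrivial (hL : Δ.HasLifts I w₀ w)
    (hflat : Module.Flat A (MvPolynomial (Fin l) A ⧸ I)) (hw₀ : 0 < w₀) (hw : ∀ i, 0 < w i)
    (h : ∀ q, Δ.fibreGrHom I w q = 0 → Δ.totalGrHom I w₀ w (rename Fin.succ q) = 0) :
    Δ.IsCanonicallyTrivial I w₀ w := by
  rw [isCanonicallyTrivial_iff _ _ hw₀ hw]
  refine fun p => ⟨fun hp => ?_, Δ.totalGrHom_of_productHom I h⟩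
  rw [productHom_eq_zero_iff]
  intro j
  induction j generalizing p with
  | zero => exact Δ.fibreGrHom_tCoeff_zero I hp
  | succ j ih =>
    obtain ⟨g, hg⟩ := exists_eq_X_mul (p := p - rename Fin.succ (tCoeff 0 p))
      (by rw [map_sub, tCoeff_zero_rename, sub_self])
    have hg0 : Δ.totalGrHom I w₀ w (X 0 * g) = 0 := by
      rw [← hg, map_sub, hp, h _ (Δ.fibreGrHom_tCoeff_zero I hp), sub_zero]
    have e : tCoeff (j + 1) p = tCoeff j g := by
      rw [← tCoeff_succ_X_mul j g, ← hg, map_sub, tCoeff_succ_rename, sub_zero]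
    rw [e]
    exact ih g (hL.totalGrHom_of_X_mul Δ hflat hw₀ hw hg0)

theorem HasLifts.hasCentralFibre (hL : Δ.HasLifts I w₀ w) (hw₀ : 0 < w₀) (hw : ∀ i, 0 < w i) :
    Δ.HasCentralFibre I w₀ w := by
  let f : MvPolynomial (Fin (l + 1)) k →ₐ[k] Δ.TotalGr I w₀ w ⧸ Ideal.span {Δ.tBar I w₀ w} :=
    (Ideal.Quotient.mkₐ k _).comp (Δ.totalGrHom I w₀ w)
  let g : MvPolynomial (Fin (l + 1)) k →ₐ[k] Δ.FibreGr I w :=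
    ((Polynomial.aeval (0 : Δ.FibreGr I w)).restrictScalars k).comp (Δ.productHom I w)
  have hg : ∀ p, g p = Δ.fibreGrHom I w (tCoeff 0 p) := by
    intro p
    rw [← coeff_productHom, Polynomial.coeff_zero_eq_aeval_zero]
    rfl
  have hfs : Function.Surjective f :=
    (Ideal.Quotient.mkₐ_surjective k _).comp (Δ.totalGrHom_surjective I hw₀ hw)
  have hgs : Function.Surjective g := by
    intro y
    obtain ⟨q, rfl⟩ := Δ.fibreGrHom_surjective I hw y
    exact ⟨rename Fin.succ q, by rw [hg, tCoeff_zero_rename]⟩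
  obtain ⟨e, he⟩ := exists_algEquiv_of_ker_eq hfs hgs fun p => by
    rw [hg]
    change Ideal.Quotient.mk _ (Δ.totalGrHom I w₀ w p) = 0 ↔ _
    rw [Ideal.Quotient.eq_zero_iff_mem, Ideal.mem_span_singleton']
    constructor
    · rintro ⟨a, ha⟩
      obtain ⟨a, rfl⟩ := Δ.totalGrHom_surjective I hw₀ hw a
      have := Δ.fibreGrHom_tCoeff_zero I (p := p - X 0 * a)
        (by rw [map_sub, map_mul, totalGrHom_X_zero, ← ha, mul_comm, sub_self])
      rwa [map_sub, tCoeff_zero_X_mul, sub_zero] at this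
    · intro hp
      choose r hr hr0 hrp using fun m => hL.exists_tCoeff_zero_eq Δ hw₀ hw
        (weightedHomogeneousComponent_isWeightedHomogeneous m (tCoeff 0 p))
        (Δ.fibreGrHom_component I hp m)
      obtain ⟨a, ha⟩ := exists_eq_X_mul (p := p - ∑ m ∈ (weightedHomogeneousComponent_finsupp
        (w := w) (tCoeff 0 p)).toFinset, r m) (by
          rw [map_sub, map_sum, Finset.sum_congr rfl fun m _ => hrp m, ← finsum_eq_sum,
            sum_weightedHomogeneousComponent, sub_self])
      refine ⟨Δ.totalGrHom I w₀ w a, ?_⟩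
      rw [mul_comm, ← totalGrHom_X_zero, ← map_mul, ← ha, map_sub, map_sum,
        Finset.sum_eq_zero fun m _ => hr0 m, sub_zero]
  refine ⟨e, fun i => ?_⟩
  rw [← totalGrHom_X_succ]
  refine (he (X i.succ)).trans ?_
  rw [hg, ← rename_X, tCoeff_zero_rename, fibreGrHom_X]

/-- Filtering by the degree in which `t` has a smaller weight `v₀` degenerates `𝒲` to `𝔸¹_t × W`:
of two monomials of the same `(w₀, w)`-weight the one with the smaller power of `t` has the larger
degree. -/
theorem HasLifts.isTopDegeneration (hL : Δ.HasLifts I w₀ w)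
    (hflat : Module.Flat A (MvPolynomial (Fin l) A ⧸ I)) (hw₀ : 0 < w₀) (hw : ∀ i, 0 < w i)
    {v₀ : ℝ≥0} (hv : v₀ < w₀) :
    IsTopDegeneration (allWeights v₀ w) 
      (Δ.totalGrHom I w₀ w : MvPolynomial (Fin (l + 1)) k →+* Δ.TotalGr I w₀ w)
      (Δ.productHom I w : MvPolynomial (Fin (l + 1)) k →+* (Δ.FibreGr I w)[X]) where
  surjective_left := Δ.totalGrHom_surjective I hw₀ hw
  surjective_right := Δ.productHom_surjective I hw
  homogeneous q c hq := by
    rw [RingHom.coe_coe, productHom_eq_zero_iff] at hq ⊢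
    intro j
    rcases le_or_gt (j * v₀) c with hj | hj
    · obtain ⟨n, rfl⟩ := exists_add_of_le hj
      rw [tCoeff_weightedHomogeneousComponent]
      exact Δ.fibreGrHom_component I (hq j) n
    · rw [tCoeff_weightedHomogeneousComponent_of_lt hj, map_zero]
  symb_ker p c hpc hp := by
    rw [RingHom.coe_coe] at hp
    rw [RingHom.coe_coe, productHom_eq_zero_iff]
    intro j
    rcases le_or_gt (j * v₀) c with hj | hj
    · obtain ⟨n, rfl⟩ := exists_add_of_le hj
      rw [tCoeff_weightedHomogeneousComponent, ← tCoeff_weightedHomogeneousComponent (w₀ := w₀)]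
      refine hL.fibreGrHom_tCoeff Δ hflat hw₀ hw j (Δ.totalGrHom_component I hp _) fun i hi => ?_
      -- a term `tⁱ z^d` with `i < j` would have larger weight than `c` when `t` has weight `v₀`
      ext d
      rw [coeff_tCoeff, coeff_zero]
      by_contra hne
      have h1 := weightedHomogeneousComponent_isWeightedHomogeneous (w := allWeights w₀ w)
        (j * w₀ + n) p hne
      have h2 : Finsupp.weight (allWeights v₀ w) (d.cons i) ≤ j * v₀ + n := by
        refine hpc _ fun h0 => hne ?_
        classical
        rw [coeff_weightedHomogeneousComponent, h0, ite_self]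
      rw [weight_cons] at h1 h2
      have h3 : (i : ℝ) * w₀ + Finsupp.weight w d = j * w₀ + n := by exact_mod_cast h1
      have h4 : (i : ℝ) * v₀ + Finsupp.weight w d ≤ j * v₀ + n := by exact_mod_cast h2
      have h5 : (i : ℝ) < j := by exact_mod_cast hi
      have h6 : (v₀ : ℝ) < w₀ := hv
      nlinarith [mul_pos (sub_pos.mpr h5) (sub_pos.mpr h6)]
    · rw [tCoeff_weightedHomogeneousComponent_of_lt hj, map_zero]
  ker_symb q c hqc hq := by
    rw [RingHom.coe_coe, productHom_eq_zero_iff] at hq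
    have key : ∀ j, ∃ r, Δ.totalGrHom I w₀ w r = 0 ∧
        X 0 ^ j * rename Fin.succ (tCoeff j q) - X 0 ^ j * r ∈
          weightSupported k (allWeights v₀ w) (Set.Iio c) := by
      intro j
      by_cases hj0 : tCoeff j q = 0
      · exact ⟨0, map_zero _, by simp [hj0]⟩
      have hle : j * v₀ ≤ c := by
        by_contra hlt
        refine hj0 ?_
        rw [← hqc.weightedHomogeneousComponent_same]
        exact tCoeff_weightedHomogeneousComponent_of_lt (not_le.mp hlt) q
      obtain ⟨n, rfl⟩ := exists_add_of_le hle
      have hn : IsWeightedHomogeneous w (tCoeff j q) n := by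
        rw [← hqc.weightedHomogeneousComponent_same, tCoeff_weightedHomogeneousComponent]
        exact weightedHomogeneousComponent_isWeightedHomogeneous _ _
      obtain ⟨r, hrn, hr, hrq⟩ := hL.exists_tCoeff_zero_eq Δ hw₀ hw hn (hq j)
      refine ⟨r, hr, ?_⟩
      have hX : IsWeightedHomogeneous (allWeights v₀ w) (X 0 ^ j : MvPolynomial (Fin (l + 1)) k)
          (j * v₀) := by
        simpa using (isWeightedHomogeneous_X k (allWeights v₀ w) 0).pow j
      rw [← mul_sub]
      refine mul_mem_weightSupported (r := {j * v₀}) (s := Set.Iio n) ?_ hX ?_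
      · rintro a rfl b hb
        exact Set.mem_Iio.mpr (add_lt_add_right (Set.mem_Iio.mp hb) _)
      · -- the terms of `r` that involve `t` become lighter
        intro d hd
        rw [← d.cons_tail, coeff_sub, ← coeff_tCoeff, ← coeff_tCoeff] at hd
        rw [← d.cons_tail, Set.mem_Iio, weight_cons]
        rcases Nat.eq_zero_or_pos (d 0) with h | h
        · rw [h, tCoeff_zero_rename, hrq, sub_self] at hd
          exact absurd rfl hd
        · obtain ⟨i, hi⟩ := Nat.exists_eq_add_of_le' h
          rw [hi, tCoeff_succ_rename, coeff_zero, zero_sub, neg_ne_zero, coeff_tCoeff] at hd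
          have h1 := hrn hd
          rw [weight_cons] at h1
          rw [hi, ← h1]
          gcongr
    choose r hr hrq using key
    refine ⟨∑ j ∈ (finSuccEquiv k l q).support, X 0 ^ j * r j, ?_, ?_⟩
    · rw [RingHom.coe_coe, map_sum]
      exact Finset.sum_eq_zero fun j _ => by rw [map_mul, hr, mul_zero]
    · conv => arg 2; arg 1; rw [← sum_X_pow_mul_rename_tCoeff q]
      rw [← Finset.sum_sub_distrib]
      exact Submodule.sum_mem _ fun j _ => hrq j

theorem HasLifts.isDomain (hL : Δ.HasLifts I w₀ w)
    (hflat : Module.Flat A (MvPolynomial (Fin l) A ⧸ I)) (hw₀ : 0 < w₀) (hw : ∀ i, 0 < w i)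
    (hW : IsDomain (Δ.FibreGr I w)) : IsDomain (Δ.TotalGr I w₀ w) :=
  (hL.isTopDegeneration Δ hflat hw₀ hw (half_lt_self hw₀)).isDomain
    (allWeights_pos (half_pos hw₀) hw)

theorem isNoetherianRing_fibreGr (hw : ∀ i, 0 < w i) : IsNoetherianRing (Δ.FibreGr I w) :=
  isNoetherianRing_of_surjective _ _ (Δ.fibreGrHom I w : MvPolynomial (Fin l) k →+* _)
    (Δ.fibreGrHom_surjective I hw)

theorem HasLifts.isIntegrallyClosed (hL : Δ.HasLifts I w₀ w)
    (hflat : Module.Flat A (MvPolynomial (Fin l) A ⧸ I)) (hw₀ : 0 < w₀) (hw : ∀ i, 0 < w i)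
    (hW : IsDomain (Δ.FibreGr I w)) (hWnormal : IsIntegrallyClosed (Δ.FibreGr I w)) :
    IsIntegrallyClosed (Δ.TotalGr I w₀ w) := by
  have := Δ.isNoetherianRing_fibreGr (I := I) hw
  exact (hL.isTopDegeneration Δ hflat hw₀ hw (half_lt_self hw₀)).isIntegrallyClosed
    (allWeights_pos (half_pos hw₀) hw)

theorem finiteType_totalGr (hw₀ : 0 < w₀) (hw : ∀ i, 0 < w i) :
    Algebra.FiniteType k (Δ.TotalGr I w₀ w) :=
  Algebra.FiniteType.of_surjective (Δ.totalGrHom I w₀ w) (Δ.totalGrHom_surjective I hw₀ hw)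

end PointedCurve

/-! ### The critical weight -/

namespace PointedCurve

open MvPolynomial Filter Topology

variable {k A : Type*} [Field k] [CommRing A] [IsDomain A] [Algebra k A] (Δ : PointedCurve k A)
variable {l : ℕ} (I : Ideal (MvPolynomial (Fin l) A)) (w₀ : ℝ≥0) (w : Fin l → ℝ≥0)

/-- The homogeneous equation `q` of degree `n` is the initial form of the restriction to the
central fibre of an equation of `𝒳` of weight at least `n`. -/
def HasInitialLift (q : MvPolynomial (Fin l) k) (n : ℝ≥0) : Prop :=
  ∃ G ∈ Δ.totalGermIdeal I, (n : ℝ≥0∞) ≤ weight (allWeights w₀ w) (expand (Δ.totalExp l) G) ∧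
    (n : ℝ≥0∞) < weight w (expand (fibreExp k l) (Δ.toFibre l G) - (q : MvPowerSeries (Fin l) k))

variable {w₀ w}

theorem coe_rename_succ (q : MvPolynomial (Fin l) k) :
    restrictSeries k l (rename Fin.succ q : MvPolynomial (Fin (l + 1)) k) =
      (q : MvPowerSeries (Fin l) k) := by
  rw [← coe_tCoeff_zero, tCoeff_zero_rename]

theorem coeff_cons_succ_rename (q : MvPolynomial (Fin l) k) (j : ℕ) (d : Fin l →₀ ℕ) :
    MvPowerSeries.coeff (d.cons (j + 1))
      ((rename Fin.succ q : MvPolynomial (Fin (l + 1)) k) : MvPowerSeries (Fin (l + 1)) k) = 0 := by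
  rw [coeff_coe, ← coeff_tCoeff, tCoeff_succ_rename, coeff_zero]

theorem hasInitialLift_zero (n : ℝ≥0) : Δ.HasInitialLift I w₀ w 0 n :=
  ⟨0, zero_mem _, by simp [weight_zero], by simp [weight_zero]⟩

variable {I}

theorem HasInitialLift.add {q q' : MvPolynomial (Fin l) k} {n : ℝ≥0}
    (h : Δ.HasInitialLift I w₀ w q n) (h' : Δ.HasInitialLift I w₀ w q' n) :
    Δ.HasInitialLift I w₀ w (q + q') n := by
  obtain ⟨G, hG, hGw, hGq⟩ := h
  obtain ⟨G', hG', hGw', hGq'⟩ := h'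
  refine ⟨G + G', add_mem hG hG', ?_, ?_⟩
  · rw [map_add]
    exact (le_min hGw hGw').trans (min_weight_le_weight_add _ _ _)
  · rw [map_add, map_add, coe_add, add_sub_add_comm]
    exact (lt_min hGq hGq').trans_le (min_weight_le_weight_add _ _ _)

theorem HasInitialLift.mul {p q : MvPolynomial (Fin l) k} {a n : ℝ≥0}
    (hp : IsWeightedHomogeneous w p a) (h : Δ.HasInitialLift I w₀ w q n) :
    Δ.HasInitialLift I w₀ w (p * q) (a + n) := by
  obtain ⟨G, hG, hGw, hGq⟩ := h
  refine ⟨(Δ.isCoordinateExpansion_totalExp l).coordEval (rename Fin.succ p) * G,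
    Ideal.mul_mem_left _ _ hG, ?_, ?_⟩
  · rw [map_mul, IsCoordinateExpansion.expand_coordEval, ENNReal.coe_add]
    exact (add_le_add
      (le_weight_coe_of_isWeightedHomogeneous (isWeightedHomogeneous_rename_succ hp)) hGw).trans
      (weight_add_weight_le_weight_mul _ _ _)
  · rw [expand_toFibre, map_mul, map_mul, IsCoordinateExpansion.expand_coordEval, coe_rename_succ,
      coe_mul, ← mul_sub, ← expand_toFibre, ENNReal.coe_add]
    exact (ENNReal.add_lt_add_of_le_of_lt ENNReal.coe_ne_top
      (le_weight_coe_of_isWeightedHomogeneous hp) hGq).trans_le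
      (weight_add_weight_le_weight_mul _ _ _)

theorem hasInitialLift_of_totalGrHom {q : MvPolynomial (Fin l) k} {n : ℝ≥0}
    (hq : IsWeightedHomogeneous w q n) (h : Δ.totalGrHom I w₀ w (rename Fin.succ q) = 0) :
    Δ.HasInitialLift I w₀ w q n := by
  have hq' := isWeightedHomogeneous_rename_succ (w₀ := w₀) hq
  obtain ⟨G, hG, hlt⟩ := (Δ.totalGrHom_eq_zero_iff I hq').mp h
  refine ⟨G, hG, ?_, ?_⟩
  · have := (le_min hlt.le (le_weight_coe_of_isWeightedHomogeneous hq')).trans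
      (min_weight_le_weight_add _ _ _)
    rwa [sub_add_cancel] at this
  · rw [expand_toFibre, ← coe_rename_succ, ← map_sub]
    exact hlt.trans_le (weight_le_weight_restrictSeries _)

/-- A lift of `q` makes `q` an initial form of an equation of `𝒳` once the weight of `t` is so
large that the terms of the lift that involve `t` do not contribute. -/
theorem totalGrHom_rename_of_lift (hw₀ : 0 < w₀) (hw : ∀ i, 0 < w i) {q : MvPolynomial (Fin l) k}
    {n : ℝ≥0} (hq : IsWeightedHomogeneous w q n) {G : Δ.TotalRing l} (hG : G ∈ Δ.totalGermIdeal I)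
    (hlt : (n : ℝ≥0∞) <
      weight w (expand (fibreExp k l) (Δ.toFibre l G) - (q : MvPowerSeries (Fin l) k)))
    (h : ∀ (j : ℕ) (d : Fin l →₀ ℕ),
      MvPowerSeries.coeff (d.cons (j + 1)) (expand (Δ.totalExp l) G) ≠ 0 →
      n < Finsupp.weight (allWeights w₀ w) (d.cons (j + 1))) :
    Δ.totalGrHom I w₀ w (rename Fin.succ q) = 0 := by
  refine (Δ.totalGrHom_eq_zero_iff I (isWeightedHomogeneous_rename_succ hq)).mpr ⟨G, hG, ?_⟩
  rw [coe_lt_weight_iff (allWeights_pos hw₀ hw)]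
  intro e he
  rw [← e.cons_tail] at he ⊢
  rcases Nat.eq_zero_or_pos (e 0) with h0 | h0
  · rw [h0] at he ⊢
    rw [← coeff_restrictSeries, map_sub, ← expand_toFibre, coe_rename_succ] at he
    rw [weight_cons]
    simpa using (coe_lt_weight_iff hw).mp hlt _ he
  · obtain ⟨j, hj⟩ := Nat.exists_eq_add_of_le' h0
    rw [hj] at he ⊢
    rw [map_sub, coeff_cons_succ_rename, sub_zero] at he
    exact h _ _ he

/-- Increasing the weight of `t` moves the terms of a lift that involve `t` out of the initial
form. -/
theorem HasInitialLift.totalGrHom_of_lt (hw : ∀ i, 0 < w i) {q : MvPolynomial (Fin l) k}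
    {n v₀ : ℝ≥0} (hq : IsWeightedHomogeneous w q n) (h : Δ.HasInitialLift I w₀ w q n)
    (hv : w₀ < v₀) : Δ.totalGrHom I v₀ w (rename Fin.succ q) = 0 := by
  obtain ⟨G, hG, hGw, hGq⟩ := h
  refine Δ.totalGrHom_rename_of_lift (hv.trans_le' (zero_le)) hw hq hG hGq fun j d hd => ?_
  refine (coe_le_weight_iff.mp hGw _ hd).trans_lt ?_
  rw [weight_cons, weight_cons]
  gcongr

/-- If `t` is heavier than `q`, any lift will do. -/
theorem totalGrHom_rename_of_degree_lt (hw : ∀ i, 0 < w i) {q : MvPolynomial (Fin l) k} {n : ℝ≥0}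
    (hq : IsWeightedHomogeneous w q n) (hq0 : Δ.fibreGrHom I w q = 0) (hn : n < w₀) :
    Δ.totalGrHom I w₀ w (rename Fin.succ q) = 0 := by
  obtain ⟨f, hf, hlt⟩ := (Δ.fibreGrHom_eq_zero_iff I hq).mp hq0
  rw [← map_toFibre_totalGermIdeal] at hf
  obtain ⟨G, hG, rfl⟩ := (Ideal.mem_map_iff_of_surjective _ Δ.toFibre_surjective).mp hf
  refine Δ.totalGrHom_rename_of_lift (hn.trans_le' (zero_le)) hw hq hG hlt fun j d _ => ?_
  refine hn.trans_le ?_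
  rw [weight_cons, Nat.cast_succ, add_one_mul, add_right_comm]
  exact le_add_self

theorem continuous_weight_allWeights (e : Fin (l + 1) →₀ ℕ) :
    Continuous fun v : ℝ≥0 => Finsupp.weight (allWeights v w) e := by
  rw [← e.cons_tail]
  simp only [weight_cons]
  fun_prop

/-- Being an initial form of an equation of `𝒳` is an open condition on the weight of `t`, because
only finitely many monomials matter. -/
theorem eventually_totalGrHom_rename (hw₀ : 0 < w₀) (hw : ∀ i, 0 < w i) {q : MvPolynomial (Fin l) k}
    {n : ℝ≥0} (hq : IsWeightedHomogeneous w q n)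
    (h : Δ.totalGrHom I w₀ w (rename Fin.succ q) = 0) :
    ∀ᶠ v in 𝓝 w₀, Δ.totalGrHom I v w (rename Fin.succ q) = 0 := by
  obtain ⟨G, hG, hlt⟩ := (Δ.totalGrHom_eq_zero_iff I (isWeightedHomogeneous_rename_succ hq)).mp h
  rw [coe_lt_weight_iff (allWeights_pos hw₀ hw)] at hlt
  have hfin := finite_weight_le (allWeights_pos (half_pos hw₀) hw) n
  have hev : ∀ᶠ v in 𝓝 w₀,
      ∀ e ∈ {e : Fin (l + 1) →₀ ℕ | Finsupp.weight (allWeights (w₀ / 2) w) e ≤ n},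
      n < Finsupp.weight (allWeights w₀ w) e → n < Finsupp.weight (allWeights v w) e := by
    refine (Filter.eventually_all_finite hfin).mpr fun e _ => ?_
    by_cases he : n < Finsupp.weight (allWeights w₀ w) e
    · filter_upwards [(continuous_weight_allWeights e).continuousAt.eventually_const_lt he]
        with v hv _
      exact hv
    · exact Eventually.of_forall fun v h => absurd h he
  filter_upwards [hev, eventually_gt_nhds (half_lt_self hw₀)] with v hv hlow
  refine Δ.totalGrHom_rename_of_lift (hlow.trans_le' (zero_le)) hw hq hG ?_ fun j d hd => ?_
  · rw [expand_toFibre, ← coe_rename_succ, ← map_sub]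
    exact ((coe_lt_weight_iff (allWeights_pos hw₀ hw)).mpr hlt).trans_le
      (weight_le_weight_restrictSeries _)
  · have h1 := hlt (d.cons (j + 1)) (by rwa [map_sub, coeff_cons_succ_rename, sub_zero])
    by_cases h2 : Finsupp.weight (allWeights (w₀ / 2) w) (d.cons (j + 1)) ≤ n
    · exact hv _ h2 h1
    · refine (not_le.mp h2).trans_le ?_
      rw [weight_cons, weight_cons]
      gcongr

/-- Liftability passes to limits from above, because only finitely many monomials matter. -/
theorem hasInitialLift_of_forall_gt (hw₀ : 0 < w₀) (hw : ∀ i, 0 < w i) {q : MvPolynomial (Fin l) k}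
    {n : ℝ≥0} (hq : IsWeightedHomogeneous w q n)
    (h : ∀ v, w₀ < v → Δ.totalGrHom I v w (rename Fin.succ q) = 0) :
    Δ.HasInitialLift I w₀ w q n := by
  have hfin := (finite_weight_le (allWeights_pos hw₀ hw) n).subset
    (t := {e : Fin (l + 1) →₀ ℕ | Finsupp.weight (allWeights w₀ w) e < n}) fun e he =>
      (show Finsupp.weight (allWeights w₀ w) e < n from he).le
  have hev : ∀ᶠ v in 𝓝 w₀, ∀ e ∈ {e : Fin (l + 1) →₀ ℕ | Finsupp.weight (allWeights w₀ w) e < n},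
      Finsupp.weight (allWeights v w) e < n :=
    (Filter.eventually_all_finite hfin).mpr fun e he =>
      (continuous_weight_allWeights e).continuousAt.eventually_lt_const he
  obtain ⟨v, hv, hgt⟩ := ((hev.filter_mono nhdsWithin_le_nhds).and
    (self_mem_nhdsWithin (a := w₀) (s := Set.Ioi w₀))).exists
  obtain ⟨G, hG, hGw, hGq⟩ := Δ.hasInitialLift_of_totalGrHom hq (h v hgt)
  refine ⟨G, hG, coe_le_weight_iff.mpr fun e he => ?_, hGq⟩
  by_contra hlt
  exact absurd (hv e (not_le.mp hlt)) (not_lt.mpr (coe_le_weight_iff.mp hGw e he))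

variable (I w)

/-- The ideal of relations of the graded ring of the central fibre has finitely many homogeneous
generators. -/
theorem exists_homogeneous_generators : ∃ T : Finset (ℝ≥0 × MvPolynomial (Fin l) k),
    (∀ i ∈ T, IsWeightedHomogeneous w i.2 i.1 ∧ Δ.fibreGrHom I w i.2 = 0) ∧
      ∀ q, Δ.fibreGrHom I w q = 0 → q ∈ Ideal.span (Set.range fun i : T => i.1.2) := by
  classical
  obtain ⟨S, hS⟩ := (isNoetherianRing_iff_ideal_fg _).mp inferInstance
    (RingHom.ker (Δ.fibreGrHom I w))
  have hS0 : ∀ p ∈ S, Δ.fibreGrHom I w p = 0 := fun p hp => by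
    have := Ideal.subset_span (s := (S : Set (MvPolynomial (Fin l) k))) hp
    rwa [hS] at this
  refine ⟨S.biUnion fun p => (weightedHomogeneousComponent_finsupp (w := w) p).toFinset.image
    fun m => (m, weightedHomogeneousComponent w m p), fun i hi => ?_, fun q hq => ?_⟩
  · obtain ⟨p, hp, hi⟩ := Finset.mem_biUnion.mp hi
    obtain ⟨m, -, rfl⟩ := Finset.mem_image.mp hi
    exact ⟨weightedHomogeneousComponent_isWeightedHomogeneous m p,
      Δ.fibreGrHom_component I (hS0 p hp) m⟩
  · have hq' : q ∈ RingHom.ker (Δ.fibreGrHom I w) := hq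
    rw [← hS] at hq'
    refine Ideal.span_le.mpr (fun p hp => ?_) hq'
    rw [SetLike.mem_coe, ← sum_weightedHomogeneousComponent w p, finsum_eq_sum _
      (weightedHomogeneousComponent_finsupp p)]
    refine Ideal.sum_mem _ fun m hm => Ideal.subset_span ⟨⟨(m, _), ?_⟩, rfl⟩
    exact Finset.mem_biUnion.mpr ⟨p, hp, Finset.mem_image_of_mem _ hm⟩

variable {I w}

theorem hasLifts_of_generators (hw₀ : 0 < w₀) (hw : ∀ i, 0 < w i)
    {T : Finset (ℝ≥0 × MvPolynomial (Fin l) k)}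
    (hT : ∀ i ∈ T, IsWeightedHomogeneous w i.2 i.1 ∧ Δ.fibreGrHom I w i.2 = 0)
    (hspan : ∀ q, Δ.fibreGrHom I w q = 0 → q ∈ Ideal.span (Set.range fun i : T => i.1.2))
    (h : ∀ i ∈ T, Δ.HasInitialLift I w₀ w i.2 i.1) : Δ.HasLifts I w₀ w := by
  refine Δ.hasLifts_of_initial I hw₀ hw fun q m hq hq0 => ?_
  obtain ⟨c, rfl⟩ := Ideal.mem_span_range_iff_exists_fun.mp (hspan q hq0)
  change Δ.HasInitialLift I w₀ w _ m
  rw [← hq.weightedHomogeneousComponent_same, map_sum]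
  refine Finset.sum_induction _ (fun p => Δ.HasInitialLift I w₀ w p m)
    (fun _ _ => HasInitialLift.add Δ) (Δ.hasInitialLift_zero I m) fun i _ => ?_
  rw [mul_comm]
  rcases le_or_gt i.1.1 m with him | him
  · obtain ⟨a, rfl⟩ := exists_add_of_le him
    rw [weightedHomogeneousComponent_add_mul (hT i.1 i.2).1, mul_comm, add_comm]
    exact (h i.1 i.2).mul Δ (weightedHomogeneousComponent_isWeightedHomogeneous a _)
  · rw [weightedHomogeneousComponent_mul_eq_zero (hT i.1 i.2).1 _ him]
    exact Δ.hasInitialLift_zero I m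

/-- Canonical triviality says that the generators of the initial ideal of the central fibre, as
polynomials that do not involve `t`, belong to the initial ideal of `𝒳`. -/
theorem isCanonicallyTrivial_iff_generators (hflat : Module.Flat A (MvPolynomial (Fin l) A ⧸ I))
    (hw₀ : 0 < w₀) (hw : ∀ i, 0 < w i) {T : Finset (ℝ≥0 × MvPolynomial (Fin l) k)}
    (hT : ∀ i ∈ T, IsWeightedHomogeneous w i.2 i.1 ∧ Δ.fibreGrHom I w i.2 = 0)
    (hspan : ∀ q, Δ.fibreGrHom I w q = 0 → q ∈ Ideal.span (Set.range fun i : T => i.1.2)) :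
    Δ.IsCanonicallyTrivial I w₀ w ↔ ∀ i ∈ T, Δ.totalGrHom I w₀ w (rename Fin.succ i.2) = 0 := by
  constructor
  · intro h i hi
    exact ((Δ.isCanonicallyTrivial_iff I hw₀ hw).mp h _).mpr (Δ.productHom_rename I (hT i hi).2)
  · intro h
    have hL := Δ.hasLifts_of_generators hw₀ hw hT hspan fun i hi =>
      Δ.hasInitialLift_of_totalGrHom (hT i hi).1 (h i hi)
    refine hL.isCanonicallyTrivial Δ hflat hw₀ hw fun q hq => ?_
    obtain ⟨c, rfl⟩ := Ideal.mem_span_range_iff_exists_fun.mp (hspan q hq)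
    rw [map_sum, map_sum]
    refine Finset.sum_eq_zero fun i _ => ?_
    rw [map_mul, map_mul, h i.1 i.2, mul_zero]

/-- The weights of `t` for which `𝒲` is canonically trivial form an open up-set, and equations can
be lifted on its closure. -/
theorem exists_critical_weight (hflat : Module.Flat A (MvPolynomial (Fin l) A ⧸ I))
    (hw : ∀ i, 0 < w i) : ∃ wcri : ℝ≥0, 0 < wcri ∧
      (∀ w₀, wcri < w₀ → Δ.IsCanonicallyTrivial I w₀ w) ∧
      ((∃ w₀, 0 < w₀ ∧ ¬ Δ.IsCanonicallyTrivial I w₀ w) →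
        ∀ w₀, 0 < w₀ → (Δ.IsCanonicallyTrivial I w₀ w ↔ wcri < w₀)) ∧
      ∀ w₀, wcri ≤ w₀ → Δ.HasLifts I w₀ w := by
  obtain ⟨T, hT, hspan⟩ := Δ.exists_homogeneous_generators I w
  have hiff : ∀ {v : ℝ≥0}, 0 < v → (Δ.IsCanonicallyTrivial I v w ↔
      ∀ i ∈ T, Δ.totalGrHom I v w (rename Fin.succ i.2) = 0) := fun hv =>
    Δ.isCanonicallyTrivial_iff_generators hflat hv hw hT hspan
  have hlift : ∀ v, 0 < v → Δ.IsCanonicallyTrivial I v w → Δ.HasLifts I v w := fun v hv h =>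
    Δ.hasLifts_of_generators hv hw hT hspan fun i hi =>
      Δ.hasInitialLift_of_totalGrHom (hT i hi).1 ((hiff hv).mp h i hi)
  by_cases hall : ∀ v, 0 < v → Δ.IsCanonicallyTrivial I v w
  -- if `𝒲` is always trivial, any positive number is a critical weight
  · refine ⟨1, one_pos, fun v hv => hall v (one_pos.trans hv), ?_, fun v hv =>
      hlift v (one_pos.trans_le hv) (hall v (one_pos.trans_le hv))⟩
    rintro ⟨v, hv, h⟩
    exact absurd (hall v hv) h
  push Not at hall
  obtain ⟨v₁, hv₁, hnot⟩ := hall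
  have hup : ∀ {v v' : ℝ≥0}, 0 < v → Δ.IsCanonicallyTrivial I v w → v < v' →
      Δ.IsCanonicallyTrivial I v' w := fun hv h hvv' =>
    (hiff (hv.trans hvv')).mpr fun i hi =>
      (Δ.hasInitialLift_of_totalGrHom (hT i hi).1 ((hiff hv).mp h i hi)).totalGrHom_of_lt Δ hw
        (hT i hi).1 hvv'
  set S : Set ℝ≥0 := {v | 0 < v ∧ Δ.IsCanonicallyTrivial I v w} with hS
  have hne : S.Nonempty := by
    refine ⟨T.sup Prod.fst + 1, by positivity, (hiff (by positivity)).mpr fun i hi => ?_⟩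
    exact Δ.totalGrHom_rename_of_degree_lt hw (hT i hi).1 (hT i hi).2
      (lt_add_of_le_of_pos (Finset.le_sup (f := Prod.fst) hi) one_pos)
  have hbdd : BddBelow S := ⟨0, fun _ _ => zero_le⟩
  have hpos : 0 < sInf S := hv₁.trans_le <| le_csInf hne fun v hv => by
    by_contra hlt
    exact hnot (hup hv.1 hv.2 (not_le.mp hlt))
  have habove : ∀ v, sInf S < v → Δ.IsCanonicallyTrivial I v w := fun v hv => by
    obtain ⟨v', hv', hlt⟩ := exists_lt_of_csInf_lt hne hv
    exact hup hv'.1 hv'.2 hlt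
  refine ⟨sInf S, hpos, habove, fun _ v hv => ⟨fun h => ?_, habove v⟩, fun v hv => ?_⟩
  -- by openness, the infimum itself does not belong to `S`
  · have hev : ∀ᶠ v' in 𝓝 v, ∀ i ∈ T, Δ.totalGrHom I v' w (rename Fin.succ i.2) = 0 :=
      (Filter.eventually_all_finset T).mpr fun i hi =>
        Δ.eventually_totalGrHom_rename hv hw (hT i hi).1 ((hiff hv).mp h i hi)
    have : (𝓝[<] v).NeBot := nhdsLT_neBot_of_exists_lt ⟨0, hv⟩
    obtain ⟨v', ⟨h', hpos'⟩, hlt⟩ := (((hev.and (eventually_gt_nhds hv)).filter_mono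
      nhdsWithin_le_nhds).and (self_mem_nhdsWithin (a := v) (s := Set.Iio v))).exists
    exact (csInf_le hbdd ⟨hpos', (hiff hpos').mpr h'⟩).trans_lt hlt
  · refine Δ.hasLifts_of_generators (hpos.trans_le hv) hw hT hspan fun i hi => ?_
    refine Δ.hasInitialLift_of_forall_gt (hpos.trans_le hv) hw (hT i hi).1 fun v' hv' => ?_
    exact (hiff ((hpos.trans_le hv).trans hv')).mp (habove v' (hv.trans_lt hv')) i hi

end PointedCurve

/-! ### Faithful flatness and the torus action -/

theorem flat_of_injective {R S : Type*} [CommRing R] [IsDedekindDomain R] [CommRing S] [IsDomain S]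
    {f : R →+* S} (hf : Function.Injective f) : f.Flat := by
  algebraize [f]
  have : FaithfulSMul R S := (faithfulSMul_iff_algebraMap_injective _ _).mpr hf
  exact (inferInstance : Module.Flat R S)

namespace PointedCurve

open MvPolynomial

variable {k A : Type*} [Field k] [CommRing A] [IsDomain A] [Algebra k A] (Δ : PointedCurve k A)
variable {l : ℕ} (I : Ideal (MvPolynomial (Fin l) A)) (w₀ : ℝ≥0) (w : Fin l → ℝ≥0)

/-- The restriction to the zero section, `t ↦ t` and `zᵢ ↦ 0`. -/
def sectionHom (k : Type*) [Field k] (l : ℕ) : MvPolynomial (Fin (l + 1)) k →ₐ[k] k[X] :=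
  (Polynomial.mapAlgHom (aeval (0 : Fin l → k))).comp (finSuccEquiv k l).toAlgHom

theorem coeff_sectionHom (p : MvPolynomial (Fin (l + 1)) k) (j : ℕ) :
    (sectionHom k l p).coeff j = coeff (Finsupp.cons j 0) p := by
  rw [← coeff_tCoeff, tCoeff_apply, ← constantCoeff_eq]
  simp [sectionHom]

variable {w₀ w}

/-- The initial forms of the equations of `𝒳` vanish on the zero section, since the equations do. -/
theorem sectionHom_eq_zero (hw₀ : 0 < w₀) (hw : ∀ i, 0 < w i)
    (hsection : I ≤ Ideal.span (Set.range (X : Fin l → MvPolynomial (Fin l) A)))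
    {p : MvPolynomial (Fin (l + 1)) k} (hp : Δ.totalGrHom I w₀ w p = 0) : sectionHom k l p = 0 := by
  classical
  ext j
  rw [coeff_sectionHom, Polynomial.coeff_zero]
  by_contra hne
  obtain ⟨F, hF, hlt⟩ := (Δ.totalGrHom_eq_zero_iff I
    (weightedHomogeneousComponent_isWeightedHomogeneous _ p)).mp
    (Δ.totalGrHom_component I hp (Finsupp.weight (allWeights w₀ w) (Finsupp.cons j 0)))
  refine lt_irrefl _ ((coe_lt_weight_iff (allWeights_pos hw₀ hw)).mp hlt (Finsupp.cons j 0) ?_)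
  rw [map_sub, Δ.coeff_expand_eq_zero_of_section I hsection hF (by simp), coeff_coe,
    coeff_weightedHomogeneousComponent, if_pos rfl, zero_sub]
  exact neg_ne_zero.mpr hne

/-- The zero section is a section of `𝒲 → 𝔸¹_t`, so this morphism is surjective and `k[t]` embeds
into the coordinate ring of `𝒲`, which is a domain, hence torsion-free. -/
theorem structureHom_faithfullyFlat (hw₀ : 0 < w₀) (hw : ∀ i, 0 < w i)
    (hsection : I ≤ Ideal.span (Set.range (X : Fin l → MvPolynomial (Fin l) A)))
    [IsDomain (Δ.TotalGr I w₀ w)] : (Δ.structureHom I w₀ w).FaithfullyFlat := by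
  let r : Δ.TotalGr I w₀ w →ₐ[k] k[X] := AlgHom.liftOfSurjective _
    (Δ.totalGrHom_surjective I hw₀ hw) (sectionHom k l)
    fun p hp => Δ.sectionHom_eq_zero I hw₀ hw hsection hp
  have hr' : ∀ p, r (Δ.totalGrHom I w₀ w p) = sectionHom k l p :=
    AlgHom.liftOfSurjective_apply _ _ _ _
  have hr : (r : Δ.TotalGr I w₀ w →+* k[X]).comp (Δ.structureHom I w₀ w) = RingHom.id _ := by
    have : r.comp (Polynomial.aeval (Δ.tBar I w₀ w)) = AlgHom.id k k[X] := by
      refine Polynomial.algHom_ext ?_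
      rw [AlgHom.comp_apply, Polynomial.aeval_X, ← totalGrHom_X_zero, hr']
      simp [sectionHom, finSuccEquiv_X_zero]
    exact congrArg AlgHom.toRingHom this
  have hinj : Function.Injective (Δ.structureHom I w₀ w) :=
    Function.LeftInverse.injective (g := r) fun q => RingHom.congr_fun hr q
  rw [RingHom.FaithfullyFlat.iff_flat_and_comap_surjective]
  constructor
  · exact flat_of_injective hinj
  · intro P
    refine ⟨PrimeSpectrum.comap (r : Δ.TotalGr I w₀ w →+* k[X]) P, ?_⟩
    rw [← PrimeSpectrum.comap_comp_apply, hr, PrimeSpectrum.comap_id]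

variable (w₀ w) in
/-- If `M` is embedded into `ℝ` so that `d` gives the weights, then the components for the grading
by `M` are components for the weights, or zero. -/
theorem totalGrHom_component_of_injective {M : Type*} [AddCommGroup M] {d : Fin (l + 1) → M}
    {φ : M →+ ℝ} (hφ : Function.Injective φ) (hd : ∀ j, φ (d j) = allWeights w₀ w j)
    {p : MvPolynomial (Fin (l + 1)) k} (hp : Δ.totalGrHom I w₀ w p = 0) (m : M) :
    Δ.totalGrHom I w₀ w (weightedHomogeneousComponent d m p) = 0 := by
  classical
  have hwt : ∀ e : Fin (l + 1) →₀ ℕ,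
      φ (Finsupp.weight d e) = (Finsupp.weight (allWeights w₀ w) e : ℝ≥0) := by
    intro e
    simp [Finsupp.weight_apply, Finsupp.sum_fintype, hd]
  by_cases hm : ∃ m' : ℝ≥0, (m' : ℝ) = φ m
  · obtain ⟨m', hm'⟩ := hm
    have : weightedHomogeneousComponent d m p =
        weightedHomogeneousComponent (allWeights w₀ w) m' p := by
      ext e
      rw [coeff_weightedHomogeneousComponent, coeff_weightedHomogeneousComponent]
      refine if_congr ?_ rfl rfl
      rw [← hφ.eq_iff, hwt, ← hm', NNReal.coe_inj]
    rw [this]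
    exact Δ.totalGrHom_component I hp m'
  · have : weightedHomogeneousComponent d m p = 0 := by
      ext e
      rw [coeff_weightedHomogeneousComponent, coeff_zero, if_neg]
      rintro rfl
      exact hm ⟨_, (hwt e).symm⟩
    rw [this, map_zero]

/-- The grading by the weights as a coaction. -/
theorem actsWithWeights_of_injective (hw₀ : 0 < w₀) (hw : ∀ i, 0 < w i) {M : Type*} [AddCommGroup M]
    {d : Fin (l + 1) → M} {φ : M →+ ℝ} (hφ : Function.Injective φ)
    (hd : ∀ j, φ (d j) = allWeights w₀ w j) : Δ.ActsWithWeights I w₀ w M d := by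
  classical
  let ρ : Δ.TotalGr I w₀ w →ₐ[k] AddMonoidAlgebra (Δ.TotalGr I w₀ w) M :=
    AlgHom.liftOfSurjective _ (Δ.totalGrHom_surjective I hw₀ hw)
      (gradingHom (Δ.totalGrHom I w₀ w) d) fun p hp => by
        change gradingHom (Δ.totalGrHom I w₀ w) d p = 0
        ext m
        rw [coeff_gradingHom]
        exact Δ.totalGrHom_component_of_injective I w₀ w hφ hd hp m
  have hρ : ∀ p, ρ (Δ.totalGrHom I w₀ w p) = gradingHom (Δ.totalGrHom I w₀ w) d p :=
    AlgHom.liftOfSurjective_apply _ _ _ _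
  refine ⟨ρ, ⟨fun r => ?_, fun r m => ?_⟩, ?_, fun i => ?_⟩
  · obtain ⟨p, rfl⟩ := Δ.totalGrHom_surjective I hw₀ hw r
    rw [hρ]
    induction p using MvPolynomial.induction_on' with
    | monomial e c =>
      rw [gradingHom_monomial, AddMonoidAlgebra.coeff_single, Finsupp.sum_single_index rfl]
    | add p q hp hq =>
      rw [map_add, map_add, AddMonoidAlgebra.coeff_add,
        Finsupp.sum_add_index' (fun _ => rfl) (fun _ _ _ => rfl), hp, hq]
  · obtain ⟨p, rfl⟩ := Δ.totalGrHom_surjective I hw₀ hw r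
    rw [hρ, coeff_gradingHom, hρ]
    ext n
    rw [coeff_gradingHom, weightedHomogeneousComponent_of_mem
      (weightedHomogeneousComponent_isWeightedHomogeneous m p), AddMonoidAlgebra.coeff_single,
      Finsupp.single_apply]
    by_cases h : n = m
    · simp [h]
    · simp [h, Ne.symm h]
  · rw [← totalGrHom_X_zero, hρ]
    simp [gradingHom]
  · rw [← totalGrHom_X_succ, hρ]
    simp [gradingHom]

theorem isEquivariant (hw₀ : 0 < w₀) (hw : ∀ i, 0 < w i) : Δ.IsEquivariant I w₀ w := by
  refine ⟨Δ.actsWithWeights_of_injective I hw₀ hw (φ := (weightGroup w₀ w).subtype)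
    Subtype.val_injective fun _ => rfl, fun c n hc hn => ?_⟩
  refine Δ.actsWithWeights_of_injective I hw₀ hw
    (φ := (AddMonoidHom.mulLeft c).comp (Int.castAddHom ℝ)) (fun a b hab => ?_) fun j => (hn j).symm
  have h : (a : ℝ) = b := mul_left_cancel₀ hc.ne' hab
  exact_mod_cast h

end PointedCurve

/-! ### The weight valuation -/

namespace IsCoordinateExpansion

open MvPolynomial

variable {k τ P : Type*} [Field k] [CommRing P] [Algebra k P]
variable {E : P →+* MvPowerSeries τ k} {x : τ → P} (H : IsCoordinateExpansion E x)
  (I : Ideal P) {w : τ → ℝ≥0}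

include H

/-- By Krull's intersection theorem, the weights of the germs that restrict to a nonzero function
are bounded. -/
theorem exists_weight_lt_of_ne_zero [Finite τ] [IsNoetherianRing (AmbientRing E)]
    (w : τ → ℝ≥0) {f : Stalk E I} (hf : f ≠ 0) :
    ∃ C : ℝ≥0, ∀ F, restrict E I F = f → weight w (expand E F) < C := by
  have htop : H.coordIdeal ≠ ⊤ := by
    intro h
    have h1 : (1 : AmbientRing E) ∈ H.coordIdeal ^ 1 := by simp [h]
    have h2 := H.coordIdeal_pow_le (fun _ => 1) (a := 1) (fun _ => le_rfl) 1 h1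
    rw [mem_weightIdeal, map_one, coe_le_weight_iff] at h2
    simpa using h2 0 (by simp)
  have hinf := Ideal.iInf_pow_smul_eq_bot_of_isLocalRing (M := Stalk E I) _ htop
  obtain ⟨n, hn⟩ : ∃ n : ℕ, f ∉ H.coordIdeal ^ n • (⊤ : Submodule (AmbientRing E) (Stalk E I)) := by
    by_contra! h
    refine hf ((Submodule.mem_bot (AmbientRing E)).mp ?_)
    rw [← hinf]
    exact (Submodule.mem_iInf _).mpr h
  obtain ⟨b, hb, hwb⟩ : ∃ b : ℝ≥0, 0 < b ∧ ∀ i, w i ≤ b := by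
    obtain ⟨b, hb⟩ := (Set.finite_range w).bddAbove
    exact ⟨b + 1, by positivity, fun i => (hb ⟨i, rfl⟩).trans le_self_add⟩
  refine ⟨n * b, fun F hF => ?_⟩
  by_contra hle
  have hmem := H.mem_coordIdeal_pow_of_le_weight w hb hwb (not_lt.mp hle)
  refine hn ?_
  have : F • (1 : Stalk E I) = f := by
    rw [← hF]
    exact congrArg (restrict E I) (mul_one F)
  rw [← this]
  exact Submodule.smul_mem_smul hmem Submodule.mem_top

/-- Among the germs that restrict to a given function there is one of largest weight. -/
theorem exists_isGreatest_weight [Finite τ] [IsNoetherianRing (AmbientRing E)] (hw : ∀ i, 0 < w i)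
    (f : Stalk E I) :
    ∃ v, IsGreatest {m | ∃ F, restrict E I F = f ∧ m = weight w (expand E F)} v := by
  by_cases hf : f = 0
  · exact ⟨⊤, ⟨0, by rw [map_zero, hf], by rw [map_zero, weight_zero]⟩, fun _ _ => le_top⟩
  obtain ⟨C, hC⟩ := H.exists_weight_lt_of_ne_zero I w hf
  have hfin : {m | ∃ F, restrict E I F = f ∧ m = weight w (expand E F)}.Finite := by
    refine ((finite_weight_le hw C).image fun d => ((Finsupp.weight w d : ℝ≥0) : ℝ≥0∞)).subset ?_
    rintro _ ⟨F, hF, rfl⟩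
    have hlt := hC F hF
    have hF0 : expand E F ≠ 0 := by
      intro h0
      rw [h0, weight_zero] at hlt
      exact not_top_lt hlt
    obtain ⟨d, -, hd⟩ := exists_weight_eq hw hF0
    rw [hd] at hlt ⊢
    exact ⟨d, ENNReal.coe_le_coe.mp hlt.le, rfl⟩
  obtain ⟨F, hF⟩ := Ideal.Quotient.mk_surjective f
  obtain ⟨v, hv, hmax⟩ := hfin.exists_le_maximal (a := weight w (expand E F)) ⟨F, hF, rfl⟩
  exact ⟨v, hmax.prop, fun m hm => (le_total m v).elim id fun h => hmax.le_of_ge hm h⟩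

/-- The initial form of a germ vanishes in the graded ring if and only if the weight can be
increased without changing the restriction. -/
theorem grHom_eq_zero_iff_exists_lift [Finite τ] {p : MvPolynomial τ k} {m : ℝ≥0}
    (hp : p.IsWeightedHomogeneous w m) {F : AmbientRing E}
    (hF : (m : ℝ≥0∞) < weight w (expand E F - (p : MvPowerSeries τ k))) :
    H.grHom I w p = 0 ↔
      ∃ F', restrict E I F' = restrict E I F ∧ (m : ℝ≥0∞) < weight w (expand E F') := by
  rw [H.grHom_eq_zero_iff_of_isWeightedHomogeneous I w hp]
  constructor
  · rintro ⟨K, hK, hlt⟩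
    refine ⟨F - K, by rw [map_sub, Ideal.Quotient.eq_zero_iff_mem.mpr hK, sub_zero], ?_⟩
    rw [map_sub, ← sub_sub_sub_cancel_right _ _ (p : MvPowerSeries τ k)]
    exact (lt_min hF hlt).trans_le (min_weight_le_weight_sub _ _)
  · rintro ⟨F', hF', hlt⟩
    refine ⟨F - F', Ideal.Quotient.eq.mp hF'.symm, ?_⟩
    rw [map_sub, sub_right_comm]
    exact (lt_min hF hlt).trans_le (min_weight_le_weight_sub _ _)

/-- If the graded ring is a domain, the largest weight of a germ with a given restriction is a
valuation. -/
theorem exists_weightValuation [Finite τ] [IsNoetherianRing (AmbientRing E)] (hw : ∀ i, 0 < w i)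
    [IsDomain (Gr (k := k) E I w)] : ∃ v : AddValuation (Stalk E I) ℝ≥0∞,
      ∀ f, IsGreatest {m | ∃ F, restrict E I F = f ∧ m = weight w (expand E F)} (v f) := by
  choose v hv using fun f => H.exists_isGreatest_weight I hw f
  have hle : ∀ F, weight w (expand E F) ≤ v (restrict E I F) := fun F => (hv _).2 ⟨F, rfl, rfl⟩
  have h0 : v 0 = ⊤ := by
    have := hle 0
    rwa [map_zero, map_zero, weight_zero, top_le_iff] at this
  have h1 : v 1 = 0 := by
    by_contra hne
    obtain ⟨F, hF, hFv⟩ := (hv 1).1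
    refine one_ne_zero (α := Gr (k := k) E I w) ?_
    rw [← map_one (H.grHom I w)]
    refine (H.grHom_eq_zero_iff_exists_lift I (isWeightedHomogeneous_one k w) (F := 1) ?_).mpr
      ⟨F, by rw [hF, map_one], ?_⟩
    · simp [weight_zero]
    · rw [← hFv, ENNReal.coe_zero]
      exact pos_iff_ne_zero.mpr hne
  refine ⟨AddValuation.of v h0 h1 (fun f g => ?_) (fun f g => ?_), hv⟩
  · obtain ⟨F, rfl, hF⟩ := (hv f).1
    obtain ⟨G, rfl, hG⟩ := (hv g).1
    rw [hF, hG, ← map_add]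
    refine (min_weight_le_weight_add _ _ _).trans ?_
    rw [← map_add]
    exact hle _
  · by_cases hf : f = 0
    · rw [hf, zero_mul, h0, top_add]
    by_cases hg : g = 0
    · rw [hg, mul_zero, h0, add_top]
    -- the initial form of a germ of largest weight does not vanish in the graded ring
    have key : ∀ f : Stalk E I, f ≠ 0 → ∃ F, ∃ m : ℝ≥0, ∃ p : MvPolynomial τ k,
        restrict E I F = f ∧ v f = m ∧
        (m : ℝ≥0∞) ≤ weight w (expand E F) ∧ p.IsWeightedHomogeneous w m ∧
        (m : ℝ≥0∞) < weight w (expand E F - (p : MvPowerSeries τ k)) ∧ H.grHom I w p ≠ 0 := by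
      intro f hf
      obtain ⟨F, hF, hFv⟩ := (hv f).1
      obtain ⟨C, hC⟩ := H.exists_weight_lt_of_ne_zero I w hf
      obtain ⟨m, hm⟩ := WithTop.ne_top_iff_exists.mp ((hC F hF).trans_le le_top).ne
      have hlt := lt_weight_sub_homogPart hw hm.le
      have hp := isWeightedHomogeneous_homogPart hw m (expand E F)
      refine ⟨F, m, _, hF, hFv.trans hm.symm, hm.le, hp, hlt, fun h => ?_⟩
      obtain ⟨F', hF', hlt'⟩ := (H.grHom_eq_zero_iff_exists_lift I hp hlt).mp h
      have := hle F'
      rw [hF', hF, hFv, ← hm] at this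
      exact absurd hlt' (not_lt.mpr this)
    obtain ⟨F, m, p, rfl, hm, hFm, hp, hFp, hp0⟩ := key f hf
    obtain ⟨G, n, q, rfl, hn, hGn, hq, hGq, hq0⟩ := key g hg
    have hFG : ((m + n : ℝ≥0) : ℝ≥0∞) ≤ v (restrict E I F * restrict E I G) := by
      rw [← map_mul]
      refine le_trans ?_ (hle _)
      rw [map_mul, ENNReal.coe_add]
      exact (add_le_add hFm hGn).trans (weight_add_weight_le_weight_mul _ _ _)
    have hlt : ((m + n : ℝ≥0) : ℝ≥0∞) <
        weight w (expand E (F * G) - ((p * q : MvPolynomial τ k) : MvPowerSeries τ k)) := by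
      have e : expand E (F * G) - ((p * q : MvPolynomial τ k) : MvPowerSeries τ k) =
          expand E F * (expand E G - (q : MvPowerSeries τ k)) +
            (q : MvPowerSeries τ k) * (expand E F - (p : MvPowerSeries τ k)) := by
        rw [map_mul, coe_mul]
        ring
      rw [e]
      refine (lt_min ?_ ?_).trans_le (min_weight_le_weight_add _ _ _)
      · rw [ENNReal.coe_add]
        exact (ENNReal.add_lt_add_of_le_of_lt ENNReal.coe_ne_top hFm hGq).trans_le
          (weight_add_weight_le_weight_mul _ _ _)
      · rw [add_comm, ENNReal.coe_add]
        exact (ENNReal.add_lt_add_of_le_of_lt ENNReal.coe_ne_top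
          (le_weight_coe_of_isWeightedHomogeneous hq) hFp).trans_le
          (weight_add_weight_le_weight_mul _ _ _)
    rw [hm, hn, ← ENNReal.coe_add]
    refine le_antisymm (not_lt.mp fun hgt => ?_) hFG
    obtain ⟨K, hK, hKv⟩ := (hv (restrict E I F * restrict E I G)).1
    have := (H.grHom_eq_zero_iff_exists_lift I (hp.mul hq) hlt).mpr
      ⟨K, by rw [hK, map_mul], hKv ▸ hgt⟩
    rw [map_mul] at this
    exact mul_ne_zero hp0 hq0 this

end IsCoordinateExpansion

theorem PointedCurve.existsUnique_weightValuation {k A : Type*} [Field k] [CommRing A] [IsDomain A]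
    [Algebra k A] (Δ : PointedCurve k A) {l : ℕ} (I : Ideal (MvPolynomial (Fin l) A)) {w₀ : ℝ≥0}
    {w : Fin l → ℝ≥0} (hw₀ : 0 < w₀) (hw : ∀ i, 0 < w i) [IsDomain (Δ.TotalGr I w₀ w)] :
    ∃! v : AddValuation (Δ.TotalStalk I) ℝ≥0∞, Δ.IsWeightValuation I w₀ w v := by
  obtain ⟨v, hv⟩ := (Δ.isCoordinateExpansion_totalExp l).exists_weightValuation I
    (allWeights_pos hw₀ hw)
  exact ⟨v, hv, fun v' hv' => DFunLike.ext _ _ fun f => (hv' f).unique (hv f)⟩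

end

end Bubbling

theorem mainTheorem8 {k A : Type*} [Field k] [CharZero k] [CommRing A] [IsDomain A] [Algebra k A]
    (Δ : Bubbling.PointedCurve k A) (l : ℕ) (I : Ideal (MvPolynomial (Fin l) A))
    (hflat : Module.Flat A (MvPolynomial (Fin l) A ⧸ I))
    (hsection : I ≤ Ideal.span (Set.range (MvPolynomial.X : Fin l → MvPolynomial (Fin l) A)))
    (w : Fin l → NNReal) (hw : ∀ i, 0 < w i)
    (hW : IsDomain (Δ.FibreGr I w)) (hWnormal : IsIntegrallyClosed (Δ.FibreGr I w)) :
    ∃ wcri : NNReal, 0 < wcri ∧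
      (∀ w₀, wcri < w₀ → Δ.IsCanonicallyTrivial I w₀ w) ∧
      ((∃ w₀, 0 < w₀ ∧ ¬ Δ.IsCanonicallyTrivial I w₀ w) →
        ∀ w₀, 0 < w₀ → (Δ.IsCanonicallyTrivial I w₀ w ↔ wcri < w₀)) ∧
      (IsDomain (Δ.TotalGr I wcri w) ∧ IsIntegrallyClosed (Δ.TotalGr I wcri w) ∧
        Algebra.FiniteType k (Δ.TotalGr I wcri w) ∧
        (Δ.structureHom I wcri w).FaithfullyFlat ∧
        Δ.HasCentralFibre I wcri w ∧
        Δ.IsEquivariant I wcri w) ∧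
      ∀ w₀, wcri ≤ w₀ → ∃! v : AddValuation (Δ.TotalStalk I) ENNReal,
        Δ.IsWeightValuation I w₀ w v := by
  obtain ⟨wcri, hpos, htriv, hiff, hlift⟩ := Δ.exists_critical_weight hflat hw
  have hL := hlift wcri le_rfl
  have hdom := hL.isDomain Δ hflat hpos hw hW
  refine ⟨wcri, hpos, htriv, hiff, ⟨hdom, hL.isIntegrallyClosed Δ hflat hpos hw hW hWnormal,
    Δ.finiteType_totalGr hpos hw, Δ.structureHom_faithfullyFlat I hpos hw hsection,
    hL.hasCentralFibre Δ hpos hw, Δ.isEquivariant I hpos hw⟩, fun w₀ hw₀ => ?_⟩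
  have := (hlift w₀ hw₀).isDomain Δ hflat (hpos.trans_le hw₀) hw hW
  exact Δ.existsUnique_weightValuation I (hpos.trans_le hw₀) hw
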